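/- Let $G$ be a connected semisimple algebraic group over $\mathbb C$ with Lie algebra $\mathfrak g$. Fix a maximal torus and a Borel subgroup containing it, with Lie algebras $\mathfrak h\subset\mathfrak b$, put $\mathfrak u=[\mathfrak b,\mathfrak b]$ (the Lie algebra of the unipotent radical $U$ of the Borel subgroup), and let $\mathfrak h^r\subset\mathfrak h$ be the open subset of elements that are regular semisimple in $\mathfrak g$. Let $n\ge 2$. Let $\mathbf{Conn}^B_n$ be the scheme of connections $d+A$, $A=\sum_{k\ge -n}A_kz^k\,dz$ with $A_k\in\mathfrak g$, on the trivial $G$-bundle on the formal disk, such that $A_{-n}$ is regular semisimple and $A_k\in\mathfrak b$ for $-n\le k\le -1$. Let $G^U_n\subset G[[z]]$ be the group of loops $\exp(u_0+u_1z+\dots+u_{n-1}z^{n-1}+g_nz^n+g_{n+1}z^{n+1}+\dots)$ with $u_i\in\mathfrak u$ and $g_i\in\mathfrak g$. It acts on $\mathbf{Conn}^B_n$ by gauge transformations $g\cdot(d+A)=d+\operatorname{Ad}_g A-dg\,g^{-1}$. (1) Every element of $\mathbf{Conn}^B_n/G^U_n$ has a unique representative in $\mathbf{Conn}^B_n$ of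 the form $$d+\alpha_n\frac{dz}{z^n}+\dots+\alpha_1\frac{dz}{z}+\beta_0\,dz+\dots+\beta_{n-2}z^{n-2}\,dz,\qquad \alpha_i,\beta_i\in\mathfrak h .$$ The same holds for the points of $\mathbf{Conn}^B_n$ and $G^U_n$ over any commutative $\mathbb C$-algebra $R$, with $\mathfrak h$ replaced by $\mathfrak h\otimes R$. (2) The map that sends a class to the coefficients $(\alpha_n;\alpha_{n-1},\dots,\alpha_1,\beta_0,\dots,\beta_{n-2})$ of this representative is an isomorphism of varieties $\mathbf{Conn}^B_n/G^U_n\cong\mathfrak h^r\times\mathfrak h^{2n-2}$. More precisely, it is an isomorphism from the functor $R\mapsto\mathbf{Conn}^B_n(R)/G^U_n(R)$ on commutative $\mathbb C$-algebras to the functor of points of $\mathfrak h^r\times\mathfrak h^{2n-2}$. (3) $\mathbf{Conn}^B_n/G^U_n$ is an affine variety (its functor of points is represented by a finitely generated integral domain over $\mathbb C$) of dimension $(2n-1)\operatorname{rk}\mathfrak g$, where $\operatorname{rk}\mathfrak g=\dim\mathfrak h$. -/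

import Mathlib

open CategoryTheory WithConv

universe u v w

namespace FormalConn

noncomputable section

/-! ## Points, distributions and the Lie algebra of an affine group scheme

An affine algebraic group `G` over `ℂ` is given by its coordinate Hopf algebra `H`, so that
`G(S)` is the set of algebra homomorphisms `H → S`. Both `G(S)` and the Lie algebra `𝔤 ⊗ S` live in
the convolution algebra of all linear maps `H → S`; for `G = GL_N` this product is the
product of matrices. -/

/-- The convolution algebra of linear maps `H → S`. -/
abbrev Dist (H : Type u) (S : Type v) [CommRing H] [HopfAlgebra ℂ H] [CommRing S] [Algebra ℂ S] :
    Type (max u v) :=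
  WithConv (H →ₗ[ℂ] S)

/-- The `S`-points of the group with coordinate ring `H`. -/
abbrev Points (H : Type u) (S : Type v) [CommRing H] [HopfAlgebra ℂ H] [CommRing S]
    [Algebra ℂ S] : Type (max u v) :=
  WithConv (H →ₐ[ℂ] S)

section Basic

variable {H : Type u} [CommRing H] [HopfAlgebra ℂ H]
variable {S : Type v} [CommRing S] [Algebra ℂ S]
variable {S' : Type w} [CommRing S'] [Algebra ℂ S']

/-- A point of the group as an element of the convolution algebra. -/
def toDist (g : Points H S) : Dist H S := toConv g.ofConv.toLinearMap

/-- The inverse of a point is its composition with the antipode. -/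
instance instGroupPoints : Group (Points H S) where
  inv g := toConv (g.ofConv.comp (HopfAlgebra.antipodeAlgHom ℂ H))
  inv_mul_cancel g := by
    have key : toDist (toConv (g.ofConv.comp (HopfAlgebra.antipodeAlgHom ℂ H)) * g : Points H S)
        = (1 : Dist H S) := by
      have h1 := LinearMap.algHom_comp_convMul_distrib g.ofConv
        (toConv (HopfAlgebra.antipode ℂ (A := H))) (toConv (LinearMap.id : H →ₗ[ℂ] H))
      rw [LinearMap.antipode_mul_id] at h1
      apply WithConv.ofConv_injective
      refine Eq.trans (Eq.trans ?_ h1.symm) ?_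
      · rfl
      · ext x
        simp
    apply WithConv.ofConv_injective
    apply AlgHom.toLinearMap_injective
    exact congrArg WithConv.ofConv key

theorem toDist_one : toDist (1 : Points H S) = 1 := rfl

theorem toDist_mul (g h : Points H S) : toDist (g * h) = toDist g * toDist h := rfl

instance instLieRingDist : LieRing (Dist H S) := LieRing.ofAssociativeRing

instance instLieAlgebraDist : LieAlgebra S (Dist H S) := LieAlgebra.ofAssociativeAlgebra

theorem Dist.lie_def (X Y : Dist H S) : ⁅X, Y⁆ = X * Y - Y * X := rfl

/-- The condition on a linear map `H → S` to be a derivation at the identity. -/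
def IsTangent (X : Dist H S) : Prop :=
  ∀ a b : H, X.ofConv (a * b) =
    Coalgebra.counit (R := ℂ) a • X.ofConv b + Coalgebra.counit (R := ℂ) b • X.ofConv a

theorem IsTangent.mul_apply {X Y : Dist H S} (hX : IsTangent X) (hY : IsTangent Y) (a b : H) :
    (X * Y).ofConv (a * b) =
      Coalgebra.counit (R := ℂ) a • (X * Y).ofConv b +
        Coalgebra.counit (R := ℂ) b • (X * Y).ofConv a +
        (X.ofConv a * Y.ofConv b + Y.ofConv a * X.ofConv b) := by
  let 𝓐 := Coalgebra.Repr.arbitrary ℂ a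
  let 𝓑 := Coalgebra.Repr.arbitrary ℂ b
  have hab : (X * Y).ofConv (a * b) = ∑ i ∈ 𝓐.index, ∑ j ∈ 𝓑.index,
      X.ofConv (𝓐.left i * 𝓑.left j) * Y.ofConv (𝓐.right i * 𝓑.right j) := by
    change LinearMap.mul' ℂ S (TensorProduct.map X.ofConv Y.ofConv
      (Coalgebra.comul (R := ℂ) (a * b))) = _
    rw [Bialgebra.comul_mul, ← 𝓐.eq, ← 𝓑.eq, Finset.sum_mul_sum]
    simp [map_sum]
  have e1 : ∀ {c : H} (𝓒 : Coalgebra.Repr ℂ c (H × H)) (Z : Dist H S),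
      ∑ i ∈ 𝓒.index, algebraMap ℂ S (Coalgebra.counit (R := ℂ) (𝓒.left i)) *
        Z.ofConv (𝓒.right i) = Z.ofConv c := by
    intro c 𝓒 Z
    have := 𝓒.convMul_apply (1 : Dist H S) Z
    rw [one_mul] at this
    exact this.symm
  have e2 : ∀ {c : H} (𝓒 : Coalgebra.Repr ℂ c (H × H)) (Z : Dist H S),
      ∑ i ∈ 𝓒.index, Z.ofConv (𝓒.left i) *
        algebraMap ℂ S (Coalgebra.counit (R := ℂ) (𝓒.right i)) = Z.ofConv c := by
    intro c 𝓒 Z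
    have := 𝓒.convMul_apply Z (1 : Dist H S)
    rw [mul_one] at this
    exact this.symm
  have e3 : ∀ {c : H} (𝓒 : Coalgebra.Repr ℂ c (H × H)),
      ∑ i ∈ 𝓒.index, algebraMap ℂ S (Coalgebra.counit (R := ℂ) (𝓒.left i)) *
        algebraMap ℂ S (Coalgebra.counit (R := ℂ) (𝓒.right i)) =
        algebraMap ℂ S (Coalgebra.counit (R := ℂ) c) := by
    intro c 𝓒
    exact e1 𝓒 (1 : Dist H S)
  have e4 : ∀ {c : H} (𝓒 : Coalgebra.Repr ℂ c (H × H)),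
      ∑ i ∈ 𝓒.index, X.ofConv (𝓒.left i) * Y.ofConv (𝓒.right i) = (X * Y).ofConv c := by
    intro c 𝓒
    exact (𝓒.convMul_apply X Y).symm
  rw [hab]
  simp only [Algebra.smul_def]
  rw [← e3 𝓐, ← e3 𝓑, ← e4 𝓑, ← e4 𝓐]
  conv_rhs =>
    rw [← e2 𝓐 X, ← e1 𝓑 Y, ← e1 𝓐 Y, ← e2 𝓑 X]
  simp only [Finset.sum_mul_sum]
  rw [Finset.sum_comm (s := 𝓑.index)]
  simp only [← Finset.sum_add_distrib]
  refine Finset.sum_congr rfl fun i _ => Finset.sum_congr rfl fun j _ => ?_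
  rw [hX, hY]
  simp only [Algebra.smul_def]
  ring

variable (H S) in
/-- The Lie algebra `𝔤 ⊗ S` of the group: derivations `H → S` at the identity, with the commutator
bracket of the convolution algebra. -/
def lieAlg : LieSubalgebra S (Dist H S) where
  carrier := {X | IsTangent X}
  add_mem' := by
    intro X Y hX hY a b
    simp only [ofConv_add, LinearMap.add_apply, hX a b, hY a b, smul_add]
    abel
  zero_mem' := by
    intro a b
    simp
  smul_mem' := by
    intro c X hX a b
    simp only [ofConv_smul, LinearMap.smul_apply, hX a b, smul_add, smul_comm c]
  lie_mem' := by
    intro X Y hX hY a b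
    rw [Dist.lie_def, ofConv_sub]
    simp only [LinearMap.sub_apply, hX.mul_apply hY, hY.mul_apply hX, smul_sub]
    ring


/-- Change of the coefficient algebra `S → S'`. -/
def distMap (φ : S →ₐ[ℂ] S') : Dist H S →+* Dist H S' where
  toFun X := toConv (φ.toLinearMap ∘ₗ X.ofConv)
  map_one' := by
    apply WithConv.ofConv_injective
    ext x
    simp
  map_mul' X Y := by
    apply WithConv.ofConv_injective
    exact LinearMap.algHom_comp_convMul_distrib φ X Y
  map_zero' := by
    apply WithConv.ofConv_injective
    ext x
    simp
  map_add' X Y := by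
    apply WithConv.ofConv_injective
    ext x
    simp

theorem distMap_apply (φ : S →ₐ[ℂ] S') (X : Dist H S) (a : H) :
    (distMap φ X).ofConv a = φ (X.ofConv a) := rfl

theorem dist_ext {X Y : Dist H S} (h : ∀ a, X.ofConv a = Y.ofConv a) : X = Y :=
  WithConv.ofConv_injective (LinearMap.ext h)

theorem distMap_smul (φ : S →ₐ[ℂ] S') (c : S) (X : Dist H S) :
    distMap φ (c • X) = φ c • distMap φ X :=
  dist_ext fun a => by simp [distMap_apply]

theorem IsTangent.map (φ : S →ₐ[ℂ] S') {X : Dist H S} (hX : IsTangent X) :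
    IsTangent (distMap φ X) := by
  intro a b
  simp [distMap_apply, hX a b]

/-- Change of the coefficient algebra for points of the group. -/
def pointsMap (φ : S →ₐ[ℂ] S') : Points H S →* Points H S' where
  toFun g := toConv (φ.comp g.ofConv)
  map_one' := by
    apply WithConv.ofConv_injective
    ext x
    simp
  map_mul' g h := by
    apply WithConv.ofConv_injective
    exact AlgHom.comp_convMul_distrib φ g h

theorem toDist_pointsMap (φ : S →ₐ[ℂ] S') (g : Points H S) :
    toDist (pointsMap φ g) = distMap φ (toDist g) := rfl

end Basic

/-! ## Subalgebras of the Lie algebra -/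

section Lie

variable {H : Type u} [CommRing H] [HopfAlgebra ℂ H]

/-- A connected semisimple algebraic group over `ℂ`. -/
structure IsConnectedSemisimple (H : Type u) [CommRing H] [HopfAlgebra ℂ H] : Prop where
  finiteType : Algebra.FiniteType ℂ H
  connected : ConnectedSpace (PrimeSpectrum H)
  semisimple : LieAlgebra.IsSemisimple ℂ (lieAlg H ℂ)

/-- A Borel subalgebra is a maximal solvable subalgebra. -/
def IsBorel (𝔟 : LieSubalgebra ℂ (lieAlg H ℂ)) : Prop :=
  Maximal (fun 𝔠 : LieSubalgebra ℂ (lieAlg H ℂ) => LieAlgebra.IsSolvable 𝔠) 𝔟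

/-- The nilpotent part `𝔲 = [𝔟, 𝔟]` of a Borel subalgebra. -/
def nilPart (𝔟 : LieSubalgebra ℂ (lieAlg H ℂ)) : Submodule ℂ (lieAlg H ℂ) :=
  Submodule.span ℂ {z | ∃ x ∈ 𝔟, ∃ y ∈ 𝔟, ⁅x, y⁆ = z}

/-- The subspace `V ⊗ S` of `𝔤 ⊗ S`. -/
def scalarExt (V : Submodule ℂ (lieAlg H ℂ)) (S : Type v) [CommRing S] [Algebra ℂ S] :
    Submodule S (Dist H S) :=
  Submodule.span S ((fun x : lieAlg H ℂ => distMap (Algebra.ofId ℂ S) x.1) '' (V : Set _))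

theorem distMap_mem_scalarExt {S S' : Type v} [CommRing S] [Algebra ℂ S] [CommRing S']
    [Algebra ℂ S'] (φ : S →ₐ[ℂ] S') (V : Submodule ℂ (lieAlg H ℂ)) {X : Dist H S}
    (hX : X ∈ scalarExt V S) : distMap φ X ∈ scalarExt V S' := by
  unfold scalarExt at hX
  induction hX using Submodule.span_induction with
  | mem X hX =>
    obtain ⟨x, hx, rfl⟩ := hX
    refine Submodule.subset_span ⟨x, hx, ?_⟩
    exact dist_ext fun a => by simp [distMap_apply, Algebra.ofId_apply]
  | zero => simp
  | add X Y _ _ hX hY => rw [map_add]; exact add_mem hX hY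
  | smul c X _ hX => rw [distMap_smul]; exact Submodule.smul_mem _ _ hX

/-- Over a field `K`, an element of `𝔤 ⊗ K` is regular semisimple if its adjoint endomorphism is
semisimple and its centralizer has dimension `r`, the rank of `𝔤`. -/
def IsRegularSemisimple (r : ℕ) {K : Type v} [Field K] [Algebra ℂ K] (x : Dist H K) : Prop :=
  ∃ hx : x ∈ lieAlg H K,
    (LieAlgebra.ad K (lieAlg H K) ⟨x, hx⟩).IsSemisimple ∧
      Module.finrank K (LinearMap.ker (LieAlgebra.ad K (lieAlg H K) ⟨x, hx⟩)) = r

/-- The points over a `ℂ`-algebra `S` of the open subscheme `𝔤^{rs} ⊆ 𝔤`: elements of `𝔤 ⊗ S`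
which are regular semisimple at all geometric points of `Spec S`. -/
def IsRegularFamily (r : ℕ) {S : Type v} [CommRing S] [Algebra ℂ S] (x : Dist H S) : Prop :=
  ∀ (K : Type v) [Field K] [IsAlgClosed K] [Algebra ℂ K] (φ : S →ₐ[ℂ] K),
    IsRegularSemisimple r (distMap φ x)

theorem IsRegularFamily.map {r : ℕ} {S S' : Type v} [CommRing S] [Algebra ℂ S] [CommRing S']
    [Algebra ℂ S'] (φ : S →ₐ[ℂ] S') {x : Dist H S} (hx : IsRegularFamily r x) :
    IsRegularFamily r (distMap φ x) := by
  intro K _ _ _ ψ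
  exact hx K (ψ.comp φ)

end Lie

/-! ## Formal loops and the gauge action -/

section Loops

open scoped PowerSeries LaurentSeries

variable {H : Type u} [CommRing H] [HopfAlgebra ℂ H]
variable {R : Type v} [CommRing R] [Algebra ℂ R]
variable {R' : Type v} [CommRing R'] [Algebra ℂ R']

/-- The coefficientwise `ℂ`-algebra structure on Laurent series. -/
instance instAlgebraLaurent : Algebra ℂ R⸨X⸩ := HahnSeries.instAlgebra

/-- The coefficient of `z^m` of an `R⟦z⟧`-valued distribution. -/
def psCoeff (m : ℕ) (X : Dist H R⟦X⟧) : Dist H R :=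
  toConv (((PowerSeries.coeff (R := R) m).restrictScalars ℂ) ∘ₗ X.ofConv)

/-- The coefficient of `z^k` of an `R((z))`-valued distribution. -/
def lsCoeff (k : ℤ) (A : Dist H R⸨X⸩) : Dist H R :=
  toConv (HahnSeries.coeff.linearMap (R := ℂ) k ∘ₗ A.ofConv)

/-- The derivative `d/dz` of an `R⟦z⟧`-valued distribution. -/
def ddz (X : Dist H R⟦X⟧) : Dist H R⟦X⟧ :=
  toConv (((PowerSeries.derivative R).toLinearMap.restrictScalars ℂ) ∘ₗ X.ofConv)

/-- The inclusion `R⟦z⟧ → R((z))`. -/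
def toLaurent : R⟦X⟧ →ₐ[ℂ] R⸨X⸩ := HahnSeries.ofPowerSeriesAlg ℤ ℂ

/-- The gauge action `g · (d + A dz) = d + (g A g⁻¹ - (dg/dz) g⁻¹) dz` of `g ∈ G(R⟦z⟧)`. -/
def gauge (g : Points H R⟦X⟧) (A : Dist H R⸨X⸩) : Dist H R⸨X⸩ :=
  distMap toLaurent (toDist g) * A * distMap toLaurent (toDist g⁻¹) -
    distMap toLaurent (ddz (toDist g) * toDist g⁻¹)

theorem ddz_mul (X Y : Dist H R⟦X⟧) : ddz (X * Y) = ddz X * Y + X * ddz Y := by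
  refine dist_ext fun a => ?_
  let 𝓐 := Coalgebra.Repr.arbitrary ℂ a
  have h1 := 𝓐.convMul_apply X Y
  have h2 := 𝓐.convMul_apply (ddz X) Y
  have h3 := 𝓐.convMul_apply X (ddz Y)
  change PowerSeries.derivative R ((X * Y).ofConv a) = (ddz X * Y).ofConv a + (X * ddz Y).ofConv a
  rw [h1, h2, h3, map_sum, ← Finset.sum_add_distrib]
  refine Finset.sum_congr rfl fun i _ => ?_
  rw [Derivation.leibniz]
  change _ = PowerSeries.derivative R (X.ofConv _) * Y.ofConv _ +
    X.ofConv _ * PowerSeries.derivative R (Y.ofConv _)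
  simp only [smul_eq_mul]
  ring

theorem ddz_one : ddz (1 : Dist H R⟦X⟧) = 0 := by
  have h := ddz_mul (1 : Dist H R⟦X⟧) 1
  simpa using h

theorem gauge_one (A : Dist H R⸨X⸩) : gauge 1 A = A := by
  simp [gauge, toDist_one, ddz_one]

theorem gauge_mul (g h : Points H R⟦X⟧) (A : Dist H R⸨X⸩) :
    gauge (g * h) A = gauge g (gauge h A) := by
  have hh : distMap toLaurent (toDist h) * distMap toLaurent (toDist h⁻¹) =
      (1 : Dist H R⸨X⸩) := by
    rw [← map_mul, ← toDist_mul, mul_inv_cancel, toDist_one, map_one]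
  simp only [gauge, mul_inv_rev, toDist_mul, ddz_mul, map_mul, map_add]
  simp only [mul_sub, sub_mul, add_mul, mul_assoc]
  rw [← mul_assoc (distMap toLaurent (toDist h)) (distMap toLaurent (toDist h⁻¹)), hh, one_mul]
  abel

/-- The loop `g` is the exponential of `X ∈ 𝔤 ⊗ R⟦z⟧`: the series `∑ X^k / k!` converges to `g` in
the `z`-adic topology. -/
def IsExp (X : Dist H R⟦X⟧) (g : Points H R⟦X⟧) : Prop :=
  ∀ (a : H) (m : ℕ), ∃ N : ℕ, ∀ M ≥ N,
    PowerSeries.coeff (R := R) m (g.ofConv a) =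
      ∑ k ∈ Finset.range M, ((k.factorial : ℂ)⁻¹) • PowerSeries.coeff (R := R) m ((X ^ k).ofConv a)

variable (R) in
/-- The group `G_n^U(R)` generated by the loops
`exp(u₀ + u₁ z + … + u_{n-1} z^{n-1} + g_n z^n + …)` with `u_i ∈ 𝔲` and `g_i ∈ 𝔤`. -/
def unipotentLoops (𝔟 : LieSubalgebra ℂ (lieAlg H ℂ)) (n : ℕ) : Subgroup (Points H R⟦X⟧) :=
  Subgroup.closure {g | ∃ X ∈ lieAlg H R⟦X⟧,
    (∀ i < n, psCoeff i X ∈ scalarExt (nilPart 𝔟) R) ∧ IsExp X g}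

/-- The condition on `d + A dz` to belong to `Conn_n^B(R)`: a non-resonant connection on
the trivial bundle on the formal disk with a pole of order `n` and polar part in `𝔟`. -/
structure IsConn (𝔥 𝔟 : LieSubalgebra ℂ (lieAlg H ℂ)) (n : ℕ) (A : Dist H R⸨X⸩) : Prop where
  tangent : A ∈ lieAlg H R⸨X⸩
  pole : ∀ k < -(n : ℤ), lsCoeff k A = 0
  polar : ∀ k < (0 : ℤ), lsCoeff k A ∈ scalarExt 𝔟.toSubmodule R
  nonresonant : IsRegularFamily (Module.finrank ℂ 𝔥) (lsCoeff (-(n : ℤ)) A)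

variable (R) in
/-- The `R`-points of `Conn_n^B`. -/
def Conn (𝔥 𝔟 : LieSubalgebra ℂ (lieAlg H ℂ)) (n : ℕ) : Type (max u v) :=
  {A : Dist H R⸨X⸩ // IsConn 𝔥 𝔟 n A}

variable (R) in
/-- Gauge equivalence under `G_n^U(R)`. -/
def gaugeSetoid (𝔥 𝔟 : LieSubalgebra ℂ (lieAlg H ℂ)) (n : ℕ) : Setoid (Conn R 𝔥 𝔟 n) where
  r A B := ∃ g ∈ unipotentLoops R 𝔟 n, gauge g A.1 = B.1
  iseqv := by
    refine ⟨fun A => ⟨1, one_mem _, gauge_one _⟩, ?_, ?_⟩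
    · rintro A B ⟨g, hg, h⟩
      exact ⟨g⁻¹, inv_mem hg, by rw [← h, ← gauge_mul, inv_mul_cancel, gauge_one]⟩
    · rintro A B C ⟨g, hg, h⟩ ⟨g', hg', h'⟩
      exact ⟨g' * g, mul_mem hg' hg, by rw [gauge_mul, h, h']⟩

/-- The connection has the form
`d + (α_n z^{-n} + … + α_1 z^{-1} + β_0 + … + β_{n-2} z^{n-2}) dz` with all coefficients
in `𝔥 ⊗ R`. -/
def IsNormalForm {𝔥 𝔟 : LieSubalgebra ℂ (lieAlg H ℂ)} {n : ℕ} (A : Conn R 𝔥 𝔟 n) : Prop :=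
  (∀ k : ℤ, lsCoeff k A.1 ∈ scalarExt 𝔥.toSubmodule R) ∧
    ∀ k : ℤ, (n : ℤ) - 2 < k → lsCoeff k A.1 = 0

/-! ## Functoriality in the coefficient algebra -/

/-- The map `R((z)) → R'((z))` induced by `R → R'`. -/
def laurentMap (φ : R →ₐ[ℂ] R') : R⸨X⸩ →ₐ[ℂ] R'⸨X⸩ where
  toFun f := HahnSeries.map f φ
  map_one' := HahnSeries.map_one (RingHom.toMonoidWithZeroHom (φ : R →+* R'))
  map_mul' x y := HahnSeries.map_mul (RingHom.toNonUnitalRingHom (φ : R →+* R'))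
  map_zero' := by ext; simp
  map_add' x y := by ext; simp
  commutes' c := by
    change HahnSeries.map (HahnSeries.C (algebraMap ℂ R c)) φ = HahnSeries.C (algebraMap ℂ R' c)
    ext k
    by_cases hk : k = 0 <;> simp [HahnSeries.C_apply, hk]

theorem lsCoeff_map (φ : R →ₐ[ℂ] R') (k : ℤ) (A : Dist H R⸨X⸩) :
    lsCoeff k (distMap (laurentMap φ) A) = distMap φ (lsCoeff k A) := rfl

theorem psCoeff_map (φ : R →ₐ[ℂ] R') (k : ℕ) (A : Dist H R⟦X⟧) :
    psCoeff k (distMap (PowerSeries.mapAlgHom φ) A) = distMap φ (psCoeff k A) := by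
  refine dist_ext fun a => ?_
  change PowerSeries.coeff k (PowerSeries.mapAlgHom φ (A.ofConv a)) = φ (PowerSeries.coeff k _)
  simp [PowerSeries.mapAlgHom_apply]

theorem ddz_map (φ : R →ₐ[ℂ] R') (A : Dist H R⟦X⟧) :
    ddz (distMap (PowerSeries.mapAlgHom φ) A) = distMap (PowerSeries.mapAlgHom φ) (ddz A) := by
  refine dist_ext fun a => ?_
  change PowerSeries.derivative R' (PowerSeries.mapAlgHom φ (A.ofConv a)) =
    PowerSeries.mapAlgHom φ (PowerSeries.derivative R (A.ofConv a))
  ext m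
  simp [PowerSeries.mapAlgHom_apply, PowerSeries.coeff_derivative]

theorem toLaurent_map (φ : R →ₐ[ℂ] R') (A : Dist H R⟦X⟧) :
    distMap toLaurent (distMap (PowerSeries.mapAlgHom φ) A) =
      distMap (laurentMap φ) (distMap toLaurent A) := by
  refine dist_ext fun a => ?_
  change HahnSeries.ofPowerSeries ℤ R' (PowerSeries.mapAlgHom φ (A.ofConv a)) =
    HahnSeries.map (HahnSeries.ofPowerSeries ℤ R (A.ofConv a)) φ
  ext k
  rw [HahnSeries.map_coeff, PowerSeries.coeff_coe, PowerSeries.coeff_coe]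
  split_ifs <;> simp [PowerSeries.mapAlgHom_apply]

theorem gauge_map (φ : R →ₐ[ℂ] R') (g : Points H R⟦X⟧) (A : Dist H R⸨X⸩) :
    gauge (pointsMap (PowerSeries.mapAlgHom φ) g) (distMap (laurentMap φ) A) =
      distMap (laurentMap φ) (gauge g A) := by
  simp only [gauge, ← map_inv, toDist_pointsMap, ddz_map, ← map_mul, toLaurent_map, map_sub]

theorem IsExp.map (φ : R →ₐ[ℂ] R') {X : Dist H R⟦X⟧} {g : Points H R⟦X⟧} (h : IsExp X g) :
    IsExp (distMap (PowerSeries.mapAlgHom φ) X) (pointsMap (PowerSeries.mapAlgHom φ) g) := by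
  intro a m
  obtain ⟨N, hN⟩ := h a m
  refine ⟨N, fun M hM => ?_⟩
  have := congrArg φ (hN M hM)
  rw [map_sum] at this
  change PowerSeries.coeff m (PowerSeries.mapAlgHom φ (g.ofConv a)) = _
  rw [PowerSeries.mapAlgHom_apply, PowerSeries.coeff_map]
  refine Eq.trans this (Finset.sum_congr rfl fun k _ => ?_)
  rw [← map_pow, distMap_apply, PowerSeries.mapAlgHom_apply, PowerSeries.coeff_map, map_smul]
  rfl

theorem unipotentLoops_map (φ : R →ₐ[ℂ] R') {𝔟 : LieSubalgebra ℂ (lieAlg H ℂ)} {n : ℕ}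
    {g : Points H R⟦X⟧} (hg : g ∈ unipotentLoops R 𝔟 n) :
    pointsMap (PowerSeries.mapAlgHom φ) g ∈ unipotentLoops R' 𝔟 n := by
  have : unipotentLoops R 𝔟 n ≤
      (unipotentLoops R' 𝔟 n).comap (pointsMap (PowerSeries.mapAlgHom φ)) := by
    refine (Subgroup.closure_le _).2 ?_
    rintro g ⟨X, hX, hu, he⟩
    refine Subgroup.subset_closure ⟨_, IsTangent.map _ hX, fun i hi => ?_, he.map φ⟩
    rw [psCoeff_map]
    exact distMap_mem_scalarExt φ _ (hu i hi)
  exact this hg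

theorem IsConn.map (φ : R →ₐ[ℂ] R') {𝔥 𝔟 : LieSubalgebra ℂ (lieAlg H ℂ)} {n : ℕ}
    {A : Dist H R⸨X⸩} (hA : IsConn 𝔥 𝔟 n A) : IsConn 𝔥 𝔟 n (distMap (laurentMap φ) A) where
  tangent := IsTangent.map _ hA.tangent
  pole k hk := by rw [lsCoeff_map, hA.pole k hk, map_zero]
  polar k hk := by rw [lsCoeff_map]; exact distMap_mem_scalarExt φ _ (hA.polar k hk)
  nonresonant := by rw [lsCoeff_map]; exact hA.nonresonant.map φ

/-- The map `Conn_n^B(R) → Conn_n^B(R')` induced by `R → R'`. -/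
def Conn.map {𝔥 𝔟 : LieSubalgebra ℂ (lieAlg H ℂ)} {n : ℕ} (φ : R →ₐ[ℂ] R')
    (A : Conn R 𝔥 𝔟 n) : Conn R' 𝔥 𝔟 n :=
  ⟨distMap (laurentMap φ) A.1, A.2.map φ⟩

variable (R) in
/-- The set of `R`-points of `Conn_n^B / G_n^U`. -/
def ConnQuot (𝔥 𝔟 : LieSubalgebra ℂ (lieAlg H ℂ)) (n : ℕ) : Type (max u v) :=
  Quotient (gaugeSetoid R 𝔥 𝔟 n)

/-- The class of a connection modulo gauge equivalence. -/
def ConnQuot.mk {𝔥 𝔟 : LieSubalgebra ℂ (lieAlg H ℂ)} {n : ℕ} (A : Conn R 𝔥 𝔟 n) :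
    ConnQuot R 𝔥 𝔟 n :=
  Quotient.mk (gaugeSetoid R 𝔥 𝔟 n) A

/-- The map induced on the quotients. -/
def ConnQuot.map {𝔥 𝔟 : LieSubalgebra ℂ (lieAlg H ℂ)} {n : ℕ} (φ : R →ₐ[ℂ] R') :
    ConnQuot R 𝔥 𝔟 n → ConnQuot R' 𝔥 𝔟 n :=
  Quotient.map (Conn.map φ) (by
    rintro A B ⟨g, hg, h⟩
    exact ⟨_, unipotentLoops_map φ hg, by
      change gauge _ (distMap (laurentMap φ) A.1) = distMap (laurentMap φ) B.1
      rw [gauge_map, h]⟩)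

variable (R) in
/-- The `R`-points of the variety `𝔥^r × 𝔥^m`. -/
def CartanPoints (𝔥 : LieSubalgebra ℂ (lieAlg H ℂ)) (m : ℕ) : Type (max u v) :=
  {x : scalarExt 𝔥.toSubmodule R // IsRegularFamily (Module.finrank ℂ 𝔥) x.1} ×
    (Fin m → scalarExt 𝔥.toSubmodule R)

/-- The map on points of `𝔥^r × 𝔥^m` induced by `R → R'`. -/
def CartanPoints.map {𝔥 : LieSubalgebra ℂ (lieAlg H ℂ)} {m : ℕ} (φ : R →ₐ[ℂ] R')
    (p : CartanPoints R 𝔥 m) : CartanPoints R' 𝔥 m :=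
  (⟨⟨distMap φ p.1.1.1, distMap_mem_scalarExt φ _ p.1.1.2⟩, p.1.2.map φ⟩,
    fun i => ⟨distMap φ (p.2 i).1, distMap_mem_scalarExt φ _ (p.2 i).2⟩)

/-- The coefficients `(α_n, (α_{n-1}, …, α_1, β_0, …, β_{n-2}))` of a connection in normal form. -/
def normalCoeffs {𝔥 𝔟 : LieSubalgebra ℂ (lieAlg H ℂ)} {n : ℕ} (A : Conn R 𝔥 𝔟 n)
    (hA : IsNormalForm A) : CartanPoints R 𝔥 (2 * n - 2) :=
  (⟨⟨lsCoeff (-(n : ℤ)) A.1, hA.1 _⟩, A.2.nonresonant⟩,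
    fun i => ⟨lsCoeff (-(n : ℤ) + 1 + (i : ℤ)) A.1, hA.1 _⟩)

end Loops

section Functors

variable {H : Type u} [CommRing H] [HopfAlgebra ℂ H]

/-- The functor of points of `Conn_n^B / G_n^U`. -/
def connQuotFunctor (𝔥 𝔟 : LieSubalgebra ℂ (lieAlg H ℂ)) (n : ℕ) :
    CommAlgCat.{v} ℂ ⥤ Type (max u v) where
  obj R := ConnQuot R 𝔥 𝔟 n
  map f := TypeCat.ofHom (ConnQuot.map f.hom)
  map_id _ := by
    ext x
    obtain ⟨A, rfl⟩ := Quotient.exists_rep x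
    rfl
  map_comp _ _ := by
    ext x
    obtain ⟨A, rfl⟩ := Quotient.exists_rep x
    rfl

/-- The functor of points of `𝔥^r × 𝔥^m`. -/
def cartanFunctor (𝔥 : LieSubalgebra ℂ (lieAlg H ℂ)) (m : ℕ) :
    CommAlgCat.{v} ℂ ⥤ Type (max u v) where
  obj R := CartanPoints R 𝔥 m
  map f := TypeCat.ofHom (CartanPoints.map f.hom)
  map_id _ := rfl
  map_comp _ _ := rfl

/-- A functor of points is an affine variety of dimension `d`: it is represented by
a finitely generated integral `ℂ`-algebra of Krull dimension `d`. -/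
def IsAffineVarietyOfDim (F : CommAlgCat.{v} ℂ ⥤ Type (max u v)) (d : ℕ) : Prop :=
  ∃ A : CommAlgCat.{v} ℂ, Algebra.FiniteType ℂ A ∧ IsDomain A ∧ ringKrullDim A = d ∧
    Nonempty (F ≅ coyoneda.obj (Opposite.op A) ⋙ uliftFunctor.{u, v})

end Functors

end

end FormalConn

/-! Write `B = z^n A`. The gauge action becomes `B ↦ g B g⁻¹ - z^n g' g⁻¹`, and the normal form says
that all coefficients of `B` lie in `𝔥` and vanish from order `2n - 1` on. All computations take
place in the convolution algebra of distributions, where points are group-like and elements of `𝔤 ⊗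
S` are primitive, so an arbitrary coefficient algebra costs nothing extra.

Existence. Modulo `z^n` the derivative term disappears, and the polar part is an element `h + e` of
`(𝔥 ⊕ 𝔲) ⊗ R[z]/z^n` acted on by conjugation. Regularity of the leading coefficient means that every
root takes a unit value on its Cartan part (`isUnit_of_isRegularFamily`, by comparing characteristic
polynomials of triangular operators). Hence `[h, u] = e` can be solved, and conjugation by `exp u`
pushes `e` one step up a finite filtration of `𝔲` (`exists_conj_step`). For `m ≥ n`, a term `z^m Y`
in the exponent changes the coefficient of `z^m` by `[Y, B_0]` and nothing below it: its derivative
contributes only from order `n + m - 1 > m` on, since `n ≥ 2`. This removes all root components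
(`exists_nonpolar`). What is left is commutative: `exp X` with `X ∈ z^n 𝔥[[z]]` subtracts `z^n X'`,
which reaches exactly the orders `≥ 2n - 1` (`exists_cartan`).

Uniqueness. Let `g` carry one normal form `B` to another, `B'`. Modulo `z^n`, `g` is a product of
exponentials of elements of `𝔲`. Such points are contracted to `1` by the one-parameter group of an
element `ρ ∈ 𝔥` that is positive on the roots of `𝔟`: they extend to a polynomial family `g(t)`,
formally `t^ρ g t^{-ρ}`, with `g(1) = g` and `g(0) = 1`. The relation `g h = h' g` with `h, h'`
Cartan extends to the family, and `t = 0` gives `h = h'` (`eq_of_contracted_conj`). A contracted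
point that commutes with a regular `h` is trivial (`eq_one_of_contracted_comm`). So `g = 1 + z^n E`
and `B' = B + z^n D` with `D ≡ -[B, E]` modulo `z^(n-1)`. A bracket with a Cartan element has no
Cartan component, so `D ≡ 0` there, and `B` and `B'` agree below order `2n - 1` (`eq_of_gauge`).

The element `ρ` is the sum of the coroots of the roots of `𝔟`; its positivity is a reflection
argument (`sum_pairing_pos`). Exponentials of `𝔲` make sense because products of elements of `𝔲`
eventually vanish at any given function (`exists_pow_apply_eq_zero`), a consequence of Lie's
theorem.

Normal forms are stable under base change, so reading off coefficients is an isomorphism of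
functors. The target is represented by a polynomial ring in `(2n - 1) rk 𝔤` variables with the
product of the roots of the leading coefficient inverted; inverting a nonzero polynomial does not
change the Krull dimension. -/

namespace FormalConn

noncomputable section

/-! ### Primitive and group-like distributions; divided powers -/

section Convolution

open TensorProduct

variable {H : Type u} [CommRing H] [HopfAlgebra ℂ H]
variable {S : Type v} [CommRing S] [Algebra ℂ S]
variable {S' : Type w} [CommRing S'] [Algebra ℂ S']

/-- Composition of a distribution with a `ℂ`-linear map of the coefficients. -/
def distLin (l : S →ₗ[ℂ] S') : Dist H S →ₗ[ℂ] Dist H S' where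
  toFun X := toConv (l ∘ₗ X.ofConv)
  map_add' X Y := by apply WithConv.ofConv_injective; ext; simp
  map_smul' c X := by apply WithConv.ofConv_injective; ext; simp

theorem distLin_apply (l : S →ₗ[ℂ] S') (X : Dist H S) (a : H) :
    (distLin l X).ofConv a = l (X.ofConv a) := rfl

theorem smul_ofConv (c : S) (X : Dist H S) (a : H) : (c • X).ofConv a = c * X.ofConv a := rfl

theorem one_ofConv (a : H) :
    (1 : Dist H S).ofConv a = algebraMap ℂ S (Coalgebra.counit (R := ℂ) a) := rfl

theorem IsTangent.distLin (l : S →ₗ[ℂ] S') {X : Dist H S} (hX : IsTangent X) :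
    IsTangent (distLin l X) := by
  intro a b
  simp [distLin_apply, hX a b]

theorem IsTangent.apply_one {X : Dist H S} (hX : IsTangent X) : X.ofConv 1 = 0 := by
  have := hX 1 1
  simpa using this

theorem distLin_derivation_mul (D : Derivation ℂ S S) (X Y : Dist H S) :
    distLin D.toLinearMap (X * Y) =
      distLin D.toLinearMap X * Y + X * distLin D.toLinearMap Y := by
  refine dist_ext fun a => ?_
  let 𝓐 := Coalgebra.Repr.arbitrary ℂ a
  rw [distLin_apply, ofConv_add, LinearMap.add_apply, 𝓐.convMul_apply, 𝓐.convMul_apply,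
    𝓐.convMul_apply, map_sum, ← Finset.sum_add_distrib]
  refine Finset.sum_congr rfl fun i _ => ?_
  rw [distLin_apply, distLin_apply]
  change D _ = D _ * _ + _ * D _
  rw [Derivation.leibniz]
  simp only [smul_eq_mul]
  ring

/-- Composition of a distribution with the multiplication of the coordinate ring. -/
def mulPullback : Dist H S →+* WithConv (H ⊗[ℂ] H →ₗ[ℂ] S) where
  toFun X := toConv (X.ofConv ∘ₗ LinearMap.mul' ℂ H)
  map_one' := by
    apply WithConv.ofConv_injective
    ext x y
    simp [Bialgebra.counit_mul, mul_comm]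
  map_mul' X Y := by
    apply WithConv.ofConv_injective
    exact LinearMap.convMul_comp_coalgHom_distrib X Y (Bialgebra.mulCoalgHom ℂ H)
  map_zero' := by
    apply WithConv.ofConv_injective
    ext x
    simp
  map_add' X Y := by
    apply WithConv.ofConv_injective
    ext x
    simp

/-- The exterior product of two distributions. -/
def boxProd (X Y : Dist H S) : WithConv (H ⊗[ℂ] H →ₗ[ℂ] S) :=
  toConv (LinearMap.mul' ℂ S ∘ₗ TensorProduct.map X.ofConv Y.ofConv)

theorem mulPullback_tmul (X : Dist H S) (a b : H) :
    (mulPullback X).ofConv (a ⊗ₜ b) = X.ofConv (a * b) := rfl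

theorem boxProd_tmul (X Y : Dist H S) (a b : H) :
    (boxProd X Y).ofConv (a ⊗ₜ b) = X.ofConv a * Y.ofConv b := rfl

theorem boxProd_mul (X Y X' Y' : Dist H S) :
    boxProd X Y * boxProd X' Y' = boxProd (X * X') (Y * Y') := by
  apply WithConv.ofConv_injective
  have h := LinearMap.algHom_comp_convMul_distrib (Algebra.TensorProduct.lmul' ℂ (S := S))
    (toConv (TensorProduct.map X.ofConv Y.ofConv)) (toConv (TensorProduct.map X'.ofConv Y'.ofConv))
  refine Eq.trans h.symm ?_
  have h2 := TensorProduct.map_convMul_map (R := ℂ) (f := X) (h := X') (g := Y) (k := Y')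
  exact congrArg (fun t : WithConv (H ⊗[ℂ] H →ₗ[ℂ] S ⊗[ℂ] S) =>
    (Algebra.TensorProduct.lmul' ℂ (S := S)).toLinearMap ∘ₗ t.ofConv) h2

theorem boxProd_one_one : boxProd (1 : Dist H S) 1 = 1 := by
  apply WithConv.ofConv_injective
  ext a b
  simp [boxProd, mul_comm]

theorem boxProd_pow (X Y : Dist H S) (k : ℕ) : boxProd X Y ^ k = boxProd (X ^ k) (Y ^ k) := by
  induction k with
  | zero => simp [boxProd_one_one]
  | succ k ih => rw [pow_succ, ih, boxProd_mul, pow_succ, pow_succ]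

theorem conv_tensor_ext {P Q : WithConv (H ⊗[ℂ] H →ₗ[ℂ] S)}
    (h : ∀ a b : H, P.ofConv (a ⊗ₜ b) = Q.ofConv (a ⊗ₜ b)) : P = Q :=
  WithConv.ofConv_injective (TensorProduct.ext' h)

/-- With `mulPullback` as coproduct and `boxProd` as exterior product, tangent means primitive, and
`mulPullback_toDist` says that points are group-like. Conditions on values at products become
identities between ring elements. -/
theorem isTangent_iff_mulPullback {X : Dist H S} :
    IsTangent X ↔ mulPullback X = boxProd X 1 + boxProd 1 X := by
  constructor
  · intro h
    refine conv_tensor_ext fun a b => ?_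
    rw [mulPullback_tmul, ofConv_add, LinearMap.add_apply, boxProd_tmul, boxProd_tmul, h,
      one_ofConv, one_ofConv, Algebra.smul_def, Algebra.smul_def]
    ring
  · intro h a b
    have := congrArg (fun t => t.ofConv (a ⊗ₜ b)) h
    simp only [mulPullback_tmul, ofConv_add, LinearMap.add_apply, boxProd_tmul, one_ofConv] at this
    rw [this, Algebra.smul_def, Algebra.smul_def]
    ring

theorem mulPullback_toDist (g : Points H S) :
    mulPullback (toDist g) = boxProd (toDist g) (toDist g) :=
  conv_tensor_ext fun a b => map_mul g.ofConv a b

theorem toDist_apply (g : Points H S) (a : H) : (toDist g).ofConv a = g.ofConv a := rfl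

theorem toDist_injective : Function.Injective (toDist : Points H S → Dist H S) := by
  intro g h e
  apply WithConv.ofConv_injective
  apply AlgHom.toLinearMap_injective
  exact congrArg WithConv.ofConv e

theorem toDist_inv_mul (g : Points H S) : toDist g⁻¹ * toDist g = 1 := by
  rw [← toDist_mul, inv_mul_cancel, toDist_one]

theorem toDist_mul_inv (g : Points H S) : toDist g * toDist g⁻¹ = 1 := by
  rw [← toDist_mul, mul_inv_cancel, toDist_one]

/-- A derivation of the coordinate ring along the point `g`, multiplied by `g⁻¹`, is tangent. -/
theorem isTangent_mul_inv {g : Points H S} {D : Dist H S}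
    (hD : mulPullback D = boxProd D (toDist g) + boxProd (toDist g) D) :
    IsTangent (D * toDist g⁻¹) := by
  rw [isTangent_iff_mulPullback, map_mul, hD, mulPullback_toDist, add_mul, boxProd_mul,
    boxProd_mul, toDist_mul_inv]

theorem IsTangent.conj (g : Points H S) {X : Dist H S} (hX : IsTangent X) :
    IsTangent (toDist g * X * toDist g⁻¹) := by
  apply isTangent_mul_inv
  rw [map_mul, mulPullback_toDist, isTangent_iff_mulPullback.1 hX, mul_add, boxProd_mul,
    boxProd_mul, mul_one]

theorem isTangent_derivation_mul_inv (D : Derivation ℂ S S) (g : Points H S) :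
    IsTangent (distLin D.toLinearMap (toDist g) * toDist g⁻¹) := by
  apply isTangent_mul_inv
  refine conv_tensor_ext fun a b => ?_
  rw [mulPullback_tmul, ofConv_add, LinearMap.add_apply, boxProd_tmul, boxProd_tmul,
    distLin_apply, distLin_apply, distLin_apply, toDist_apply, toDist_apply, toDist_apply, map_mul]
  change D _ = D _ * _ + _ * D _
  rw [Derivation.leibniz]
  simp only [smul_eq_mul]
  ring

/-- The divided power `X^k / k!`. -/
def divPow (X : Dist H S) (k : ℕ) : Dist H S := ((k.factorial : ℂ)⁻¹) • X ^ k

theorem divPow_zero (X : Dist H S) : divPow X 0 = 1 := by simp [divPow]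

theorem divPow_one (X : Dist H S) : divPow X 1 = X := by simp [divPow]

theorem divPow_succ (X : Dist H S) (k : ℕ) :
    ((k : ℂ) + 1) • divPow X (k + 1) = X * divPow X k := by
  have h : ((k : ℂ) + 1) ≠ 0 := by exact_mod_cast Nat.succ_ne_zero k
  have h2 : (k.factorial : ℂ) ≠ 0 := by exact_mod_cast Nat.factorial_ne_zero k
  rw [divPow, divPow, smul_smul, mul_smul_comm, pow_succ', Nat.factorial_succ]
  congr 1
  push_cast
  field_simp

/-- The two summands `X ⊠ 1` and `1 ⊠ X` of the coproduct of `X` commute, so its `k`-th power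
expands by the binomial theorem. This is the multiplicativity of the exponential, degree by degree.
-/
theorem IsTangent.divPow_mul {X : Dist H S} (hX : IsTangent X) (k : ℕ) (a b : H) :
    (divPow X k).ofConv (a * b) =
      ∑ p ∈ Finset.HasAntidiagonal.antidiagonal k, (divPow X p.1).ofConv a * (divPow X p.2).ofConv b := by
  have hc : Commute (boxProd X 1) (boxProd 1 X) := by
    rw [commute_iff_eq, boxProd_mul, boxProd_mul, one_mul, mul_one]
  have h := hc.add_pow' k
  rw [← isTangent_iff_mulPullback.1 hX, ← map_pow] at h
  have h2 := congrArg (fun t => t.ofConv (a ⊗ₜ b)) h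
  simp only [mulPullback_tmul, boxProd_pow, boxProd_mul, one_pow, one_mul, mul_one] at h2
  have h3 : ∀ (s : Finset (ℕ × ℕ)) (f : ℕ × ℕ → WithConv (H ⊗[ℂ] H →ₗ[ℂ] S)),
      (∑ p ∈ s, f p).ofConv (a ⊗ₜ b) = ∑ p ∈ s, (f p).ofConv (a ⊗ₜ b) := by
    intro s f
    classical
    induction s using Finset.induction_on with
    | empty => simp
    | insert p s hp ih => rw [Finset.sum_insert hp, Finset.sum_insert hp, ofConv_add,
        LinearMap.add_apply, ih]
  rw [h3] at h2
  simp only [divPow, ofConv_smul, LinearMap.smul_apply]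
  rw [h2, Finset.smul_sum]
  refine Finset.sum_congr rfl fun p hp => ?_
  have hp' := Finset.HasAntidiagonal.mem_antidiagonal.1 hp
  rw [ofConv_smul, LinearMap.smul_apply, boxProd_tmul, ← Nat.cast_smul_eq_nsmul ℂ, smul_smul,
    smul_mul_smul_comm]
  congr 1
  have e := Nat.add_choose_mul_factorial_mul_factorial p.1 p.2
  rw [hp'] at e
  have h1 : (k.factorial : ℂ) ≠ 0 := by exact_mod_cast Nat.factorial_ne_zero k
  have h4 : (p.1.factorial : ℂ) ≠ 0 := by exact_mod_cast Nat.factorial_ne_zero p.1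
  have h5 : (p.2.factorial : ℂ) ≠ 0 := by exact_mod_cast Nat.factorial_ne_zero p.2
  rw [← Nat.choose_symm_of_eq_add (hp'.symm)] at e
  have e' : (k.choose p.1 : ℂ) * p.1.factorial * p.2.factorial = k.factorial := by exact_mod_cast e
  field_simp
  linear_combination e'

theorem divPow_apply_one {X : Dist H S} (hX : IsTangent X) (k : ℕ) :
    (divPow X k).ofConv 1 = if k = 0 then 1 else 0 := by
  split_ifs with hk
  · subst hk
    simp [divPow_zero]
  · obtain ⟨k, rfl⟩ := Nat.exists_eq_succ_of_ne_zero hk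
    have h : ((k : ℂ) + 1) ≠ 0 := by exact_mod_cast Nat.succ_ne_zero k
    have h2 := congrArg (fun t : Dist H S => t.ofConv 1) (divPow_succ X k)
    simp only [ofConv_smul, LinearMap.smul_apply] at h2
    have h3 : (X * divPow X k).ofConv 1 = 0 := by
      change LinearMap.mul' ℂ S (TensorProduct.map X.ofConv _ (Coalgebra.comul (R := ℂ) 1)) = 0
      rw [Bialgebra.comul_one, Algebra.TensorProduct.one_def, TensorProduct.map_tmul, hX.apply_one]
      simp
    rw [h3] at h2
    exact (smul_eq_zero.1 h2).resolve_left h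

end Convolution

/-! ### Nilpotent action of the derived algebra (Lie's theorem) -/

section SolvableAction

open LieModule

/-- The derived algebra of a solvable Lie algebra acts nilpotently on finite-dimensional modules:
a product of `dim V` operators from it is zero. -/
theorem exists_foldr_lie_eq_zero {L : Type*} [LieRing L] [LieAlgebra ℂ L]
    [LieAlgebra.IsSolvable L] (d : ℕ) :
    ∀ (V : Type v) [AddCommGroup V] [Module ℂ V] [LieRingModule L V] [LieModule ℂ L V]
      [Module.Finite ℂ V], Module.finrank ℂ V = d →
      ∀ l : List L, l.length = d → (∀ z ∈ l, z ∈ Submodule.span ℂ {z | ∃ x y : L, ⁅x, y⁆ = z}) →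
        ∀ v : V, l.foldr (fun x v => ⁅x, v⁆) v = 0 := by
  induction d with
  | zero =>
    intro V _ _ _ _ _ hV l hl _ v
    have := Module.finrank_zero_iff.1 hV
    exact Subsingleton.elim _ _
  | succ d ih =>
    intro V _ _ _ _ _ hV l hl hz v
    have hnt : Nontrivial V := Module.nontrivial_of_finrank_pos (R := ℂ) (by omega)
    -- Lie's theorem supplies a common eigenvector `w`. Brackets kill it because scalars commute, so
    -- the induction runs on the quotient by its line.
    obtain ⟨χ, hχ⟩ := exists_nontrivial_weightSpace_of_isSolvable ℂ L V
    obtain ⟨⟨w, hw⟩, hw0⟩ := exists_ne (0 : weightSpace V χ)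
    have hw0 : w ≠ 0 := fun h => hw0 (Subtype.ext h)
    rw [mem_weightSpace] at hw
    let N : LieSubmodule ℂ L V :=
      { Submodule.span ℂ {w} with
        lie_mem := by
          intro x m hm
          obtain ⟨c, rfl⟩ := Submodule.mem_span_singleton.1 hm
          rw [lie_smul, hw]
          exact Submodule.smul_mem _ _ (Submodule.smul_mem _ _ (Submodule.mem_span_singleton_self w)) }
    have hN : ∀ m, m ∈ N ↔ ∃ c : ℂ, c • w = m := fun m => Submodule.mem_span_singleton
    have hkill : ∀ z ∈ Submodule.span ℂ {z | ∃ x y : L, ⁅x, y⁆ = z}, ⁅z, w⁆ = 0 := by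
      intro z hz
      induction hz using Submodule.span_induction with
      | mem z hz =>
        obtain ⟨x, y, rfl⟩ := hz
        rw [lie_lie, hw, hw, lie_smul, lie_smul, hw, hw, smul_smul, smul_smul, mul_comm, sub_self]
      | zero => simp
      | add a b _ _ ha hb => rw [add_lie, ha, hb, add_zero]
      | smul c a _ ha => rw [smul_lie, ha, smul_zero]
    have hfin : Module.finrank ℂ (V ⧸ N) = d := by
      have h1 := Submodule.finrank_quotient_add_finrank (N.toSubmodule)
      have h2 : Module.finrank ℂ N.toSubmodule = 1 := finrank_span_singleton hw0
      change Module.finrank ℂ (V ⧸ N.toSubmodule) = d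
      omega
    obtain ⟨z, l, rfl⟩ := List.exists_cons_of_length_eq_add_one hl
    -- The last `d` operators of the list already map `V` into the line of `w`, and the outermost
    -- one kills that line.
    have h := ih (V ⧸ N) hfin l (by simpa using hl) (fun z' hz' => hz z' (by simp [hz']))
      (LieSubmodule.Quotient.mk v)
    have hq : ∀ l : List L, l.foldr (fun x v => ⁅x, v⁆) (LieSubmodule.Quotient.mk v : V ⧸ N) =
        LieSubmodule.Quotient.mk (l.foldr (fun x v => ⁅x, v⁆) v) := by
      intro l
      induction l with
      | nil => rfl
      | cons a l ih => rw [List.foldr_cons, List.foldr_cons, ih]; rfl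
    rw [hq] at h
    replace h : LieSubmodule.Quotient.mk' N (l.foldr (fun x v => ⁅x, v⁆) v) = 0 := h
    rw [LieSubmodule.Quotient.mk_eq_zero, hN] at h
    obtain ⟨c, hc⟩ := h
    rw [List.foldr_cons, ← hc, lie_smul, hkill z (hz z (by simp)), smul_zero]

end SolvableAction

/-! ### Roots of a solvable subalgebra -/

section Roots

open LieModule LieAlgebra LieAlgebra.IsKilling

variable {L : Type u} [LieRing L] [LieAlgebra ℂ L]

/-- A decomposition of a Lie algebra into a Cartan subalgebra `𝔥` and lines spanned by root vectors,
compatible with a subalgebra `𝔟` containing `𝔥`, together with an element `rho` of `𝔥` that is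
integral and positive on the roots of `𝔟`. -/
structure RootFrame (𝔥 𝔟 : LieSubalgebra ℂ L) (κ : Type*) [Fintype κ] where
  /-- The root vectors. -/
  vec : κ → L
  /-- The coordinates along the root vectors. -/
  coord : κ → Module.Dual ℂ L
  /-- The roots, extended to linear forms on the Lie algebra. -/
  root : κ → Module.Dual ℂ L
  /-- The roots of `𝔟`. -/
  pos : Set κ
  /-- The values of the roots on `rho`. -/
  wt : κ → ℤ
  /-- An integral element of `𝔥`. -/
  rho : L
  coord_vec_self : ∀ k, coord k (vec k) = 1
  coord_vec_ne : ∀ k l, k ≠ l → coord k (vec l) = 0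
  coord_cartan : ∀ k, ∀ x ∈ 𝔥, coord k x = 0
  lie_vec : ∀ k, ∀ x ∈ 𝔥, ⁅x, vec k⁆ = root k x • vec k
  sub_mem : ∀ x, x - ∑ k, coord k x • vec k ∈ 𝔥
  lie_cartan : ∀ x ∈ 𝔥, ∀ y ∈ 𝔥, ⁅x, y⁆ = 0
  mem_borel : ∀ x, x ∈ 𝔟 ↔ ∀ k ∉ pos, coord k x = 0
  rho_mem : rho ∈ 𝔥
  root_rho : ∀ k, root k rho = wt k
  wt_pos : ∀ k ∈ pos, 0 < wt k
  root_ne : ∀ k, ∃ x ∈ 𝔥, root k x ≠ 0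

variable [IsKilling ℂ L] [FiniteDimensional ℂ L] {𝔥 𝔟 : LieSubalgebra ℂ L} [𝔥.IsCartanSubalgebra]

theorem exists_smul_of_mem_rootSpace {α : Weight ℂ 𝔥 L} (hα : α.IsNonZero) {x y : L}
    (hx : x ∈ rootSpace 𝔥 α) (hx0 : x ≠ 0) (hy : y ∈ rootSpace 𝔥 α) : ∃ c : ℂ, c • x = y := by
  simpa using (finrank_eq_one_iff_of_nonzero' ⟨x, hx⟩ (by simpa using hx0)).mp
      (finrank_rootSpace_eq_one _ hα) ⟨_, hy⟩

/-- The root space of `α` is contained in the subalgebra `𝔟`. -/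
def RootLE (𝔟 : LieSubalgebra ℂ L) (α : 𝔥 → ℂ) : Prop := ∀ x ∈ rootSpace 𝔥 α, x ∈ 𝔟

theorem rootLE_of_mem {α : Weight ℂ 𝔥 L} (hα : α.IsNonZero) {x : L}
    (hx : x ∈ rootSpace 𝔥 α) (hx0 : x ≠ 0) (hxb : x ∈ 𝔟) : RootLE 𝔟 (α : 𝔥 → ℂ) := by
  intro y hy
  obtain ⟨c, rfl⟩ := exists_smul_of_mem_rootSpace hα hx hx0 hy
  exact 𝔟.smul_mem c hxb

/-- The subalgebra `𝔟` is stable under a root vector `f` of `α`, so it contains the part of the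
`α`-string above `β`. The triple is taken for `-α`, so that `f` raises by `α` and the primitive
vector `y` sits at the bottom of the string. A pairing equal to `-p` guarantees that the string
extends at least `p` steps beyond `β`. -/
theorem RootLE.reflect {α β γ : Weight ℂ 𝔥 L} (hα : α.IsNonZero)
    (hγ0 : γ.IsNonZero) (hαb : RootLE 𝔟 (α : 𝔥 → ℂ)) (hβb : RootLE 𝔟 (β : 𝔥 → ℂ))
    (p : ℕ) (hp : β (coroot α) = -(p : ℂ)) (hγ : (γ : 𝔥 → ℂ) = p • (α : 𝔥 → ℂ) + β) :
    RootLE 𝔟 (γ : 𝔥 → ℂ) := by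
  obtain ⟨y, hy, y_ne0⟩ := (chainTop (-α) β).exists_ne_zero
  obtain ⟨h, e, f, isSl2, he, hf⟩ := exists_isSl2Triple_of_weight_isNonZero hα.neg
  obtain rfl := isSl2.h_eq_coroot hα.neg he hf
  have prim : isSl2.HasPrimitiveVectorWith y (chainLength (-α) β : ℂ) :=
    have := lie_mem_genWeightSpace_of_mem_genWeightSpace he hy
    ⟨y_ne0, (chainLength_smul _ _ hy).symm, by
      rwa [Weight.coe_neg, genWeightSpace_add_chainTop _ _ (neg_ne_zero.2 hα)] at this⟩
  rw [Weight.coe_neg, neg_neg] at hf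
  have hq := fun n => toEnd_pow_apply_mem (M := L) hf hy n
  have hpow := fun n => prim.pow_toEnd_f_ne_zero_of_eq_nat rfl (i := n)
  have hfb : f ∈ 𝔟 := hαb f hf
  have hbeta : (chainBotCoeff α β) • (α : 𝔥 → ℂ) + (chainTop (-α) β : 𝔥 → ℂ) = β := by
    rw [coe_chainTop', Weight.coe_neg, chainTopCoeff_neg, smul_neg, add_neg_cancel_left]
  have h1 : (toEnd ℂ L L f ^ (chainBotCoeff α β)) y ∈ 𝔟 := by
    have := hq (chainBotCoeff α β)
    rw [hbeta] at this
    exact hβb _ this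
  have h2 : ∀ n : ℕ, (toEnd ℂ L L f ^ n) ((toEnd ℂ L L f ^ (chainBotCoeff α β)) y) ∈ 𝔟 := by
    intro n
    induction n with
    | zero => simpa using h1
    | succ n ih =>
      rw [pow_succ', Module.End.mul_apply]
      exact 𝔟.lie_mem hfb ih
  have h3 := h2 p
  rw [← Module.End.mul_apply, ← pow_add] at h3
  have hle : p + chainBotCoeff α β ≤ chainLength (-α) β := by
    rw [chainLength_neg, ← chainBotCoeff_add_chainTopCoeff]
    have := apply_coroot_eq_cast α β
    rw [hp] at this
    have h4 : -(p : ℤ) = chainBotCoeff α β - chainTopCoeff α β := by exact_mod_cast this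
    omega
  refine rootLE_of_mem hγ0 ?_ (hpow _ hle) h3
  have := hq (p + chainBotCoeff α β)
  rwa [add_smul, add_assoc, hbeta, ← hγ] at this

/-- Otherwise `𝔟` would contain an `𝔰𝔩₂`-triple. Its semisimple element `c = [e, f]` is a bracket in
`𝔟`, so by Lie's theorem it acts nilpotently on `L`, contradicting `[c, e] = 2e`. -/
theorem not_rootLE_neg [LieAlgebra.IsSolvable 𝔟] {α : Weight ℂ 𝔥 L} (hα : α.IsNonZero)
    (h : RootLE 𝔟 (α : 𝔥 → ℂ)) : ¬ RootLE 𝔟 (-(α : 𝔥 → ℂ)) := by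
  intro h'
  obtain ⟨c, e, f, isSl2, he, hf⟩ := exists_isSl2Triple_of_weight_isNonZero hα
  have heb := h e he
  have hfb := h' f hf
  have hcb : c ∈ 𝔟 := by rw [← isSl2.lie_e_f]; exact 𝔟.lie_mem heb hfb
  have hspan : (⟨c, hcb⟩ : 𝔟) ∈ Submodule.span ℂ {z | ∃ x y : 𝔟, ⁅x, y⁆ = z} :=
    Submodule.subset_span ⟨⟨e, heb⟩, ⟨f, hfb⟩, Subtype.ext isSl2.lie_e_f⟩
  have h0 := exists_foldr_lie_eq_zero (L := 𝔟) _ L rfl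
    (List.replicate (Module.finrank ℂ L) ⟨c, hcb⟩) (by simp)
    (fun z hz => by rw [List.eq_of_mem_replicate hz]; exact hspan) e
  have h1 : ∀ n : ℕ, (List.replicate n (⟨c, hcb⟩ : 𝔟)).foldr (fun x v => ⁅x, v⁆) e =
      (2 : ℂ) ^ n • e := by
    intro n
    induction n with
    | zero => simp
    | succ n ih =>
      rw [List.replicate_succ, List.foldr_cons, ih, lie_smul]
      change (2 : ℂ) ^ n • ⁅c, e⁆ = _
      rw [isSl2.lie_h_e_smul ℂ, smul_smul, pow_succ]
  rw [h1] at h0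
  exact isSl2.e_ne_zero ((smul_eq_zero.1 h0).resolve_left (pow_ne_zero _ two_ne_zero))

end Roots

/-! ### The element `ρ` and the root decomposition -/

section Frame

open LieModule LieAlgebra LieAlgebra.IsKilling

variable {L : Type u} [LieRing L] [LieAlgebra ℂ L]
variable [IsKilling ℂ L] [FiniteDimensional ℂ L] {𝔥 𝔟 : LieSubalgebra ℂ L} [𝔥.IsCartanSubalgebra]

/-- The reflection in `α` changes the sign of the pairing of `α` with `β^∨`. Roots of `s` whose
reflection stays in `s` therefore cancel in pairs. A root whose reflection leaves `s` has
nonnegative pairing, by `RootLE.reflect`. The root `α` is of the second kind, since `-α` is not in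
`s`, and contributes `2`. -/
theorem sum_pairing_pos [LieAlgebra.IsSolvable 𝔟] (s : Finset 𝔥.root)
    (hs : ∀ β, β ∈ s ↔ RootLE 𝔟 (β.1 : 𝔥 → ℂ)) {α : 𝔥.root} (hα : α ∈ s) :
    0 < ∑ β ∈ s, (rootSystem 𝔥).pairingIn ℤ α β := by
  classical
  set P := rootSystem 𝔥 with hP
  have hα0 : α.1.IsNonZero := 𝔥.isNonZero_coe_root α
  have hroot : ∀ β : 𝔥.root, ((P.reflectionPerm α β).1 : 𝔥 → ℂ) =
      (β.1 : 𝔥 → ℂ) - (β.1 (coroot α.1)) • (α.1 : 𝔥 → ℂ) := by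
    intro β
    have h := P.root_reflectionPerm α β
    rw [P.reflection_apply_root] at h
    funext x
    have := congrArg (fun t : Module.Dual ℂ 𝔥 => t x) h
    exact this
  have hanti : ∀ β, P.pairingIn ℤ α (P.reflectionPerm α β) = - P.pairingIn ℤ α β := by
    intro β
    rw [P.pairingIn_reflectionPerm, P.pairingIn_reflectionPerm_self_left]
  have hself : P.pairingIn ℤ α α = 2 := P.pairingIn_same ℤ α
  rw [← Finset.sum_filter_add_sum_filter_not s (fun β => P.reflectionPerm α β ∈ s)]
  have h1 : ∑ β ∈ s with P.reflectionPerm α β ∈ s, P.pairingIn ℤ α β = 0 := by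
    refine Finset.sum_involution (fun β _ => P.reflectionPerm α β) ?_ ?_ ?_ ?_
    · intro β _
      simp only [hanti, add_neg_cancel]
    · intro β _ hne heq
      have := hanti β
      rw [heq] at this
      omega
    · intro β hβ
      rw [Finset.mem_filter] at hβ ⊢
      refine ⟨hβ.2, ?_⟩
      simpa using hβ.1
    · intro β _
      simp
  have h2 : ∀ β ∈ s.filter (fun β => ¬ P.reflectionPerm α β ∈ s), 0 ≤ P.pairingIn ℤ α β := by
    intro β hβ
    rw [Finset.mem_filter] at hβ
    by_contra hlt
    push Not at hlt
    apply hβ.2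
    have hlt' : P.pairingIn ℤ β α < 0 := (P.pairingIn_lt_zero_iff ℤ).1 hlt
    obtain ⟨p, hp⟩ : ∃ p : ℕ, P.pairingIn ℤ β α = -(p : ℤ) :=
      ⟨(-P.pairingIn ℤ β α).toNat, by omega⟩
    have hp' : β.1 (coroot α.1) = -(p : ℂ) := by
      have := P.algebraMap_pairingIn ℤ β α
      rw [hp] at this
      simpa [hP] using this.symm
    rw [hs]
    refine RootLE.reflect hα0 (𝔥.isNonZero_coe_root _) ((hs α).1 hα) ((hs β).1 hβ.1) p hp' ?_
    rw [hroot, hp', neg_smul, sub_neg_eq_add, Nat.cast_smul_eq_nsmul, add_comm]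
  rw [h1, zero_add]
  have hmem : α ∈ s.filter (fun β => ¬ P.reflectionPerm α β ∈ s) := by
    rw [Finset.mem_filter]
    refine ⟨hα, fun h => ?_⟩
    rw [hs, hroot, root_apply_coroot hα0] at h
    refine not_rootLE_neg hα0 ((hs α).1 hα) ?_
    convert h using 1
    rw [two_smul]
    abel
  calc 0 < P.pairingIn ℤ α α := by rw [hself]; norm_num
    _ ≤ _ := Finset.single_le_sum h2 hmem

/-- Root spaces are lines, and the Killing form pairs the spaces of `α` and `-α` perfectly and kills
all other pairings with them. Coordinates are therefore Killing products with opposite root vectors.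
The element `rho` is the sum of the coroots of the roots of `𝔟`, which makes the weights integral.
-/
theorem exists_rootFrame [LieAlgebra.IsSolvable 𝔟] (hle : 𝔥 ≤ 𝔟) :
    Nonempty (RootFrame 𝔥 𝔟 𝔥.root) := by
  classical
  have hnz : ∀ k : 𝔥.root, k.1.IsNonZero := fun k => 𝔥.isNonZero_coe_root k
  choose e he he0 using fun k : 𝔥.root => k.1.exists_ne_zero
  have hneg : ∀ k : 𝔥.root, ∃ y ∈ rootSpace 𝔥 (-(k.1 : 𝔥 → ℂ)), killingForm ℂ L (e k) y = 1 := by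
    intro k
    by_contra hcon
    push Not at hcon
    apply he0 k
    have : e k ∈ LinearMap.ker (killingForm ℂ L) := by
      refine mem_ker_killingForm_of_mem_rootSpace_of_forall_rootSpace_neg ℂ L 𝔥 (he k) ?_
      intro y hy
      by_contra hne
      refine hcon ((killingForm ℂ L (e k) y)⁻¹ • y) (Submodule.smul_mem _ _ hy) ?_
      rw [map_smul, smul_eq_mul, inv_mul_cancel₀ hne]
    simpa using this
  choose y hy hey using hneg
  have hcartan0 : ∀ x ∈ 𝔥, x ∈ rootSpace 𝔥 (0 : 𝔥 → ℂ) := by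
    intro x hx
    rw [rootSpace_zero_eq]
    exact hx
  let crd : 𝔥.root → Module.Dual ℂ L := fun k => (killingForm ℂ L).flip (y k)
  have hcrd_ne : ∀ (k : 𝔥.root) (χ : 𝔥 → ℂ), χ ≠ (k.1 : 𝔥 → ℂ) → ∀ x ∈ rootSpace 𝔥 χ,
      crd k x = 0 := by
    intro k χ hχ x hx
    refine killingForm_apply_eq_zero_of_mem_rootSpace_of_add_ne_zero ℂ L 𝔥 hx (hy k) ?_
    intro h
    exact hχ (by rwa [add_neg_eq_zero] at h)
  have hdec : ∀ x, x - ∑ k, crd k x • e k ∈ 𝔥 := by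
    intro x
    have hx : x ∈ ⨆ χ : Weight ℂ 𝔥 L, genWeightSpace L χ := by
      rw [iSup_genWeightSpace_eq_top']; trivial
    induction hx using LieSubmodule.iSup_induction' with
    | mem χ x hx =>
      by_cases hχ : χ.IsZero
      · have hx' : x ∈ rootSpace 𝔥 (0 : 𝔥 → ℂ) := by rwa [hχ.eq] at hx
        rw [Finset.sum_eq_zero, sub_zero]
        · rw [rootSpace_zero_eq] at hx'
          exact hx'
        · intro k _
          rw [hcrd_ne k 0 (fun h => hnz k h.symm) x hx', zero_smul]
      · obtain ⟨c, rfl⟩ := exists_smul_of_mem_rootSpace (α := χ) hχ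
          (he ⟨χ, by simpa using hχ⟩) (he0 _) hx
        rw [Finset.sum_eq_single ⟨χ, by simpa using hχ⟩]
        · rw [map_smul]
          have : crd ⟨χ, by simpa using hχ⟩ (e ⟨χ, by simpa using hχ⟩) = 1 := hey _
          rw [this, smul_eq_mul, mul_one, sub_self]
          exact 𝔥.zero_mem
        · intro k _ hk
          rw [hcrd_ne k χ _ _ hx, zero_smul]
          intro h
          exact hk (Subtype.ext (DFunLike.coe_injective h.symm))
        · simp
    | zero => simp
    | add x z _ _ hx hz =>
      have : x + z - ∑ k, crd k (x + z) • e k =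
          (x - ∑ k, crd k x • e k) + (z - ∑ k, crd k z • e k) := by
        simp only [map_add, add_smul, Finset.sum_add_distrib]
        abel
      rw [this]
      exact 𝔥.add_mem hx hz
  -- The Killing form extends each root from `𝔥` to all of `L`, so that later the root can be
  -- evaluated through a function on the group.
  let rt : 𝔥.root → Module.Dual ℂ L :=
    fun k => killingForm ℂ L ((cartanEquivDual 𝔥).symm k.1 : 𝔥)
  have hrt : ∀ (k : 𝔥.root) (x : 𝔥), rt k x = k.1 x := by
    intro k x
    have : cartanEquivDual 𝔥 ((cartanEquivDual 𝔥).symm (k.1 : Module.Dual ℂ 𝔥)) x = k.1 x := by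
      rw [LinearEquiv.apply_symm_apply, Weight.toLinear_apply]
    exact this
  let s : Finset 𝔥.root := Finset.univ.filter fun β => RootLE 𝔟 (β.1 : 𝔥 → ℂ)
  have hs : ∀ β, β ∈ s ↔ RootLE 𝔟 (β.1 : 𝔥 → ℂ) := by simp [s]
  have hvb : ∀ k, k ∈ s ↔ e k ∈ 𝔟 := fun k =>
    ⟨fun h => (hs k).1 h _ (he k), fun h => (hs k).2 (rootLE_of_mem (hnz k) (he k) (he0 k) h)⟩
  -- As an `𝔥`-submodule, `𝔟` is the sum of its intersections with the weight spaces, so it contains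
  -- each root component of its elements.
  let N : LieSubmodule ℂ 𝔥 L :=
    { 𝔟.toSubmodule with lie_mem := fun {x m} hm => 𝔟.lie_mem (hle x.2) hm }
  have hNb : ∀ x, x ∈ N ↔ x ∈ 𝔟 := fun x => Iff.rfl
  have hcomp : ∀ x ∈ 𝔟, ∀ k, crd k x • e k ∈ 𝔟 := by
    intro x hx k
    rw [← hNb, eq_iSup_inf_genWeightSpace (K := ℂ) (N := N)] at hx
    induction hx using LieSubmodule.iSup_induction' with
    | mem χ x hx =>
      obtain ⟨hxb, hx⟩ := (LieSubmodule.mem_inf _ _ _).1 hx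
      by_cases hχ : (χ : 𝔥 → ℂ) = k.1
      · have hx' : x ∈ rootSpace 𝔥 (k.1 : 𝔥 → ℂ) := by rwa [hχ] at hx
        obtain ⟨c, rfl⟩ := exists_smul_of_mem_rootSpace (hnz k) (he k) (he0 k) hx'
        rw [map_smul]
        have : crd k (e k) = 1 := hey k
        rw [this, smul_eq_mul, mul_one]
        exact hxb
      · rw [hcrd_ne k χ hχ x hx, zero_smul]
        exact 𝔟.zero_mem
    | zero => simp
    | add x z _ _ hx hz =>
      rw [map_add, add_smul]
      exact 𝔟.add_mem hx hz
  refine ⟨{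
    vec := e
    coord := crd
    root := rt
    pos := {k | k ∈ s}
    wt := fun k => ∑ β ∈ s, (rootSystem 𝔥).pairingIn ℤ k β
    rho := ((∑ β ∈ s, coroot β.1 : 𝔥) : L)
    coord_vec_self := fun k => hey k
    coord_vec_ne := fun k l hkl => hcrd_ne k _
      (fun h => hkl (Subtype.ext (DFunLike.coe_injective h.symm))) _ (he l)
    coord_cartan := fun k x hx => hcrd_ne k 0 (fun h => hnz k h.symm) x (hcartan0 x hx)
    lie_vec := fun k x hx => ?_
    sub_mem := hdec
    lie_cartan := fun x hx z hz => ?_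
    mem_borel := fun x => ⟨fun hx k hk => ?_, fun hx => ?_⟩
    rho_mem := Subtype.property _
    root_rho := fun k => ?_
    wt_pos := fun k hk => sum_pairing_pos s hs hk
    root_ne := fun k => ?_ }⟩
  · rw [hrt k ⟨x, hx⟩]
    exact lie_eq_smul_of_mem_rootSpace (he k) ⟨x, hx⟩
  · have := LieModule.IsTrivial.trivial (⟨x, hx⟩ : 𝔥) (⟨z, hz⟩ : 𝔥)
    exact congrArg Subtype.val this
  · by_contra hne
    apply hk
    change k ∈ s
    rw [hvb]
    have := 𝔟.smul_mem (crd k x)⁻¹ (hcomp x hx k)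
    rwa [smul_smul, inv_mul_cancel₀ hne, one_smul] at this
  · have h1 := hle (hdec x)
    have h2 : ∑ k, crd k x • e k ∈ 𝔟 := by
      refine sum_mem fun k _ => ?_
      by_cases hk : k ∈ s
      · exact 𝔟.smul_mem _ ((hvb k).1 hk)
      · rw [hx k hk, zero_smul]
        exact 𝔟.zero_mem
    have := 𝔟.add_mem h1 h2
    rwa [sub_add_cancel] at this
  · rw [hrt]
    change (Weight.toLinear ℂ 𝔥 L k.1) (∑ β ∈ s, coroot β.1) = _
    rw [map_sum]
    push_cast
    refine Finset.sum_congr rfl fun β _ => ?_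
    have := (rootSystem 𝔥).algebraMap_pairingIn ℤ k β
    simpa using this.symm
  · have := hnz k
    by_contra hcon
    push Not at hcon
    apply this
    funext x
    have := hcon x x.2
    rwa [hrt] at this

end Frame

/-! ### The filtration of `𝔲` by `ρ`-weight -/

namespace RootFrame

variable {L : Type u} [LieRing L] [LieAlgebra ℂ L] {𝔥 𝔟 : LieSubalgebra ℂ L} {κ : Type v} [Fintype κ]
  (F : RootFrame 𝔥 𝔟 κ)

theorem lie_eq_sum {x : L} (hx : x ∈ 𝔥) (z : L) :
    ⁅x, z⁆ = ∑ k, (F.root k x * F.coord k z) • F.vec k := by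
  have h := F.lie_cartan x hx _ (F.sub_mem z)
  rw [lie_sub, sub_eq_zero] at h
  rw [h, lie_sum]
  refine Finset.sum_congr rfl fun k _ => ?_
  rw [lie_smul, F.lie_vec k x hx, smul_smul, mul_comm]

theorem coord_sum (c : κ → ℂ) (k : κ) : F.coord k (∑ l, c l • F.vec l) = c k := by
  rw [map_sum, Finset.sum_eq_single k]
  · rw [map_smul, F.coord_vec_self, smul_eq_mul, mul_one]
  · intro l _ hl
    rw [map_smul, F.coord_vec_ne k l hl.symm, smul_zero]
  · simp

theorem coord_lie {x : L} (hx : x ∈ 𝔥) (z : L) (k : κ) :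
    F.coord k ⁅x, z⁆ = F.root k x * F.coord k z := by
  rw [F.lie_eq_sum hx, F.coord_sum]

/-- An eigenvector of `rho` for a nonzero eigenvalue is a combination of root vectors. -/
theorem eq_sum_of_lie_rho {z : L} {c : ℂ} (hc : c ≠ 0) (h : ⁅F.rho, z⁆ = c • z) :
    z = ∑ k, F.coord k z • F.vec k := by
  have h1 := F.lie_eq_sum F.rho_mem z
  rw [h] at h1
  have h2 : z = ∑ k, (c⁻¹ * (F.root k F.rho * F.coord k z)) • F.vec k := by
    conv_lhs => rw [← inv_smul_smul₀ hc z, h1, Finset.smul_sum]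
    exact Finset.sum_congr rfl fun k _ => by rw [smul_smul]
  have h3 : ∀ k, F.coord k z = c⁻¹ * (F.root k F.rho * F.coord k z) := by
    intro k
    conv_lhs => rw [h2, F.coord_sum]
  conv_lhs => rw [h2]
  exact Finset.sum_congr rfl fun k _ => by rw [← h3]

/-- The span of the root vectors of `𝔟` of weight at least `j`. -/
def filt (j : ℤ) : Submodule ℂ L := Submodule.span ℂ {z | ∃ k ∈ F.pos, j ≤ F.wt k ∧ F.vec k = z}

theorem filt_anti {i j : ℤ} (h : i ≤ j) : F.filt j ≤ F.filt i :=
  Submodule.span_mono fun _ ⟨k, hk, hj, e⟩ => ⟨k, hk, h.trans hj, e⟩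

theorem vec_mem_borel {k : κ} (hk : k ∈ F.pos) : F.vec k ∈ 𝔟 := by
  rw [F.mem_borel]
  intro l hl
  exact F.coord_vec_ne l k (fun h => hl (h ▸ hk))

/-- The bracket is an eigenvector of `rho` with eigenvalue the sum of the weights. That sum is
positive, so there is no Cartan component and only root vectors of exactly this weight occur; they
belong to `𝔟` because the bracket does. -/
theorem lie_vec_vec_mem {k l : κ} (hk : k ∈ F.pos) (hl : l ∈ F.pos) :
    ⁅F.vec k, F.vec l⁆ ∈ F.filt (F.wt k + F.wt l) := by
  have hb : ⁅F.vec k, F.vec l⁆ ∈ 𝔟 := 𝔟.lie_mem (F.vec_mem_borel hk) (F.vec_mem_borel hl)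
  have hρ : ⁅F.rho, ⁅F.vec k, F.vec l⁆⁆ = ((F.wt k : ℂ) + F.wt l) • ⁅F.vec k, F.vec l⁆ := by
    rw [leibniz_lie, F.lie_vec k _ F.rho_mem, F.lie_vec l _ F.rho_mem, F.root_rho, F.root_rho,
      smul_lie, lie_smul, add_smul]
  have hpos := add_pos (F.wt_pos k hk) (F.wt_pos l hl)
  have hne : (F.wt k : ℂ) + F.wt l ≠ 0 := by exact_mod_cast hpos.ne'
  rw [F.eq_sum_of_lie_rho hne hρ]
  refine Submodule.sum_mem _ fun m _ => ?_
  by_cases hm : F.coord m ⁅F.vec k, F.vec l⁆ = 0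
  · rw [hm, zero_smul]
    exact Submodule.zero_mem _
  · refine Submodule.smul_mem _ _ (Submodule.subset_span ⟨m, ?_, ?_, rfl⟩)
    · by_contra hmp
      exact hm ((F.mem_borel _).1 hb m hmp)
    · have h1 := congrArg (F.coord m) hρ
      rw [F.coord_lie F.rho_mem, map_smul, smul_eq_mul, F.root_rho] at h1
      have h2 := mul_right_cancel₀ hm h1
      have h3 : F.wt m = F.wt k + F.wt l := by exact_mod_cast h2
      exact h3.ge

theorem lie_filt {i j : ℤ} {x y : L} (hx : x ∈ F.filt i) (hy : y ∈ F.filt j) :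
    ⁅x, y⁆ ∈ F.filt (i + j) := by
  unfold filt at hx
  induction hx using Submodule.span_induction with
  | mem x hx =>
    obtain ⟨k, hk, hki, rfl⟩ := hx
    unfold filt at hy
    induction hy using Submodule.span_induction with
    | mem y hy =>
      obtain ⟨l, hl, hlj, rfl⟩ := hy
      exact F.filt_anti (by omega) (F.lie_vec_vec_mem hk hl)
    | zero => simp
    | add a b _ _ ha hb => rw [lie_add]; exact add_mem ha hb
    | smul c a _ ha => rw [lie_smul]; exact Submodule.smul_mem _ _ ha
  | zero => simp
  | add a b _ _ ha hb => rw [add_lie]; exact add_mem ha hb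
  | smul c a _ ha => rw [smul_lie]; exact Submodule.smul_mem _ _ ha

theorem lie_cartan_filt {j : ℤ} {x y : L} (hx : x ∈ 𝔥) (hy : y ∈ F.filt j) :
    ⁅x, y⁆ ∈ F.filt j := by
  unfold filt at hy
  induction hy using Submodule.span_induction with
  | mem y hy =>
    obtain ⟨l, hl, hlj, rfl⟩ := hy
    rw [F.lie_vec l x hx]
    exact Submodule.smul_mem _ _ (Submodule.subset_span ⟨l, hl, hlj, rfl⟩)
  | zero => simp
  | add a b _ _ ha hb => rw [lie_add]; exact add_mem ha hb
  | smul c a _ ha => rw [lie_smul]; exact Submodule.smul_mem _ _ ha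

theorem filt_eq_bot : ∃ N : ℕ, F.filt N = ⊥ := by
  refine ⟨(∑ k, |F.wt k| + 1).toNat, ?_⟩
  rw [filt, Submodule.span_eq_bot]
  rintro z ⟨k, _, hj, rfl⟩
  exfalso
  have h1 := Finset.single_le_sum (f := fun k => |F.wt k|) (fun k _ => abs_nonneg _)
    (Finset.mem_univ k)
  have h2 := le_abs_self (F.wt k)
  have h3 : (0 : ℤ) ≤ ∑ k, |F.wt k| := Finset.sum_nonneg fun k _ => abs_nonneg _
  omega

theorem mem_borel_iff (x : L) : x ∈ 𝔟 ↔ ∃ h ∈ 𝔥, ∃ u ∈ F.filt 1, x = h + u := by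
  classical
  constructor
  · intro hx
    refine ⟨_, F.sub_mem x, ∑ k, F.coord k x • F.vec k, ?_, by abel⟩
    refine Submodule.sum_mem _ fun k _ => ?_
    by_cases hk : k ∈ F.pos
    · exact Submodule.smul_mem _ _ (Submodule.subset_span ⟨k, hk, F.wt_pos k hk, rfl⟩)
    · rw [(F.mem_borel x).1 hx k hk, zero_smul]
      exact Submodule.zero_mem _
  · rintro ⟨h, hh, u, hu, rfl⟩
    refine 𝔟.add_mem ((F.mem_borel h).2 fun k _ => F.coord_cartan k h hh) ?_
    have : F.filt 1 ≤ 𝔟.toSubmodule := by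
      rw [filt, Submodule.span_le]
      rintro z ⟨k, hk, _, rfl⟩
      exact F.vec_mem_borel hk
    exact this hu

/-- Brackets in `𝔟` lose their Cartan part because `𝔥` is commutative; conversely a root vector of
`𝔟` is a nonzero multiple of its bracket with `rho`. -/
theorem span_lie_borel : Submodule.span ℂ {z | ∃ x ∈ 𝔟, ∃ y ∈ 𝔟, ⁅x, y⁆ = z} = F.filt 1 := by
  apply le_antisymm
  · rw [Submodule.span_le]
    rintro z ⟨x, hx, y, hy, rfl⟩
    obtain ⟨h, hh, u, hu, rfl⟩ := (F.mem_borel_iff x).1 hx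
    obtain ⟨h', hh', u', hu', rfl⟩ := (F.mem_borel_iff y).1 hy
    rw [add_lie, lie_add, lie_add, F.lie_cartan h hh h' hh', zero_add]
    refine add_mem (F.lie_cartan_filt hh hu') (add_mem ?_ ?_)
    · rw [← lie_skew]
      exact neg_mem (F.lie_cartan_filt hh' hu)
    · exact F.filt_anti (by norm_num) (F.lie_filt hu hu')
  · rw [filt, Submodule.span_le]
    rintro z ⟨k, hk, _, rfl⟩
    have h1 : ((F.wt k : ℂ))⁻¹ • ⁅F.rho, F.vec k⁆ = F.vec k := by
      have : (F.wt k : ℂ) ≠ 0 := by exact_mod_cast (F.wt_pos k hk).ne'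
      rw [F.lie_vec k _ F.rho_mem, F.root_rho, smul_smul, inv_mul_cancel₀ this, one_smul]
    rw [SetLike.mem_coe, ← h1]
    exact Submodule.smul_mem _ _ (Submodule.subset_span
      ⟨_, (F.mem_borel _).2 fun l _ => F.coord_cartan l _ F.rho_mem, _, F.vec_mem_borel hk, rfl⟩)

end RootFrame

/-! ### Extension of scalars and membership tested on functions -/

section ScalarExtension

variable {H : Type u} [CommRing H] [HopfAlgebra ℂ H]
variable {S : Type v} [CommRing S] [Algebra ℂ S]
variable {S' : Type w} [CommRing S'] [Algebra ℂ S']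

/-- The distribution `x ⊗ 1` with coefficients in `S`. -/
def baseExt (S : Type v) [CommRing S] [Algebra ℂ S] (x : Dist H ℂ) : Dist H S :=
  distMap (Algebra.ofId ℂ S) x

theorem baseExt_apply (x : Dist H ℂ) (a : H) :
    (baseExt S x).ofConv a = algebraMap ℂ S (x.ofConv a) := rfl

theorem baseExt_mul (x y : Dist H ℂ) : baseExt S (x * y) = baseExt S x * baseExt S y :=
  map_mul _ _ _

theorem baseExt_lie (x y : Dist H ℂ) : baseExt S ⁅x, y⁆ = ⁅baseExt S x, baseExt S y⁆ := by
  rw [Dist.lie_def, Dist.lie_def, ← baseExt_mul, ← baseExt_mul]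
  exact map_sub _ _ _

theorem baseExt_smul (c : ℂ) (x : Dist H ℂ) :
    baseExt S (c • x) = algebraMap ℂ S c • baseExt S x :=
  dist_ext fun a => by
    rw [baseExt_apply, smul_ofConv, smul_ofConv, map_mul, baseExt_apply]

theorem distLin_baseExt (l : S →ₗ[ℂ] S') (s : S) (x : Dist H ℂ) :
    distLin l (s • baseExt S x) = l s • baseExt S' x := by
  refine dist_ext fun a => ?_
  rw [distLin_apply, smul_ofConv, smul_ofConv, baseExt_apply, baseExt_apply, mul_comm,
    ← Algebra.smul_def, map_smul, Algebra.smul_def, mul_comm]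

theorem distMap_baseExt (φ : S →ₐ[ℂ] S') (x : Dist H ℂ) :
    distMap φ (baseExt S x) = baseExt S' x :=
  dist_ext fun a => by simp [baseExt_apply, distMap_apply]

theorem sum_ofConv {ι : Type*} (s : Finset ι) (X : ι → Dist H S) (a : H) :
    (∑ i ∈ s, X i).ofConv a = ∑ i ∈ s, (X i).ofConv a := by
  let ev : Dist H S →+ S :=
    { toFun := fun X => X.ofConv a
      map_zero' := rfl
      map_add' := fun _ _ => rfl }
  exact map_sum ev X s

/-- A derivation at the identity is determined by its values on algebra generators. -/
theorem finite_lieAlg [Algebra.FiniteType ℂ H] : Module.Finite ℂ (lieAlg H ℂ) := by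
  obtain ⟨s, hs⟩ := Algebra.FiniteType.out (R := ℂ) (A := H)
  let ev : lieAlg H ℂ →ₗ[ℂ] (s → ℂ) :=
    { toFun := fun x i => x.1.ofConv i
      map_add' := fun x y => rfl
      map_smul' := fun c x => rfl }
  refine Module.Finite.of_injective ev ?_
  rw [← LinearMap.ker_eq_bot, LinearMap.ker_eq_bot']
  intro x hx
  refine Subtype.ext (dist_ext fun a => ?_)
  have hx' : IsTangent x.1 := x.2
  have ha : a ∈ Algebra.adjoin ℂ (s : Set H) := by rw [hs]; trivial
  change x.1.ofConv a = 0
  induction ha using Algebra.adjoin_induction with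
  | mem a ha => exact congrFun hx ⟨a, ha⟩
  | algebraMap r => rw [Algebra.algebraMap_eq_smul_one, map_smul, hx'.apply_one, smul_zero]
  | add a b _ _ ha hb => rw [map_add, ha, hb, add_zero]
  | mul a b _ _ ha hb => rw [hx' a b, ha, hb, smul_zero, smul_zero, add_zero]

/-- Functions separate distributions, so by duality in finite dimension they yield every linear
form. A form given by a function can be evaluated on `𝔤 ⊗ S` for every `S`. -/
theorem exists_eval [Module.Finite ℂ (lieAlg H ℂ)] (φ : Module.Dual ℂ (lieAlg H ℂ)) :
    ∃ f : H, ∀ x, φ x = x.1.ofConv f := by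
  let ev : H →ₗ[ℂ] Module.Dual ℂ (lieAlg H ℂ) :=
    { toFun := fun f =>
        { toFun := fun x => x.1.ofConv f
          map_add' := fun x y => rfl
          map_smul' := fun c x => rfl }
      map_add' := fun f g => LinearMap.ext fun x => map_add x.1.ofConv _ _
      map_smul' := fun c f => LinearMap.ext fun x => map_smul x.1.ofConv _ _ }
  by_contra hcon
  have hφ : φ ∉ LinearMap.range ev := by
    rintro ⟨f, rfl⟩
    exact hcon ⟨f, fun x => rfl⟩
  obtain ⟨ξ, hξ, hle⟩ := Submodule.exists_le_ker_of_notMem hφ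
  obtain ⟨x, rfl⟩ := (Module.evalEquiv ℂ (lieAlg H ℂ)).surjective ξ
  apply hξ
  have hx : x = 0 := by
    refine Subtype.ext (dist_ext fun a => ?_)
    exact hle ⟨a, rfl⟩
  rw [hx, map_zero, LinearMap.zero_apply]

theorem exists_functional {M : Type*} [AddCommGroup M] [Module ℂ M] {x : M} (hx : x ≠ 0) :
    ∃ l : M →ₗ[ℂ] ℂ, l x ≠ 0 := by
  by_contra hcon
  push Not at hcon
  exact hx ((Module.forall_dual_apply_eq_zero_iff ℂ x).1 hcon)

theorem isTangent_baseExt {x : Dist H ℂ} (hx : IsTangent x) : IsTangent (baseExt S x) := hx.map _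

theorem isTangent_of_mem_scalarExt {V : Submodule ℂ (lieAlg H ℂ)} {X : Dist H S}
    (hX : X ∈ scalarExt V S) : IsTangent X := by
  have : scalarExt V S ≤ (lieAlg H S).toSubmodule := by
    rw [scalarExt, Submodule.span_le]
    rintro _ ⟨x, _, rfl⟩
    exact IsTangent.map _ x.2
  exact this hX

theorem baseExt_mem_scalarExt {V : Submodule ℂ (lieAlg H ℂ)} {x : lieAlg H ℂ} (hx : x ∈ V) :
    baseExt S x.1 ∈ scalarExt V S :=
  Submodule.subset_span ⟨x, hx, rfl⟩

/-- `V ⊗ S` consists of the tangent distributions that vanish at all functions vanishing on `V`. -/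
theorem mem_scalarExt_iff [Module.Finite ℂ (lieAlg H ℂ)] {V : Submodule ℂ (lieAlg H ℂ)}
    {X : Dist H S} :
    X ∈ scalarExt V S ↔
      IsTangent X ∧ ∀ f : H, (∀ v ∈ V, v.1.ofConv f = 0) → X.ofConv f = 0 := by
  constructor
  · intro hX
    refine ⟨isTangent_of_mem_scalarExt hX, fun f hf => ?_⟩
    unfold scalarExt at hX
    induction hX using Submodule.span_induction with
    | mem X hX =>
      obtain ⟨x, hx, rfl⟩ := hX
      change algebraMap ℂ S (x.1.ofConv f) = 0
      rw [hf x hx, map_zero]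
    | zero => rfl
    | add X Y _ _ hX hY => rw [ofConv_add, LinearMap.add_apply, hX, hY, add_zero]
    | smul c X _ hX => rw [smul_ofConv, hX, mul_zero]
  · rintro ⟨hT, hX⟩
    let b := Module.finBasis ℂ V
    -- Functions representing the coordinates dual to a basis of `V`; the claim is that `X` equals
    -- its expansion in these coordinates.
    have hf : ∀ j, ∃ f : H, ∀ i, (b i).1.1.ofConv f = if i = j then 1 else 0 := by
      intro j
      obtain ⟨φ, hφ⟩ := LinearMap.exists_extend (b.coord j)
      obtain ⟨f, hf⟩ := exists_eval φ
      refine ⟨f, fun i => ?_⟩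
      rw [← hf]
      refine (LinearMap.congr_fun hφ (b i)).trans ?_
      rw [b.coord_apply, b.repr_self, Finsupp.single_apply]
    choose f hf using hf
    have key : X = ∑ j, X.ofConv (f j) • baseExt S (b j).1.1 := by
      refine dist_ext fun a => ?_
      by_contra hne
      -- A linear functional on `S` that detects the difference reduces the claim to `𝔤` itself: the
      -- image `Y` lies in `V` because it vanishes at the functions vanishing on `V`, and all its
      -- coordinates are zero.
      obtain ⟨l, hl⟩ := exists_functional (sub_ne_zero.2 hne)
      let Y : lieAlg H ℂ := ⟨distLin l (X - ∑ j, X.ofConv (f j) • baseExt S (b j).1.1), by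
        refine IsTangent.distLin l ((lieAlg H S).sub_mem hT (sum_mem fun j _ => ?_))
        exact (lieAlg H S).smul_mem _ (isTangent_baseExt (b j).1.2)⟩
      have hYapp : ∀ c, Y.1.ofConv c =
          l (X.ofConv c) - ∑ j, l (X.ofConv (f j)) * (b j).1.1.ofConv c := by
        intro c
        change (distLin l (X - ∑ j, X.ofConv (f j) • baseExt S (b j).1.1)).ofConv c = _
        rw [map_sub, map_sum, ofConv_sub, LinearMap.sub_apply, distLin_apply]
        simp only [distLin_baseExt]
        congr 1
        rw [sum_ofConv]
        rfl
      have hYV : Y ∈ V := by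
        by_contra hYV
        obtain ⟨φ, hφ, hle⟩ := Submodule.exists_le_ker_of_notMem hYV
        obtain ⟨g, hg⟩ := exists_eval φ
        apply hφ
        rw [hg, hYapp, hX g fun v hv => by rw [← hg]; exact hle hv, map_zero]
        have : ∀ j, (b j).1.1.ofConv g = 0 := fun j => by rw [← hg]; exact hle (b j).2
        simp [this]
      have hY0 : (⟨Y, hYV⟩ : V) = 0 := by
        apply b.repr.injective
        ext j
        have h1 : (⟨Y, hYV⟩ : V).1.1.ofConv (f j) = b.repr ⟨Y, hYV⟩ j := by
          conv_lhs => rw [← b.sum_repr ⟨Y, hYV⟩]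
          let ev : V →+ ℂ := { toFun := fun Z => Z.1.1.ofConv (f j), map_zero' := rfl, map_add' := fun _ _ => rfl }
          change ev _ = _
          rw [map_sum, Finset.sum_eq_single j]
          · change _ * (b j).1.1.ofConv (f j) = _
            rw [hf, if_pos rfl, mul_one]
          · intro i _ hi
            change _ * (b i).1.1.ofConv (f j) = _
            rw [hf, if_neg hi, mul_zero]
          · simp
        rw [← h1]
        change Y.1.ofConv (f j) = _
        rw [hYapp, Finset.sum_eq_single j]
        · simp [hf]
        · intro i _ hi
          rw [hf, if_neg hi, mul_zero]
        · simp
      apply hl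
      have h2 : Y.1.ofConv a = 0 := by
        have := congrArg (fun Z : V => Z.1.1.ofConv a) hY0
        exact this
      rw [← h2]
      change _ = (distLin l (X - ∑ j, X.ofConv (f j) • baseExt S (b j).1.1)).ofConv a
      rw [distLin_apply, ofConv_sub, LinearMap.sub_apply]
    rw [key]
    exact Submodule.sum_mem _ fun j _ => Submodule.smul_mem _ _ (baseExt_mem_scalarExt (b j).2)

end ScalarExtension

/-! ### Root coordinates on `𝔤 ⊗ S` -/

section Chart

variable {H : Type u} [CommRing H] [HopfAlgebra ℂ H]
variable {S : Type v} [CommRing S] [Algebra ℂ S]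
variable {S' : Type w} [CommRing S'] [Algebra ℂ S']

/-- A root frame of the Lie algebra of a group whose linear forms are evaluations at functions. -/
structure RootChart (𝔥 𝔟 : LieSubalgebra ℂ (lieAlg H ℂ)) (κ : Type*) [Fintype κ]
    extends RootFrame 𝔥 𝔟 κ where
  /-- Functions that represent the coordinates. -/
  crdFun : κ → H
  /-- Functions that represent the roots. -/
  rootFun : κ → H
  coord_eq : ∀ k x, coord k x = x.1.ofConv (crdFun k)
  root_eq : ∀ k x, root k x = x.1.ofConv (rootFun k)

theorem scalarExt_mono {V W : Submodule ℂ (lieAlg H ℂ)} (h : V ≤ W) :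
    scalarExt V S ≤ scalarExt W S :=
  Submodule.span_mono (Set.image_mono h)

theorem distLin_mem_scalarExt [Module.Finite ℂ (lieAlg H ℂ)] (l : S →ₗ[ℂ] S')
    {V : Submodule ℂ (lieAlg H ℂ)} {X : Dist H S} (hX : X ∈ scalarExt V S) :
    distLin l X ∈ scalarExt V S' := by
  rw [mem_scalarExt_iff] at hX ⊢
  exact ⟨hX.1.distLin l, fun f hf => by rw [distLin_apply, hX.2 f hf, map_zero]⟩

theorem lie_mem_scalarExt {V W U : Submodule ℂ (lieAlg H ℂ)}
    (h : ∀ x ∈ V, ∀ y ∈ W, ⁅x, y⁆ ∈ U) {X Y : Dist H S} (hX : X ∈ scalarExt V S)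
    (hY : Y ∈ scalarExt W S) : ⁅X, Y⁆ ∈ scalarExt U S := by
  unfold scalarExt at hX
  induction hX using Submodule.span_induction with
  | mem X hX =>
    obtain ⟨x, hx, rfl⟩ := hX
    unfold scalarExt at hY
    induction hY using Submodule.span_induction with
    | mem Y hY =>
      obtain ⟨y, hy, rfl⟩ := hY
      change ⁅baseExt S x.1, baseExt S y.1⁆ ∈ _
      rw [← baseExt_lie]
      exact baseExt_mem_scalarExt (h x hx y hy)
    | zero => rw [lie_zero]; exact Submodule.zero_mem _
    | add a b _ _ ha hb => rw [lie_add]; exact add_mem ha hb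
    | smul c a _ ha => rw [lie_smul]; exact Submodule.smul_mem _ _ ha
  | zero => rw [zero_lie]; exact Submodule.zero_mem _
  | add a b _ _ ha hb => rw [add_lie]; exact add_mem ha hb
  | smul c a _ ha => rw [smul_lie]; exact Submodule.smul_mem _ _ ha

theorem mem_scalarExt_top [Module.Finite ℂ (lieAlg H ℂ)] {X : Dist H S} (hX : IsTangent X) :
    X ∈ scalarExt ⊤ S := by
  rw [mem_scalarExt_iff]
  refine ⟨hX, fun f hf => ?_⟩
  by_contra hne
  obtain ⟨l, hl⟩ := exists_functional hne
  exact hl (hf ⟨distLin l X, hX.distLin l⟩ trivial)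

/-- Two tangent distributions agree if they agree at the functions `f` and `g`, as soon as
this holds over `ℂ`. -/
theorem IsTangent.apply_eq_zero [Module.Finite ℂ (lieAlg H ℂ)] {X : Dist H S} (hX : IsTangent X)
    {f : H} (hf : ∀ x : lieAlg H ℂ, x.1.ofConv f = 0) : X.ofConv f = 0 :=
  (mem_scalarExt_iff.1 (mem_scalarExt_top hX)).2 f fun v _ => hf v

namespace RootChart

variable {𝔥 𝔟 : LieSubalgebra ℂ (lieAlg H ℂ)} {κ : Type*} [Fintype κ]
variable (C : RootChart 𝔥 𝔟 κ)

theorem nilPart_eq : nilPart 𝔟 = C.filt 1 := C.span_lie_borel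

/-- The root vectors with coefficients in `S`. -/
def vecExt (S : Type v) [CommRing S] [Algebra ℂ S] (k : κ) : Dist H S := baseExt S (C.vec k).1

/-- The element `rho` with coefficients in `S`. -/
def rhoExt (S : Type v) [CommRing S] [Algebra ℂ S] : Dist H S := baseExt S C.rho.1

theorem rhoExt_mem : C.rhoExt S ∈ scalarExt 𝔥.toSubmodule S := baseExt_mem_scalarExt C.rho_mem

theorem rhoExt_apply (k : κ) : (C.rhoExt S).ofConv (C.rootFun k) = algebraMap ℂ S (C.wt k) := by
  rw [rhoExt, baseExt_apply, ← C.root_eq, C.root_rho]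

theorem vecExt_tangent (k : κ) : IsTangent (C.vecExt S k) := isTangent_baseExt (C.vec k).2

theorem sum_vecExt_apply (c : κ → S) (k : κ) :
    (∑ l, c l • C.vecExt S l).ofConv (C.crdFun k) = c k := by
  rw [sum_ofConv, Finset.sum_eq_single k]
  · rw [smul_ofConv, vecExt, baseExt_apply, ← C.coord_eq, C.coord_vec_self, map_one, mul_one]
  · intro l _ hl
    rw [smul_ofConv, vecExt, baseExt_apply, ← C.coord_eq, C.coord_vec_ne k l hl.symm, map_zero,
      mul_zero]
  · simp

theorem lie_vecExt {h : Dist H S} (hh : h ∈ scalarExt 𝔥.toSubmodule S) (k : κ) :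
    ⁅h, C.vecExt S k⁆ = h.ofConv (C.rootFun k) • C.vecExt S k := by
  unfold scalarExt at hh
  induction hh using Submodule.span_induction with
  | mem X hX =>
    obtain ⟨x, hx, rfl⟩ := hX
    change ⁅baseExt S x.1, baseExt S (C.vec k).1⁆ = _
    rw [← baseExt_lie]
    have := congrArg Subtype.val (C.lie_vec k x hx)
    rw [show ⁅x.1, (C.vec k).1⁆ = (C.root k x) • (C.vec k).1 from this, baseExt_smul, C.root_eq]
    rfl
  | zero => rw [zero_lie]; simp
  | add a b _ _ ha hb => rw [add_lie, ha, hb, ← add_smul]; rfl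
  | smul c a _ ha => rw [smul_lie, ha, smul_smul]; rfl

theorem lie_cartanExt (C : RootChart 𝔥 𝔟 κ) {h h' : Dist H S} (hh : h ∈ scalarExt 𝔥.toSubmodule S)
    (hh' : h' ∈ scalarExt 𝔥.toSubmodule S) : ⁅h, h'⁆ = 0 := by
  have := lie_mem_scalarExt (U := ⊥) (fun x hx y hy => by
    rw [Submodule.mem_bot]; exact C.lie_cartan x hx y hy) hh hh'
  rw [scalarExt, Submodule.bot_coe, Set.image_singleton, Submodule.mem_span_singleton] at this
  obtain ⟨c, hc⟩ := this
  rw [← hc]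
  simp

theorem filt_vecExt_mem {j : ℤ} {k : κ} (hk : k ∈ C.pos) (hj : j ≤ C.wt k) :
    C.vecExt S k ∈ scalarExt (C.filt j) S :=
  baseExt_mem_scalarExt (Submodule.subset_span ⟨k, hk, hj, rfl⟩)

/-- The vanishing of the other coordinates permits replacing the coefficients by arbitrary functions
of the weight without leaving `𝔲`. -/
theorem eq_sum_of_mem_filt {j : ℤ} {X : Dist H S} (hX : X ∈ scalarExt (C.filt j) S) :
    X = ∑ k, X.ofConv (C.crdFun k) • C.vecExt S k ∧
      ∀ k, ¬ (k ∈ C.pos ∧ j ≤ C.wt k) → X.ofConv (C.crdFun k) = 0 := by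
  classical
  have : X ∈ Submodule.span S {Z | ∃ k ∈ C.pos, j ≤ C.wt k ∧ C.vecExt S k = Z} := by
    unfold scalarExt at hX
    induction hX using Submodule.span_induction with
    | mem X hX =>
      obtain ⟨x, hx, rfl⟩ := hX
      unfold RootFrame.filt at hx
      induction hx using Submodule.span_induction with
      | mem x hx =>
        obtain ⟨k, hk, hj, rfl⟩ := hx
        exact Submodule.subset_span ⟨k, hk, hj, rfl⟩
      | zero =>
        have : (fun x : lieAlg H ℂ => distMap (Algebra.ofId ℂ S) x.1) 0 = 0 := map_zero _
        rw [this]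
        exact Submodule.zero_mem _
      | add a b _ _ ha hb =>
        have := add_mem ha hb
        rw [← map_add] at this
        exact this
      | smul c a _ ha =>
        change baseExt S (c • a.1) ∈ _
        rw [baseExt_smul]
        exact Submodule.smul_mem _ _ ha
    | zero => exact Submodule.zero_mem _
    | add a b _ _ ha hb => exact add_mem ha hb
    | smul c a _ ha => exact Submodule.smul_mem _ _ ha
  induction this using Submodule.span_induction with
  | mem X hX' =>
    obtain ⟨k, hk, hj, rfl⟩ := hX'
    have h1 : ∀ l, (C.vecExt S k).ofConv (C.crdFun l) = if l = k then 1 else 0 := by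
      intro l
      rw [vecExt, baseExt_apply, ← C.coord_eq]
      split_ifs with h
      · rw [h, C.coord_vec_self, map_one]
      · rw [C.coord_vec_ne l k h, map_zero]
    refine ⟨?_, fun l hl => ?_⟩
    · simp [h1]
    · rw [h1, if_neg]
      rintro rfl
      exact hl ⟨hk, hj⟩
  | zero => simp
  | add a b ha' hb' ha hb =>
    have hmem : ∀ {Z}, Z ∈ Submodule.span S {Z | ∃ k ∈ C.pos, j ≤ C.wt k ∧ C.vecExt S k = Z} →
        Z ∈ scalarExt (C.filt j) S := by
      intro Z hZ
      refine Submodule.span_le.2 ?_ hZ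
      rintro _ ⟨k, hk, hj, rfl⟩
      exact C.filt_vecExt_mem hk hj
    obtain ⟨e1, z1⟩ := ha (hmem ha')
    obtain ⟨e2, z2⟩ := hb (hmem hb')
    refine ⟨?_, fun k hk => ?_⟩
    · conv_lhs => rw [e1, e2, ← Finset.sum_add_distrib]
      exact Finset.sum_congr rfl fun k _ => by rw [← add_smul]; rfl
    · rw [ofConv_add, LinearMap.add_apply, z1 k hk, z2 k hk, add_zero]
  | smul c a ha' ha =>
    have hmem : a ∈ scalarExt (C.filt j) S := by
      refine Submodule.span_le.2 ?_ ha'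
      rintro _ ⟨k, hk, hj, rfl⟩
      exact C.filt_vecExt_mem hk hj
    obtain ⟨e1, z1⟩ := ha hmem
    refine ⟨?_, fun k hk => ?_⟩
    · conv_lhs => rw [e1, Finset.smul_sum]
      exact Finset.sum_congr rfl fun k _ => by rw [smul_smul]; rfl
    · rw [smul_ofConv, z1 k hk, mul_zero]

theorem sum_mem_filt {j : ℤ} (c : κ → S) (hc : ∀ k, ¬ (k ∈ C.pos ∧ j ≤ C.wt k) → c k = 0) :
    ∑ k, c k • C.vecExt S k ∈ scalarExt (C.filt j) S := by
  refine Submodule.sum_mem _ fun k _ => ?_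
  by_cases hk : k ∈ C.pos ∧ j ≤ C.wt k
  · exact Submodule.smul_mem _ _ (C.filt_vecExt_mem hk.1 hk.2)
  · rw [hc k hk, zero_smul]
    exact Submodule.zero_mem _

theorem exists_of_mem_borel {X : Dist H S} (hX : X ∈ scalarExt 𝔟.toSubmodule S) :
    ∃ h ∈ scalarExt 𝔥.toSubmodule S, ∃ e ∈ scalarExt (C.filt 1) S, X = h + e := by
  have : scalarExt 𝔟.toSubmodule S ≤ scalarExt 𝔥.toSubmodule S ⊔ scalarExt (C.filt 1) S := by
    conv_lhs => rw [scalarExt]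
    rw [Submodule.span_le]
    rintro _ ⟨x, hx, rfl⟩
    obtain ⟨h, hh, e, he, rfl⟩ := (C.mem_borel_iff x).1 hx
    exact Submodule.mem_sup.2 ⟨_, baseExt_mem_scalarExt hh, _, baseExt_mem_scalarExt he,
      (map_add _ _ _).symm⟩
  obtain ⟨h, hh, e, he, rfl⟩ := Submodule.mem_sup.1 (this hX)
  exact ⟨h, hh, e, he, rfl⟩

variable [Module.Finite ℂ (lieAlg H ℂ)]

theorem cartan_apply {h : Dist H S} (hh : h ∈ scalarExt 𝔥.toSubmodule S) (k : κ) :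
    h.ofConv (C.crdFun k) = 0 :=
  (mem_scalarExt_iff.1 hh).2 _ fun x hx => by rw [← C.coord_eq, C.coord_cartan k x hx]

theorem sub_sum_mem {X : Dist H S} (hX : IsTangent X) :
    X - ∑ k, X.ofConv (C.crdFun k) • C.vecExt S k ∈ scalarExt 𝔥.toSubmodule S := by
  rw [mem_scalarExt_iff]
  refine ⟨(lieAlg H S).sub_mem hX (sum_mem fun k _ =>
    (lieAlg H S).smul_mem _ (C.vecExt_tangent k)), fun f hf => ?_⟩
  -- The decomposition over `ℂ` says that all of `𝔤` vanishes at this function; such an identity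
  -- passes to `𝔤 ⊗ S`.
  have h1 : X.ofConv (f - ∑ k, (C.vec k).1.ofConv f • C.crdFun k) = 0 := by
    refine hX.apply_eq_zero fun x => ?_
    have h2 := hf _ (C.sub_mem x)
    rw [map_sub, map_sum]
    have h3 : (x - ∑ k, C.coord k x • C.vec k).1 =
        x.1 - ∑ k, C.coord k x • (C.vec k).1 := by
      rw [← LieSubalgebra.coe_incl, map_sub, map_sum]
      rfl
    rw [h3, ofConv_sub, LinearMap.sub_apply, sum_ofConv] at h2
    rw [← h2]
    congr 1
    refine Finset.sum_congr rfl fun k _ => ?_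
    rw [map_smul, smul_ofConv, smul_eq_mul, C.coord_eq, mul_comm]
  rw [map_sub, map_sum] at h1
  rw [ofConv_sub, LinearMap.sub_apply, sum_ofConv, ← h1]
  congr 1
  refine Finset.sum_congr rfl fun k _ => ?_
  rw [map_smul, smul_ofConv, vecExt, baseExt_apply, Algebra.smul_def, mul_comm]

theorem lie_eq_sum {h X : Dist H S} (hh : h ∈ scalarExt 𝔥.toSubmodule S) (hX : IsTangent X) :
    ⁅h, X⁆ = ∑ k, (h.ofConv (C.rootFun k) * X.ofConv (C.crdFun k)) • C.vecExt S k := by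
  have h1 := C.lie_cartanExt hh (C.sub_sum_mem hX)
  rw [lie_sub, sub_eq_zero] at h1
  rw [h1, lie_sum]
  refine Finset.sum_congr rfl fun k _ => ?_
  rw [lie_smul, C.lie_vecExt hh, smul_smul, mul_comm]

theorem lie_apply {h X : Dist H S} (hh : h ∈ scalarExt 𝔥.toSubmodule S) (hX : IsTangent X)
    (k : κ) : ⁅h, X⁆.ofConv (C.crdFun k) = h.ofConv (C.rootFun k) * X.ofConv (C.crdFun k) := by
  rw [C.lie_eq_sum hh hX, C.sum_vecExt_apply]

theorem mem_cartan_of_coord {X : Dist H S} (hX : IsTangent X)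
    (h : ∀ k, X.ofConv (C.crdFun k) = 0) : X ∈ scalarExt 𝔥.toSubmodule S := by
  have := C.sub_sum_mem hX
  rwa [Finset.sum_eq_zero fun k _ => by rw [h k, zero_smul], sub_zero] at this

/-- The root coordinates of `[h, X]` are those of `X` multiplied by the values of the roots at `h`,
which are units. -/
theorem mem_cartan_of_lie_eq_zero {h X : Dist H S} (hh : h ∈ scalarExt 𝔥.toSubmodule S)
    (hu : ∀ k, IsUnit (h.ofConv (C.rootFun k))) (hX : IsTangent X) (hc : ⁅h, X⁆ = 0) :
    X ∈ scalarExt 𝔥.toSubmodule S := by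
  refine C.mem_cartan_of_coord hX fun k => ?_
  have := C.lie_apply hh hX k
  rw [hc] at this
  exact (hu k).mul_right_eq_zero.1 this.symm

/-- A bracket with an element of `𝔥` lies in `𝔥` only if it vanishes. -/
theorem lie_eq_zero_of_mem_cartan (C : RootChart 𝔥 𝔟 κ) {h X : Dist H S} (hh : h ∈ scalarExt 𝔥.toSubmodule S)
    (hX : IsTangent X) (hc : ⁅h, X⁆ ∈ scalarExt 𝔥.toSubmodule S) : ⁅h, X⁆ = 0 := by
  rw [C.lie_eq_sum hh hX]
  refine Finset.sum_eq_zero fun k _ => ?_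
  rw [← C.lie_apply hh hX, C.cartan_apply hc, zero_smul]

end RootChart

end Chart

/-! ### Local nilpotence of `𝔲` -/

section LocalNilpotence

variable {H : Type u} [CommRing H] [HopfAlgebra ℂ H]
variable {S : Type v} [CommRing S] [Algebra ℂ S]

/-- The left ideal of the distributions `D` such that all left multiples of `D` vanish at `a`. -/
def annLeft (a : H) : Submodule (Dist H ℂ) (Dist H ℂ) where
  carrier := {D | ∀ E : Dist H ℂ, (E * D).ofConv a = 0}
  add_mem' := by
    intro X Y hX hY E
    rw [mul_add, ofConv_add, LinearMap.add_apply, hX, hY, add_zero]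
  zero_mem' := by
    intro E
    simp
  smul_mem' := by
    intro c X hX E
    rw [smul_eq_mul, ← mul_assoc]
    exact hX _

/-- The coproduct of `a` is a finite sum, and a distribution that vanishes at all its right factors
lies in the ideal. -/
theorem finite_quotient_annLeft (a : H) : Module.Finite ℂ (Dist H ℂ ⧸ annLeft a) := by
  let 𝓐 := Coalgebra.Repr.arbitrary ℂ a
  let ev : Dist H ℂ →ₗ[ℂ] (𝓐.index → ℂ) :=
    { toFun := fun D i => D.ofConv (𝓐.right i)
      map_add' := fun _ _ => rfl
      map_smul' := fun _ _ => rfl }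
  have hle : LinearMap.ker ev ≤ (annLeft a).restrictScalars ℂ := by
    intro D hD E
    rw [𝓐.convMul_apply]
    refine Finset.sum_eq_zero fun i hi => ?_
    have : D.ofConv (𝓐.right i) = 0 := congrFun hD ⟨i, hi⟩
    rw [this, mul_zero]
  have h1 : Module.Finite ℂ (Dist H ℂ ⧸ LinearMap.ker ev) :=
    Module.Finite.equiv ev.quotKerEquivRange.symm
  have h2 : Module.Finite ℂ (Dist H ℂ ⧸ (annLeft a).restrictScalars ℂ) :=
    Module.Finite.of_surjective (Submodule.factor hle) (Submodule.factor_surjective hle)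
  exact Module.Finite.equiv (Submodule.Quotient.restrictScalarsEquiv ℂ (annLeft a))

/-- Left multiplication makes the finite-dimensional quotient by `annLeft a` a `𝔟`-module. By Lie's
theorem, a product of as many elements of `𝔲` as its dimension annihilates the class of `1`. The
bound is uniform in `E` and in the factors. -/
theorem exists_prod_apply_eq_zero {𝔟 : LieSubalgebra ℂ (lieAlg H ℂ)} [LieAlgebra.IsSolvable 𝔟]
    (a : H) : ∃ N : ℕ, ∀ (E : Dist H ℂ) (l : List (lieAlg H ℂ)), l.length = N →
      (∀ z ∈ l, z ∈ nilPart 𝔟) → (E * (l.map Subtype.val).prod).ofConv a = 0 := by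
  let M := Dist H ℂ ⧸ annLeft a
  let f : 𝔟 →ₗ⁅ℂ⁆ Dist H ℂ := ((lieAlg H ℂ).incl).comp 𝔟.incl
  let _ : LieRingModule (Dist H ℂ) M := LieRingModule.ofAssociativeModule
  have : LieModule ℂ (Dist H ℂ) M := LieModule.ofAssociativeModule
  let _ : LieRingModule 𝔟 M := LieRingModule.compLieHom M f
  have : LieModule ℂ 𝔟 M := LieModule.compLieHom M f
  have : Module.Finite ℂ M := finite_quotient_annLeft a
  have hbr : ∀ (x : 𝔟) (D : Dist H ℂ),
      ⁅x, (Submodule.Quotient.mk D : M)⁆ = Submodule.Quotient.mk (x.1.1 * D) := fun x D => rfl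
  have hlift : ∀ z ∈ nilPart 𝔟, ∃ z' : 𝔟, z'.1 = z ∧
      z' ∈ Submodule.span ℂ {z | ∃ x y : 𝔟, ⁅x, y⁆ = z} := by
    intro z hz
    unfold nilPart at hz
    induction hz using Submodule.span_induction with
    | mem z hz =>
      obtain ⟨x, hx, y, hy, rfl⟩ := hz
      exact ⟨⁅(⟨x, hx⟩ : 𝔟), ⟨y, hy⟩⁆, rfl, Submodule.subset_span ⟨_, _, rfl⟩⟩
    | zero => exact ⟨0, rfl, Submodule.zero_mem _⟩
    | add p q _ _ hp hq =>
      obtain ⟨p', rfl, hp⟩ := hp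
      obtain ⟨q', rfl, hq⟩ := hq
      exact ⟨p' + q', rfl, add_mem hp hq⟩
    | smul c p _ hp =>
      obtain ⟨p', rfl, hp⟩ := hp
      exact ⟨c • p', rfl, Submodule.smul_mem _ _ hp⟩
  refine ⟨Module.finrank ℂ M, fun E l hl hz => ?_⟩
  have hl' : ∃ l' : List 𝔟, l'.map Subtype.val = l ∧
      ∀ z ∈ l', z ∈ Submodule.span ℂ {z | ∃ x y : 𝔟, ⁅x, y⁆ = z} := by
    clear hl
    induction l with
    | nil => exact ⟨[], rfl, by simp⟩
    | cons z l ih =>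
      obtain ⟨l', rfl, h⟩ := ih fun w hw => hz w (by simp [hw])
      obtain ⟨z', rfl, h'⟩ := hlift z (hz z (by simp))
      refine ⟨z' :: l', rfl, fun w hw => ?_⟩
      rcases List.mem_cons.1 hw with rfl | hw
      · exact h'
      · exact h w hw
  obtain ⟨l', rfl, hspan⟩ := hl'
  have h0 := exists_foldr_lie_eq_zero (L := 𝔟) _ M rfl l' (by simpa using hl) hspan
    (Submodule.Quotient.mk 1)
  have hfold : ∀ l' : List 𝔟, l'.foldr (fun x v => ⁅x, v⁆) (Submodule.Quotient.mk 1 : M) =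
      Submodule.Quotient.mk ((l'.map Subtype.val).map Subtype.val).prod := by
    intro l'
    induction l' with
    | nil => rfl
    | cons z l ih => rw [List.foldr_cons, ih, hbr]; simp
  exact (Submodule.Quotient.mk_eq_zero _).1 ((hfold l').symm.trans h0) E

theorem pow_mem_span_prod {V : Submodule ℂ (lieAlg H ℂ)} {X : Dist H S} (hX : X ∈ scalarExt V S)
    (k : ℕ) : X ^ k ∈ Submodule.span S {Z | ∃ l : List (lieAlg H ℂ), l.length = k ∧
      (∀ z ∈ l, z ∈ V) ∧ baseExt S (l.map Subtype.val).prod = Z} := by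
  induction k with
  | zero => exact Submodule.subset_span ⟨[], rfl, by simp, by simp [baseExt]⟩
  | succ k ih =>
    rw [pow_succ']
    unfold scalarExt at hX
    generalize X ^ k = Y at ih
    induction hX using Submodule.span_induction with
    | mem X hX =>
      obtain ⟨x, hx, rfl⟩ := hX
      induction ih using Submodule.span_induction with
      | mem Y hY =>
        obtain ⟨l, hl, hz, rfl⟩ := hY
        refine Submodule.subset_span ⟨x :: l, by simp [hl], ?_, ?_⟩
        · intro z hz'
          rcases List.mem_cons.1 hz' with rfl | h
          · exact hx
          · exact hz z h
        · rw [List.map_cons, List.prod_cons, baseExt_mul]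
          rfl
      | zero => rw [mul_zero]; exact Submodule.zero_mem _
      | add p q _ _ hp hq => rw [mul_add]; exact add_mem hp hq
      | smul c p _ hp => rw [mul_smul_comm]; exact Submodule.smul_mem _ _ hp
    | zero => rw [zero_mul]; exact Submodule.zero_mem _
    | add p q _ _ hp hq => rw [add_mul]; exact add_mem hp hq
    | smul c p _ hp => rw [smul_mul_assoc]; exact Submodule.smul_mem _ _ hp

/-- Elements of `𝔲 ⊗ S` are locally nilpotent. -/
theorem exists_pow_apply_eq_zero {𝔟 : LieSubalgebra ℂ (lieAlg H ℂ)} [LieAlgebra.IsSolvable 𝔟]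
    {X : Dist H S} (hX : X ∈ scalarExt (nilPart 𝔟) S) (a : H) :
    ∃ N : ℕ, ∀ k ≥ N, (X ^ k).ofConv a = 0 := by
  obtain ⟨N, hN⟩ := exists_prod_apply_eq_zero (𝔟 := 𝔟) a
  refine ⟨N, fun k hk => ?_⟩
  have h := pow_mem_span_prod hX k
  generalize X ^ k = Y at h ⊢
  induction h using Submodule.span_induction with
  | mem Y hY =>
    obtain ⟨l, hl, hz, rfl⟩ := hY
    rw [baseExt_apply]
    -- The last `N` factors suffice; the earlier ones are absorbed in the arbitrary left multiplier.
    have h1 := hN ((l.take (k - N)).map Subtype.val).prod (l.drop (k - N))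
      (by rw [List.length_drop]; omega) fun z h => hz z (List.mem_of_mem_drop h)
    rw [← List.prod_append, ← List.map_append, List.take_append_drop] at h1
    rw [h1, map_zero]
  | zero => rfl
  | add p q _ _ hp hq => rw [ofConv_add, LinearMap.add_apply, hp, hq, add_zero]
  | smul c p _ hp => rw [smul_ofConv, hp, mul_zero]

end LocalNilpotence

/-! ### Exponentials, polynomial and `z`-adic -/

section Exponential

open scoped PowerSeries

variable {H : Type u} [CommRing H] [HopfAlgebra ℂ H]
variable {S : Type v} [CommRing S] [Algebra ℂ S]
variable {R : Type v} [CommRing R] [Algebra ℂ R]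

theorem divPow_apply (X : Dist H S) (k : ℕ) (a : H) :
    (divPow X k).ofConv a = ((k.factorial : ℂ)⁻¹) • (X ^ k).ofConv a := rfl

/-- The polynomial loop `exp (s X)` of a locally nilpotent tangent distribution `X`. -/
theorem exists_polyExp {X : Dist H S} (hX : IsTangent X)
    (hN : ∀ a, ∃ N : ℕ, ∀ k ≥ N, (X ^ k).ofConv a = 0) :
    ∃ g : Points H (Polynomial S), ∀ a k, (g.ofConv a).coeff k = (divPow X k).ofConv a := by
  choose N hN using hN
  let p : H → Polynomial S := fun a =>
    ∑ k ∈ Finset.range (N a), Polynomial.monomial k ((divPow X k).ofConv a)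
  have hp : ∀ a k, (p a).coeff k = (divPow X k).ofConv a := by
    intro a k
    simp only [p, Polynomial.finsetSum_coeff, Polynomial.coeff_monomial]
    rw [Finset.sum_ite_eq' (Finset.range (N a))]
    split_ifs with h
    · rfl
    · rw [divPow_apply, hN a k (by simpa using h), smul_zero]
  let f : H →ₗ[ℂ] Polynomial S :=
    { toFun := p
      map_add' := fun a b => by
        ext k
        rw [Polynomial.coeff_add, hp, hp, hp, map_add]
      map_smul' := fun c a => by
        ext k
        rw [RingHom.id_apply, Polynomial.coeff_smul, hp, hp, map_smul] }
  refine ⟨toConv (AlgHom.ofLinearMap f ?_ ?_), hp⟩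
  · ext k
    change (p 1).coeff k = _
    rw [hp, divPow_apply_one hX, Polynomial.coeff_one]
  · intro a b
    ext k
    change (p (a * b)).coeff k = (p a * p b).coeff k
    rw [hp, hX.divPow_mul, Polynomial.coeff_mul]
    exact Finset.sum_congr rfl fun q _ => by rw [hp, hp]

theorem mul_apply_dvd {X Y : Dist H S} {c d : S} (hX : ∀ a, c ∣ X.ofConv a)
    (hY : ∀ a, d ∣ Y.ofConv a) (a : H) : c * d ∣ (X * Y).ofConv a := by
  rw [(Coalgebra.Repr.arbitrary ℂ a).convMul_apply]
  exact Finset.dvd_sum fun i _ => mul_dvd_mul (hX _) (hY _)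

theorem pow_apply_dvd {X : Dist H S} {c : S} (hX : ∀ a, c ∣ X.ofConv a) (k : ℕ) (a : H) :
    c ^ k ∣ (X ^ k).ofConv a := by
  induction k generalizing a with
  | zero => simp
  | succ k ih =>
    rw [pow_succ, pow_succ]
    exact mul_apply_dvd ih hX a

theorem sum_range_antidiagonal {A : Type*} [AddCommMonoid A] (F : ℕ × ℕ → A) (M : ℕ) :
    ∑ k ∈ Finset.range M, ∑ p ∈ Finset.HasAntidiagonal.antidiagonal k, F p =
      ∑ p ∈ (Finset.range M ×ˢ Finset.range M).filter (fun p => p.1 + p.2 < M), F p := by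
  refine Eq.trans ?_ (Finset.sum_fiberwise_of_maps_to
    (s := (Finset.range M ×ˢ Finset.range M).filter (fun p => p.1 + p.2 < M))
    (t := Finset.range M) (g := fun p : ℕ × ℕ => p.1 + p.2)
    (fun p hp => Finset.mem_range.2 (Finset.mem_filter.1 hp).2) F)
  refine Finset.sum_congr rfl fun k hk => Finset.sum_congr ?_ fun _ _ => rfl
  ext p
  simp only [Finset.HasAntidiagonal.mem_antidiagonal, Finset.mem_filter, Finset.mem_product,
    Finset.mem_range] at hk ⊢
  omega

/-- The exponential of a tangent distribution without constant term. -/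
theorem exists_isExp {X : Dist H R⟦X⟧} (hX : IsTangent X)
    (h0 : ∀ a, (PowerSeries.X : R⟦X⟧) ∣ X.ofConv a) : ∃ g : Points H R⟦X⟧, IsExp X g := by
  have hd : ∀ k a, (PowerSeries.X : R⟦X⟧) ^ k ∣ (divPow X k).ofConv a := by
    intro k a
    rw [divPow_apply, Algebra.smul_def]
    exact Dvd.dvd.mul_left (pow_apply_dvd h0 k a) _
  have hc : ∀ m k a, m < k → PowerSeries.coeff m ((divPow X k).ofConv a) = 0 :=
    fun m k a h => PowerSeries.X_pow_dvd_iff.1 (hd k a) m h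
  -- Since `X` is divisible by `z`, only the powers `k ≤ m` reach the coefficient of `z^m`; the same
  -- reason makes the discarded pairs below vanish.
  let p : H → R⟦X⟧ := fun a =>
    PowerSeries.mk fun m => ∑ k ∈ Finset.range (m + 1), PowerSeries.coeff m ((divPow X k).ofConv a)
  have hp : ∀ a m M, m < M → PowerSeries.coeff m (p a) =
      PowerSeries.coeff m (∑ k ∈ Finset.range M, (divPow X k).ofConv a) := by
    intro a m M hM
    rw [map_sum, PowerSeries.coeff_mk]
    refine Finset.sum_subset (Finset.range_mono (by omega)) fun k _ hk => hc m k a ?_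
    rw [Finset.mem_range] at hk
    omega
  let f : H →ₗ[ℂ] R⟦X⟧ :=
    { toFun := p
      map_add' := fun a b => by
        ext m
        rw [map_add, hp _ m (m + 1) (by omega), hp _ m (m + 1) (by omega),
          hp _ m (m + 1) (by omega), ← map_add, ← Finset.sum_add_distrib]
        simp only [map_add]
      map_smul' := fun c a => by
        ext m
        rw [RingHom.id_apply, PowerSeries.coeff_smul, hp _ m (m + 1) (by omega),
          hp _ m (m + 1) (by omega), ← PowerSeries.coeff_smul, Finset.smul_sum]
        simp only [map_smul] }
  refine ⟨toConv (AlgHom.ofLinearMap f ?_ ?_), ?_⟩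
  · ext m
    change PowerSeries.coeff m (p 1) = _
    rw [hp _ m (m + 1) (by omega), Finset.sum_eq_single 0]
    · rw [divPow_apply_one hX, if_pos rfl]
    · intro k _ hk
      rw [divPow_apply_one hX, if_neg hk]
    · simp
  · intro a b
    ext m
    change PowerSeries.coeff m (p (a * b)) = PowerSeries.coeff m (p a * p b)
    have h1 : PowerSeries.coeff m (p a * p b) = PowerSeries.coeff m
        ((∑ k ∈ Finset.range (m + 1), (divPow X k).ofConv a) *
          ∑ k ∈ Finset.range (m + 1), (divPow X k).ofConv b) := by
      rw [PowerSeries.coeff_mul, PowerSeries.coeff_mul]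
      refine Finset.sum_congr rfl fun q hq => ?_
      have := Finset.HasAntidiagonal.mem_antidiagonal.1 hq
      rw [hp a _ (m + 1) (by omega), hp b _ (m + 1) (by omega)]
    rw [h1, hp _ m (m + 1) (by omega)]
    simp only [hX.divPow_mul]
    rw [sum_range_antidiagonal, Finset.sum_mul_sum, ← Finset.sum_product', map_sum, map_sum]
    refine Finset.sum_subset (Finset.filter_subset _ _) fun q hq hq' => ?_
    refine PowerSeries.X_pow_dvd_iff.1
      ((pow_add (PowerSeries.X : R⟦X⟧) q.1 q.2) ▸ mul_dvd_mul (hd q.1 a) (hd q.2 b)) m ?_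
    rw [Finset.mem_filter] at hq'
    by_contra hlt
    exact hq' ⟨hq, by omega⟩
  · intro a m
    refine ⟨m + 1, fun M hM => ?_⟩
    change PowerSeries.coeff m (p a) = _
    rw [hp a m M (by omega), map_sum]
    exact Finset.sum_congr rfl fun k _ => by rw [divPow_apply, PowerSeries.coeff_smul]

end Exponential

/-! ### Locally finite sums of distributions -/

section LocSum

variable {H : Type u} [CommRing H] [HopfAlgebra ℂ H]
variable {S : Type v} [CommRing S] [Algebra ℂ S]
variable {S' : Type w} [CommRing S'] [Algebra ℂ S']

/-- The distribution `g` is the locally finite sum of the sequence `D`. -/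
def LocSum (D : ℕ → Dist H S) (g : Dist H S) : Prop :=
  ∀ a : H, ∃ N : ℕ, ∀ M ≥ N, g.ofConv a = ∑ k ∈ Finset.range M, (D k).ofConv a

theorem LocSum.unique {D : ℕ → Dist H S} {g g' : Dist H S} (h : LocSum D g) (h' : LocSum D g') :
    g = g' := by
  refine dist_ext fun a => ?_
  obtain ⟨N, hN⟩ := h a
  obtain ⟨N', hN'⟩ := h' a
  rw [hN _ (le_max_left N N'), hN' _ (le_max_right N N')]

theorem LocSum.distLin {D : ℕ → Dist H S} {g : Dist H S} (l : S →ₗ[ℂ] S') (h : LocSum D g) :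
    LocSum (fun k => distLin l (D k)) (distLin l g) := by
  intro a
  obtain ⟨N, hN⟩ := h a
  exact ⟨N, fun M hM => by rw [distLin_apply, hN M hM, map_sum]; rfl⟩

theorem LocSum.sub {D D' : ℕ → Dist H S} {g g' : Dist H S} (h : LocSum D g) (h' : LocSum D' g') :
    LocSum (fun k => D k - D' k) (g - g') := by
  intro a
  obtain ⟨N, hN⟩ := h a
  obtain ⟨N', hN'⟩ := h' a
  refine ⟨max N N', fun M hM => ?_⟩
  rw [ofConv_sub, LinearMap.sub_apply, hN M ((le_max_left N N').trans hM),
    hN' M ((le_max_right N N').trans hM), ← Finset.sum_sub_distrib]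
  rfl

/-- A convolution product at one function involves finitely many tensor factors; a common bound for
them is what makes multiplication compatible with locally finite sums. -/
theorem LocSum.exists_bound {D : ℕ → Dist H S} {g : Dist H S} (h : LocSum D g) {ι : Type*}
    (s : Finset ι) (f : ι → H) : ∃ N : ℕ, ∀ M ≥ N, ∀ i ∈ s,
      g.ofConv (f i) = ∑ k ∈ Finset.range M, (D k).ofConv (f i) := by
  choose N hN using h
  exact ⟨s.sup fun i => N (f i), fun M hM i hi =>
    hN _ M ((Finset.le_sup (f := fun i => N (f i)) hi).trans hM)⟩

theorem LocSum.mul_left {D : ℕ → Dist H S} {g : Dist H S} (Y : Dist H S) (h : LocSum D g) :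
    LocSum (fun k => Y * D k) (Y * g) := by
  intro a
  let 𝓐 := Coalgebra.Repr.arbitrary ℂ a
  obtain ⟨N, hN⟩ := h.exists_bound 𝓐.index 𝓐.right
  refine ⟨N, fun M hM => ?_⟩
  simp only [𝓐.convMul_apply]
  rw [Finset.sum_comm]
  exact Finset.sum_congr rfl fun i hi => by rw [hN M hM i hi, Finset.mul_sum]

theorem LocSum.mul_right {D : ℕ → Dist H S} {g : Dist H S} (Y : Dist H S) (h : LocSum D g) :
    LocSum (fun k => D k * Y) (g * Y) := by
  intro a
  let 𝓐 := Coalgebra.Repr.arbitrary ℂ a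
  obtain ⟨N, hN⟩ := h.exists_bound 𝓐.index 𝓐.left
  refine ⟨N, fun M hM => ?_⟩
  simp only [𝓐.convMul_apply]
  rw [Finset.sum_comm]
  exact Finset.sum_congr rfl fun i hi => by rw [hN M hM i hi, Finset.sum_mul]

theorem divPow_zero_left (k : ℕ) (hk : k ≠ 0) : divPow (0 : Dist H S) k = 0 := by
  rw [divPow, zero_pow hk, smul_zero]

theorem locSum_divPow_zero : LocSum (divPow (0 : Dist H S)) 1 := by
  intro a
  refine ⟨1, fun M hM => ?_⟩
  rw [Finset.sum_eq_single 0]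
  · rw [divPow_zero]
  · intro k _ hk
    rw [divPow_zero_left k hk]
    rfl
  · intro h
    exact absurd (Finset.mem_range.2 hM) h

theorem distMap_divPow (φ : S →ₐ[ℂ] S') (X : Dist H S) (k : ℕ) :
    distMap φ (divPow X k) = divPow (distMap φ X) k :=
  dist_ext fun a => by
    rw [distMap_apply, divPow_apply, divPow_apply, map_smul, ← map_pow, distMap_apply]

theorem LocSum.distMap_divPow {X : Dist H S} {g : Dist H S} (φ : S →ₐ[ℂ] S')
    (h : LocSum (divPow X) g) : LocSum (divPow (distMap φ X)) (distMap φ g) := by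
  intro a
  obtain ⟨N, hN⟩ := h a
  refine ⟨N, fun M hM => ?_⟩
  rw [distMap_apply, hN M hM, map_sum]
  simp only [← FormalConn.distMap_divPow, distMap_apply]

/-- The exponential of a locally nilpotent tangent distribution. -/
theorem exists_locSum_divPow {X : Dist H S} (hX : IsTangent X)
    (hN : ∀ a, ∃ N : ℕ, ∀ k ≥ N, (X ^ k).ofConv a = 0) :
    ∃ g : Points H S, LocSum (divPow X) (toDist g) := by
  obtain ⟨g, hg⟩ := exists_polyExp hX hN
  refine ⟨pointsMap ((Polynomial.aeval (1 : S)).restrictScalars ℂ) g, fun a => ?_⟩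
  refine ⟨(g.ofConv a).natDegree + 1, fun M hM => ?_⟩
  change Polynomial.aeval (1 : S) (g.ofConv a) = _
  rw [Polynomial.aeval_eq_sum_range' (show (g.ofConv a).natDegree < M by omega)]
  simp [hg]

end LocSum

/-! ### The grading by `ρ` and contracted points -/

section Euler

variable {H : Type u} [CommRing H] [HopfAlgebra ℂ H]
variable {S : Type v} [CommRing S] [Algebra ℂ S]

/-- The Euler derivation `t d/dt` of `S[t]`. -/
def euler (S : Type v) [CommRing S] [Algebra ℂ S] :
    Derivation ℂ (Polynomial S) (Polynomial S) :=
  ((Polynomial.X : Polynomial S) • (Polynomial.derivative' (R := S))).restrictScalars ℂ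

theorem euler_coeff (p : Polynomial S) (i : ℕ) : (euler S p).coeff i = i * p.coeff i := by
  change (Polynomial.X * Polynomial.derivative p).coeff i = _
  cases i with
  | zero => simp
  | succ i =>
    rw [Polynomial.coeff_X_mul, Polynomial.coeff_derivative]
    push_cast
    ring

/-- Evaluation of polynomials as a `ℂ`-algebra homomorphism. -/
def evalAt (c : S) : Polynomial S →ₐ[ℂ] S := (Polynomial.aeval c).restrictScalars ℂ

theorem evalAt_apply (c : S) (p : Polynomial S) : evalAt c p = p.eval c := by
  change Polynomial.aeval c p = _
  rw [Polynomial.coe_aeval_eq_eval]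

/-- Constant polynomials. -/
def constPoly (S : Type v) [CommRing S] [Algebra ℂ S] : S →ₐ[ℂ] Polynomial S :=
  (Polynomial.CAlgHom (R := S) (A := S)).restrictScalars ℂ

theorem constPoly_apply (s : S) : constPoly S s = Polynomial.C s := rfl

/-- The values are the power sums `∑ i^k p_i`. Linear combinations replace `i^k` by any complex
polynomial in `i`, in particular by one that isolates a single coefficient. -/
theorem eq_zero_of_eval_euler {p : Polynomial S}
    (h : ∀ k : ℕ, ((euler S)^[k] p).eval 1 = 0) : p = 0 := by
  have h1 : ∀ k i : ℕ, ((euler S)^[k] p).coeff i = (i : S) ^ k * p.coeff i := by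
    intro k
    induction k with
    | zero => simp
    | succ k ih =>
      intro i
      rw [Function.iterate_succ_apply', euler_coeff, ih]
      ring
  have hdeg : ∀ k, ((euler S)^[k] p).natDegree < p.natDegree + 1 := by
    intro k
    refine Nat.lt_succ_of_le (Polynomial.natDegree_le_iff_coeff_eq_zero.2 fun i hi => ?_)
    rw [h1, Polynomial.coeff_eq_zero_of_natDegree_lt hi, mul_zero]
  have h2 : ∀ k : ℕ, ∑ i ∈ Finset.range (p.natDegree + 1), (i : S) ^ k * p.coeff i = 0 := by
    intro k
    rw [← h k, Polynomial.eval_eq_sum_range' (hdeg k)]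
    exact Finset.sum_congr rfl fun i _ => by rw [h1, one_pow, mul_one]
  have h3 : ∀ q : Polynomial ℂ, ∑ i ∈ Finset.range (p.natDegree + 1),
      algebraMap ℂ S (q.eval (i : ℂ)) * p.coeff i = 0 := by
    intro q
    induction q using Polynomial.induction_on' with
    | add q q' hq hq' =>
      simp only [Polynomial.eval_add, map_add, add_mul, Finset.sum_add_distrib, hq, hq', add_zero]
    | monomial k c =>
      have := congrArg (fun x => algebraMap ℂ S c * x) (h2 k)
      simp only [Finset.mul_sum, mul_zero] at this
      rw [← this]
      refine Finset.sum_congr rfl fun i _ => ?_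
      rw [Polynomial.eval_monomial, map_mul, map_pow, map_natCast, mul_assoc]
  ext j
  rw [Polynomial.coeff_zero]
  by_cases hj : j < p.natDegree + 1
  swap
  · exact Polynomial.coeff_eq_zero_of_natDegree_lt (by omega)
  -- Lagrange's polynomial: it vanishes at the other exponents, and its value at `j` is a nonzero
  -- complex number, hence a unit in `S`.
  have h4 := h3 (∏ l ∈ (Finset.range (p.natDegree + 1)).erase j,
    (Polynomial.X - Polynomial.C (l : ℂ)))
  rw [Finset.sum_eq_single j] at h4
  · rw [Polynomial.eval_prod] at h4
    have hne : ∏ l ∈ (Finset.range (p.natDegree + 1)).erase j,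
        (Polynomial.X - Polynomial.C (l : ℂ)).eval (j : ℂ) ≠ 0 := by
      refine Finset.prod_ne_zero_iff.2 fun l hl => ?_
      rw [Polynomial.eval_sub, Polynomial.eval_X, Polynomial.eval_C, sub_ne_zero]
      exact Nat.cast_injective.ne (Finset.ne_of_mem_erase hl).symm
    exact (((isUnit_iff_ne_zero.2 hne).map (algebraMap ℂ S)).mul_right_eq_zero).1 h4
  · intro i hi hij
    rw [Polynomial.eval_prod, Finset.prod_eq_zero (Finset.mem_erase.2 ⟨hij, hi⟩) (by simp),
      map_zero, zero_mul]
  · intro h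
    exact absurd (Finset.mem_range.2 hj) h

/-- Compatibility of convolution with maps that are linear over a subring of coefficients. -/
theorem distLin_distMap_mul {S' : Type w} [CommRing S'] [Algebra ℂ S'] (φ : S →ₐ[ℂ] S')
    (l : S' →ₗ[ℂ] S) (hl : ∀ s x, l (φ s * x) = s * l x) (Y : Dist H S) (Z : Dist H S') :
    distLin l (distMap φ Y * Z) = Y * distLin l Z := by
  refine dist_ext fun a => ?_
  let 𝓐 := Coalgebra.Repr.arbitrary ℂ a
  rw [distLin_apply, 𝓐.convMul_apply, 𝓐.convMul_apply, map_sum]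
  exact Finset.sum_congr rfl fun i _ => hl _ _

theorem distLin_mul_distMap {S' : Type w} [CommRing S'] [Algebra ℂ S'] (φ : S →ₐ[ℂ] S')
    (l : S' →ₗ[ℂ] S) (hl : ∀ s x, l (φ s * x) = s * l x) (Y : Dist H S) (Z : Dist H S') :
    distLin l (Z * distMap φ Y) = distLin l Z * Y := by
  refine dist_ext fun a => ?_
  let 𝓐 := Coalgebra.Repr.arbitrary ℂ a
  rw [distLin_apply, 𝓐.convMul_apply, 𝓐.convMul_apply, map_sum]
  refine Finset.sum_congr rfl fun i _ => ?_
  rw [mul_comm, mul_comm (((distLin l) Z).ofConv _)]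
  exact hl _ _

/-- The action of the Euler derivation on distributions. -/
def eulerDist (X : Dist H (Polynomial S)) : Dist H (Polynomial S) :=
  distLin (euler S).toLinearMap X

theorem eulerDist_mul (X Y : Dist H (Polynomial S)) :
    eulerDist (X * Y) = eulerDist X * Y + X * eulerDist Y :=
  distLin_derivation_mul _ _ _

theorem eulerDist_const (X : Dist H S) : eulerDist (distMap (constPoly S) X) = 0 :=
  dist_ext fun a => by
    change euler S (Polynomial.C (X.ofConv a)) = 0
    ext i
    rw [euler_coeff, Polynomial.coeff_C]
    split_ifs with h <;> simp [h]

theorem eulerDist_one : eulerDist (1 : Dist H (Polynomial S)) = 0 := by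
  have := eulerDist_const (1 : Dist H S)
  rwa [map_one] at this

theorem eulerDist_sub (X Y : Dist H (Polynomial S)) :
    eulerDist (X - Y) = eulerDist X - eulerDist Y := map_sub _ _ _

theorem evalAt_const (c : S) (X : Dist H S) : distMap (evalAt c) (distMap (constPoly S) X) = X :=
  dist_ext fun a => by
    rw [distMap_apply, distMap_apply, evalAt_apply, constPoly_apply, Polynomial.eval_C]

/-- The distribution is homogeneous for the grading by `ρ`. -/
def IsGraded (ρ : Dist H S) (X : Dist H (Polynomial S)) : Prop :=
  eulerDist X = ⁅distMap (constPoly S) ρ, X⁆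

variable {ρ : Dist H S}

theorem IsGraded.one : IsGraded ρ (1 : Dist H (Polynomial S)) := by
  rw [IsGraded, eulerDist_one, Dist.lie_def, mul_one, one_mul, sub_self]

theorem IsGraded.mul {X Y : Dist H (Polynomial S)} (hX : IsGraded ρ X) (hY : IsGraded ρ Y) :
    IsGraded ρ (X * Y) := by
  rw [IsGraded, eulerDist_mul, hX, hY]
  simp only [Dist.lie_def]
  noncomm_ring

theorem IsGraded.sub {X Y : Dist H (Polynomial S)} (hX : IsGraded ρ X) (hY : IsGraded ρ Y) :
    IsGraded ρ (X - Y) := by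
  rw [IsGraded, eulerDist_sub, hX, hY, lie_sub]

theorem IsGraded.const {h : Dist H S} (hh : ⁅ρ, h⁆ = 0) :
    IsGraded ρ (distMap (constPoly S) h) := by
  rw [IsGraded, eulerDist_const, Dist.lie_def, ← map_mul, ← map_mul, ← map_sub, ← Dist.lie_def, hh,
    map_zero]

theorem IsGraded.inv {g : Points H (Polynomial S)} (hg : IsGraded ρ (toDist g)) :
    IsGraded ρ (toDist g⁻¹) := by
  have h1 : eulerDist (toDist g⁻¹ * toDist g) = 0 := by rw [toDist_inv_mul, eulerDist_one]
  rw [eulerDist_mul, hg] at h1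
  have h2 := congrArg (· * toDist g⁻¹) h1
  simp only [add_mul, mul_assoc, toDist_mul_inv, mul_one, zero_mul, Dist.lie_def, sub_mul,
    mul_sub] at h2
  rw [← mul_assoc (toDist g⁻¹) (toDist g), toDist_inv_mul, one_mul] at h2
  rw [IsGraded, Dist.lie_def]
  rw [add_sub, sub_eq_zero] at h2
  rw [← h2]
  abel

/-- Formally a graded family is `X(t) = t^ρ X(1) t^{-ρ}`. Every Euler iterate of `X` is again graded
and is an iterated bracket with `ρ`, so all iterates vanish at `t = 1`. -/
theorem IsGraded.eq_zero {X : Dist H (Polynomial S)} (hX : IsGraded ρ X)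
    (h1 : distMap (evalAt 1) X = 0) : X = 0 := by
  have key : ∀ k : ℕ, distMap (evalAt 1) (eulerDist^[k] X) = 0 ∧ IsGraded ρ (eulerDist^[k] X) := by
    intro k
    induction k with
    | zero => exact ⟨h1, hX⟩
    | succ k ih =>
      rw [Function.iterate_succ_apply']
      refine ⟨?_, ?_⟩
      · rw [ih.2, Dist.lie_def, map_sub, map_mul, map_mul, ih.1, mul_zero, zero_mul, sub_zero]
      · have hρ : IsGraded ρ (distMap (constPoly S) ρ) := IsGraded.const (lie_self ρ)
        have := (hρ.mul ih.2).sub (ih.2.mul hρ)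
        rwa [← Dist.lie_def, ← ih.2] at this
  have happ : ∀ (k : ℕ) a, (eulerDist^[k] X).ofConv a = (euler S)^[k] (X.ofConv a) := by
    intro k a
    induction k with
    | zero => rfl
    | succ k ih =>
      rw [Function.iterate_succ_apply', Function.iterate_succ_apply', ← ih]
      rfl
  refine dist_ext fun a => eq_zero_of_eval_euler fun k => ?_
  rw [← happ, ← evalAt_apply, ← distMap_apply, (key k).1]
  rfl

/-- The points which are contracted to the identity by the one-parameter group of `ρ`. -/
def contracted (ρ : Dist H S) : Subgroup (Points H S) where
  carrier := {g | ∃ g' : Points H (Polynomial S), IsGraded ρ (toDist g') ∧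
    pointsMap (evalAt 1) g' = g ∧ pointsMap (evalAt 0) g' = 1}
  one_mem' := ⟨1, IsGraded.one, map_one _, map_one _⟩
  mul_mem' := by
    rintro _ _ ⟨g, hg, rfl, hg0⟩ ⟨k, hk, rfl, hk0⟩
    exact ⟨g * k, hg.mul hk, map_mul _ _ _, by rw [map_mul, hg0, hk0, one_mul]⟩
  inv_mem' := by
    rintro _ ⟨g, hg, rfl, hg0⟩
    exact ⟨g⁻¹, hg.inv, map_inv _ _, by rw [map_inv, hg0, inv_one]⟩

end Euler

/-! ### Rigidity of contracted points -/

section Contracted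

variable {H : Type u} [CommRing H] [HopfAlgebra ℂ H]
variable {S : Type v} [CommRing S] [Algebra ℂ S]
variable {𝔥 𝔟 : LieSubalgebra ℂ (lieAlg H ℂ)} {κ : Type*} [Fintype κ]

namespace RootChart

variable (C : RootChart 𝔥 𝔟 κ)

theorem lie_rhoExt_vecExt [Module.Finite ℂ (lieAlg H ℂ)] (k : κ) :
    ⁅C.rhoExt S, C.vecExt S k⁆ = (C.wt k : S) • C.vecExt S k := by
  rw [C.lie_vecExt C.rhoExt_mem, C.rhoExt_apply, map_intCast]

/-- The exponential of an element of `𝔲 ⊗ S` is contracted by `rho`. -/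
theorem mem_contracted_of_locSum [Module.Finite ℂ (lieAlg H ℂ)] [LieAlgebra.IsSolvable 𝔟]
    {X : Dist H S} (hX : X ∈ scalarExt (nilPart 𝔟) S) {g : Points H S}
    (hg : LocSum (divPow X) (toDist g)) : g ∈ contracted (C.rhoExt S) := by
  rw [C.nilPart_eq] at hX
  obtain ⟨e, z⟩ := C.eq_sum_of_mem_filt hX
  set c : κ → S := fun k => X.ofConv (C.crdFun k)
  -- This is `t^ρ X t^{-ρ}`. It is polynomial and vanishes at `t = 0` because only positive weights
  -- occur; where `toNat` would truncate a weight, the coefficient is zero.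
  let Y : Dist H (Polynomial S) :=
    ∑ k, Polynomial.monomial (C.wt k).toNat (c k) • C.vecExt (Polynomial S) k
  have hY : Y ∈ scalarExt (C.filt 1) (Polynomial S) :=
    C.sum_mem_filt _ fun k hk => by rw [show c k = 0 from z k hk, map_zero]
  have hρ : distMap (constPoly S) (C.rhoExt S) = C.rhoExt (Polynomial S) := distMap_baseExt _ _
  have hYg : IsGraded (C.rhoExt S) Y := by
    rw [IsGraded, hρ, lie_sum, eulerDist, map_sum]
    refine Finset.sum_congr rfl fun k _ => ?_
    rw [lie_smul, C.lie_rhoExt_vecExt, vecExt, distLin_baseExt, smul_smul]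
    congr 1
    ext i
    change (euler S _).coeff i = _
    rw [euler_coeff, mul_comm, ← Polynomial.C_eq_intCast, Polynomial.coeff_mul_C,
      Polynomial.coeff_monomial]
    split_ifs with hi
    · by_cases hk : k ∈ C.pos ∧ 1 ≤ C.wt k
      · rw [← hi]
        congr 1
        rw [← Int.cast_natCast, Int.toNat_of_nonneg (by omega)]
      · rw [show c k = 0 from z k hk, zero_mul, zero_mul]
    · rw [zero_mul, zero_mul]
  have hev : ∀ r : S, distMap (evalAt r) Y =
      ∑ k, (c k * r ^ (C.wt k).toNat) • C.vecExt S k := by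
    intro r
    rw [map_sum]
    refine Finset.sum_congr rfl fun k _ => ?_
    rw [distMap_smul, vecExt, distMap_baseExt, evalAt_apply, Polynomial.eval_monomial]
    rfl
  have h1 : distMap (evalAt 1) Y = X := by
    rw [hev]
    conv_rhs => rw [e]
    simp [c]
  have h0 : distMap (evalAt 0) Y = 0 := by
    rw [hev]
    refine Finset.sum_eq_zero fun k _ => ?_
    by_cases hk : k ∈ C.pos ∧ 1 ≤ C.wt k
    · rw [zero_pow (by omega), mul_zero, zero_smul]
    · rw [show c k = 0 from z k hk, zero_mul, zero_smul]
  obtain ⟨G, hG⟩ := exists_locSum_divPow (isTangent_of_mem_scalarExt hY)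
    (exists_pow_apply_eq_zero (𝔟 := 𝔟) (by rw [C.nilPart_eq]; exact hY))
  refine ⟨G, ?_, ?_, ?_⟩
  · have hk : ∀ k, IsGraded (C.rhoExt S) (divPow Y k) := by
      intro k
      have hp : IsGraded (C.rhoExt S) (Y ^ k) := by
        induction k with
        | zero => rw [pow_zero]; exact IsGraded.one
        | succ k ih => rw [pow_succ]; exact ih.mul hYg
      rw [IsGraded, divPow, eulerDist, map_smul, lie_smul]
      exact congrArg _ hp
    -- The Euler derivative and the bracket with `rho` of the exponential are locally finite sums
    -- with equal terms.
    have l1 := hG.distLin (euler S).toLinearMap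
    have l2 := (hG.mul_left (distMap (constPoly S) (C.rhoExt S))).sub
      (hG.mul_right (distMap (constPoly S) (C.rhoExt S)))
    rw [show (fun k => distLin (euler S).toLinearMap (divPow Y k)) = _ from funext hk] at l1
    exact l1.unique l2
  · refine toDist_injective ?_
    rw [toDist_pointsMap]
    refine LocSum.unique (hG.distMap_divPow _) ?_
    rw [h1]
    exact hg
  · refine toDist_injective ?_
    rw [toDist_pointsMap]
    refine LocSum.unique (hG.distMap_divPow _) ?_
    rw [h0]
    exact locSum_divPow_zero

/-- Cartan elements commute with `rho`, so both sides are graded, and they agree at `t = 1`. -/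
theorem lift_intertwine {h h' : Dist H S} (hh : h ∈ scalarExt 𝔥.toSubmodule S)
    (hh' : h' ∈ scalarExt 𝔥.toSubmodule S) {g : Points H (Polynomial S)}
    (hg : IsGraded (C.rhoExt S) (toDist g))
    (hc : toDist (pointsMap (evalAt 1) g) * h = h' * toDist (pointsMap (evalAt 1) g)) :
    toDist g * distMap (constPoly S) h = distMap (constPoly S) h' * toDist g := by
  rw [← sub_eq_zero]
  refine IsGraded.eq_zero (ρ := C.rhoExt S) ?_ ?_
  · exact (hg.mul (IsGraded.const (C.lie_cartanExt C.rhoExt_mem hh))).sub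
      ((IsGraded.const (C.lie_cartanExt C.rhoExt_mem hh')).mul hg)
  · rw [map_sub, map_mul, map_mul, evalAt_const, evalAt_const, ← toDist_pointsMap, hc, sub_self]

/-- Specialize the lifted relation to `t = 0`, where the family is the identity. -/
theorem eq_of_contracted_conj {h h' : Dist H S} (hh : h ∈ scalarExt 𝔥.toSubmodule S)
    (hh' : h' ∈ scalarExt 𝔥.toSubmodule S) {g : Points H S} (hg : g ∈ contracted (C.rhoExt S))
    (hc : toDist g * h = h' * toDist g) : h = h' := by
  obtain ⟨g, hg, rfl, h0⟩ := hg
  have := congrArg (distMap (evalAt 0)) (C.lift_intertwine hh hh' hg hc)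
  rwa [map_mul, map_mul, evalAt_const, evalAt_const, ← toDist_pointsMap, h0, toDist_one, one_mul,
    mul_one] at this

/-- The first nonzero positive coefficient in `t` of the family would be a tangent vector commuting
with `h`, hence Cartan, hence of `ρ`-weight zero. The grading gives it weight equal to its degree,
so it cannot exist and the family is constant. -/
theorem eq_one_of_contracted_comm [Module.Finite ℂ (lieAlg H ℂ)] {h : Dist H S}
    (hh : h ∈ scalarExt 𝔥.toSubmodule S)
    (hu : ∀ k, IsUnit (h.ofConv (C.rootFun k))) {g : Points H S}
    (hg : g ∈ contracted (C.rhoExt S)) (hc : toDist g * h = h * toDist g) : g = 1 := by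
  obtain ⟨g, hg, rfl, h0⟩ := hg
  have hc := C.lift_intertwine hh hh hg hc
  let co : ℕ → Polynomial S →ₗ[ℂ] S := fun j => (Polynomial.lcoeff S j).restrictScalars ℂ
  have hco : ∀ (j : ℕ) s x, co j (constPoly S s * x) = s * co j x :=
    fun j s x => Polynomial.coeff_C_mul x
  have hz : distLin (co 0) (toDist g) = 1 := by
    have := congrArg toDist h0
    rw [toDist_pointsMap, toDist_one] at this
    rw [← this]
    refine dist_ext fun a => ?_
    rw [distMap_apply, evalAt_apply, ← Polynomial.coeff_zero_eq_eval_zero]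
    rfl
  have key : ∀ j : ℕ, 1 ≤ j → distLin (co j) (toDist g) = 0 := by
    intro j
    induction j using Nat.strong_induction_on with
    | _ j ih =>
      intro hj
      -- The intermediate coefficients vanish and the constant one is the counit, so
      -- multiplicativity leaves only the two extreme terms, which is the Leibniz rule.
      have htan : IsTangent (distLin (co j) (toDist g)) := by
        intro a b
        change (g.ofConv (a * b)).coeff j = _
        rw [map_mul, Polynomial.coeff_mul,
          ← Finset.sum_subset (s₁ := {((0 : ℕ), j), (j, (0 : ℕ))})]
        · have hz' : ∀ a, (g.ofConv a).coeff 0 = algebraMap ℂ S (Coalgebra.counit a) := fun a =>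
            congrArg (fun X : Dist H S => X.ofConv a) hz
          rw [Finset.sum_pair (by simp; omega)]
          simp only [hz', Algebra.smul_def]
          rw [mul_comm ((g.ofConv a).coeff j)]
          rfl
        · intro p hp
          rw [Finset.mem_insert, Finset.mem_singleton] at hp
          rw [Finset.HasAntidiagonal.mem_antidiagonal]
          rcases hp with rfl | rfl <;> simp
        · intro p hp hp'
          rw [Finset.HasAntidiagonal.mem_antidiagonal] at hp
          have : p.1 ≠ 0 := by
            intro h
            apply hp'
            rw [Finset.mem_insert]
            exact Or.inl (Prod.ext h (by simp; omega))
          have h' : p.2 ≠ 0 := by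
            intro h
            apply hp'
            rw [Finset.mem_insert, Finset.mem_singleton]
            exact Or.inr (Prod.ext (by simp; omega) h)
          have := congrArg (fun X : Dist H S => X.ofConv a) (ih p.1 (by omega) (by omega))
          change (g.ofConv a).coeff p.1 = 0 at this
          rw [this, zero_mul]
      have hcj : ⁅h, distLin (co j) (toDist g)⁆ = 0 := by
        have := congrArg (distLin (co j)) hc
        rw [distLin_distMap_mul _ _ (hco j), distLin_mul_distMap _ _ (hco j)] at this
        rw [Dist.lie_def, this, sub_self]
      have hmem := C.mem_cartan_of_lie_eq_zero hh hu htan hcj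
      have h1 := C.lie_cartanExt C.rhoExt_mem hmem
      have h2 := congrArg (distLin (co j)) hg
      rw [Dist.lie_def, map_sub, distLin_distMap_mul _ _ (hco j),
        distLin_mul_distMap _ _ (hco j), ← Dist.lie_def, h1] at h2
      refine dist_ext fun a => ?_
      have h3 := congrArg (fun X : Dist H S => X.ofConv a) h2
      change (euler S (g.ofConv a)).coeff j = 0 at h3
      rw [euler_coeff] at h3
      have hju : IsUnit (j : S) := by
        have := (isUnit_iff_ne_zero.2 (Nat.cast_ne_zero.2 (by omega : j ≠ 0) : (j : ℂ) ≠ 0)).map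
          (algebraMap ℂ S)
        rwa [map_natCast] at this
      exact hju.mul_right_eq_zero.1 h3
  refine toDist_injective (dist_ext fun a => ?_)
  change evalAt 1 (g.ofConv a) = _
  rw [evalAt_apply, Polynomial.eval_eq_sum_range, Finset.sum_eq_single 0]
  · rw [one_pow, mul_one]
    exact congrArg (fun X : Dist H S => X.ofConv a) hz
  · intro j _ hj
    have := congrArg (fun X : Dist H S => X.ofConv a) (key j (by omega))
    change (g.ofConv a).coeff j = 0 at this
    rw [this, zero_mul]
  · simp

end RootChart

end Contracted

/-! ### Truncation modulo `z^n` and clearing the pole -/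

section Truncation

open scoped PowerSeries LaurentSeries

variable {H : Type u} [CommRing H] [HopfAlgebra ℂ H]
variable {R : Type v} [CommRing R] [Algebra ℂ R]
variable {𝔥 𝔟 : LieSubalgebra ℂ (lieAlg H ℂ)} {κ : Type*} [Fintype κ]

/-- The truncated power series ring `R[z]/z^n`. -/
abbrev Trunc (R : Type v) [CommRing R] (n : ℕ) : Type v :=
  R⟦X⟧ ⧸ (Ideal.span {(PowerSeries.X : R⟦X⟧) ^ n})

/-- Truncation of power series modulo `z^n`. -/
def truncMap (R : Type v) [CommRing R] [Algebra ℂ R] (n : ℕ) : R⟦X⟧ →ₐ[ℂ] Trunc R n :=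
  Ideal.Quotient.mkₐ ℂ _

theorem truncMap_eq_zero {n : ℕ} {f : R⟦X⟧} : truncMap R n f = 0 ↔ PowerSeries.X ^ n ∣ f := by
  change Ideal.Quotient.mk _ f = 0 ↔ _
  rw [Ideal.Quotient.eq_zero_iff_mem, Ideal.mem_span_singleton]

theorem truncMap_X_pow {m n : ℕ} (h : n ≤ m) : truncMap R n (PowerSeries.X ^ m) = 0 :=
  truncMap_eq_zero.2 (pow_dvd_pow _ h)

theorem psCoeff_apply (m : ℕ) (X : Dist H R⟦X⟧) (a : H) :
    (psCoeff m X).ofConv a = PowerSeries.coeff m (X.ofConv a) := rfl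

theorem lsCoeff_apply (m : ℤ) (X : Dist H R⸨X⸩) (a : H) :
    (lsCoeff m X).ofConv a = (X.ofConv a).coeff m := rfl

theorem isTangent_of_psCoeff {X : Dist H R⟦X⟧} (h : ∀ m, IsTangent (psCoeff m X)) :
    IsTangent X := by
  intro a b
  ext m
  have := h m a b
  simp only [psCoeff_apply] at this
  rw [this, map_add, PowerSeries.coeff_smul, PowerSeries.coeff_smul]

theorem IsTangent.psCoeff {X : Dist H R⟦X⟧} (h : IsTangent X) (m : ℕ) :
    IsTangent (psCoeff m X) := h.distLin _

theorem IsTangent.lsCoeff {X : Dist H R⸨X⸩} (h : IsTangent X) (m : ℤ) :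
    IsTangent (lsCoeff m X) := by
  intro a b
  rw [lsCoeff_apply, h a b, HahnSeries.coeff_add]
  rfl

theorem trunc_mem_scalarExt [Module.Finite ℂ (lieAlg H ℂ)] {V : Submodule ℂ (lieAlg H ℂ)} {n : ℕ}
    {X : Dist H R⟦X⟧} (hX : IsTangent X) (h : ∀ i < n, psCoeff i X ∈ scalarExt V R) :
    distMap (truncMap R n) X ∈ scalarExt V (Trunc R n) := by
  rw [mem_scalarExt_iff]
  refine ⟨hX.map _, fun f hf => ?_⟩
  rw [distMap_apply, truncMap_eq_zero, PowerSeries.X_pow_dvd_iff]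
  intro i hi
  exact (mem_scalarExt_iff.1 (h i hi)).2 f hf

theorem mem_scalarExt_of_psCoeff [Module.Finite ℂ (lieAlg H ℂ)] {V : Submodule ℂ (lieAlg H ℂ)}
    {X : Dist H R⟦X⟧} (h : ∀ i, psCoeff i X ∈ scalarExt V R) : X ∈ scalarExt V R⟦X⟧ := by
  rw [mem_scalarExt_iff]
  refine ⟨isTangent_of_psCoeff fun i => isTangent_of_mem_scalarExt (h i), fun f hf => ?_⟩
  ext i
  exact (mem_scalarExt_iff.1 (h i)).2 f hf

theorem IsExp.locSum_trunc {X : Dist H R⟦X⟧} {g : Points H R⟦X⟧} (h : IsExp X g) (n : ℕ) :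
    LocSum (divPow (distMap (truncMap R n) X)) (toDist (pointsMap (truncMap R n) g)) := by
  intro a
  choose N hN using h a
  refine ⟨(Finset.range n).sup N, fun M hM => ?_⟩
  simp only [← distMap_divPow, distMap_apply]
  rw [← map_sum, ← sub_eq_zero]
  change truncMap R n (g.ofConv a) - _ = 0
  rw [← map_sub, truncMap_eq_zero, PowerSeries.X_pow_dvd_iff]
  intro m hm
  rw [map_sub, hN m M ((Finset.le_sup (Finset.mem_range.2 hm)).trans hM), map_sum, sub_eq_zero]
  rfl

/-- Modulo `z^n` a generator is the exponential of an element of `𝔲` over the truncated ring. The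
subgroup of contracted points takes the place of the unipotent group `U` over that ring. -/
theorem RootChart.trunc_mem_contracted (C : RootChart 𝔥 𝔟 κ) [Module.Finite ℂ (lieAlg H ℂ)]
    [LieAlgebra.IsSolvable 𝔟] {n : ℕ} {g : Points H R⟦X⟧} (hg : g ∈ unipotentLoops R 𝔟 n) :
    pointsMap (truncMap R n) g ∈ contracted (C.rhoExt (Trunc R n)) := by
  have : unipotentLoops R 𝔟 n ≤
      (contracted (C.rhoExt (Trunc R n))).comap (pointsMap (truncMap R n)) := by
    refine (Subgroup.closure_le _).2 ?_
    rintro g ⟨X, hX, hu, he⟩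
    exact C.mem_contracted_of_locSum (trunc_mem_scalarExt hX hu) (he.locSum_trunc n)
  exact this hg

theorem toLaurent_injective : Function.Injective (toLaurent : R⟦X⟧ →ₐ[ℂ] R⸨X⸩) :=
  HahnSeries.ofPowerSeries_injective

theorem distMap_injective {S : Type*} {S' : Type*} [CommRing S] [Algebra ℂ S] [CommRing S']
    [Algebra ℂ S'] {φ : S →ₐ[ℂ] S'} (h : Function.Injective φ) :
    Function.Injective (distMap φ : Dist H S → Dist H S') := by
  intro X Y hXY
  exact dist_ext fun a => h (congrArg (fun Z : Dist H S' => Z.ofConv a) hXY)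

/-- The Laurent series of the distribution `A` with pole of order at most `n` is `z^(-n)` times the
power series `B`. -/
def IsShift (n : ℕ) (B : Dist H R⟦X⟧) (A : Dist H R⸨X⸩) : Prop :=
  distMap toLaurent B = (HahnSeries.single (n : ℤ) (1 : R) : R⸨X⸩) • A

theorem isShift_iff {n : ℕ} {B : Dist H R⟦X⟧} {A : Dist H R⸨X⸩} :
    IsShift n B A ↔ (∀ k < -(n : ℤ), lsCoeff k A = 0) ∧
      ∀ i : ℕ, psCoeff i B = lsCoeff (i - n) A := by
  have hc : ∀ a (k : ℤ), (((HahnSeries.single (n : ℤ) (1 : R) : R⸨X⸩) • A).ofConv a).coeff k =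
      (A.ofConv a).coeff (k - n) := by
    intro a k
    rw [smul_ofConv, HahnSeries.coeff_single_mul, one_mul]
  constructor
  · intro h
    have h' : ∀ a (k : ℤ), (HahnSeries.ofPowerSeries ℤ R (B.ofConv a)).coeff k =
        (A.ofConv a).coeff (k - n) := by
      intro a k
      rw [← hc, ← h]
      rfl
    refine ⟨fun k hk => dist_ext fun a => ?_, fun i => dist_ext fun a => ?_⟩
    · have := h' a (k + n)
      rw [PowerSeries.coeff_coe, if_pos (by omega), add_sub_cancel_right] at this
      exact this.symm
    · rw [psCoeff_apply, lsCoeff_apply, ← h', PowerSeries.coeff_coe, if_neg (by omega)]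
      rfl
  · rintro ⟨h1, h2⟩
    refine dist_ext fun a => ?_
    ext k
    rw [hc]
    change (HahnSeries.ofPowerSeries ℤ R (B.ofConv a)).coeff k = _
    rw [PowerSeries.coeff_coe]
    split_ifs with hk
    · exact (congrArg (fun Z : Dist H R => Z.ofConv a) (h1 (k - n) (by omega))).symm
    · have := congrArg (fun Z : Dist H R => Z.ofConv a) (h2 k.natAbs)
      rw [psCoeff_apply, lsCoeff_apply] at this
      rw [this]
      congr 1
      omega

theorem exists_isShift {n : ℕ} {A : Dist H R⸨X⸩} (h : ∀ k < -(n : ℤ), lsCoeff k A = 0) :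
    ∃ B, IsShift n B A := by
  let f : H →ₗ[ℂ] R⟦X⟧ :=
    { toFun := fun a => PowerSeries.mk fun i => (A.ofConv a).coeff (i - n)
      map_add' := fun a b => by
        ext i
        simp
      map_smul' := fun c a => by
        ext i
        rw [PowerSeries.coeff_mk, map_smul, RingHom.id_apply, PowerSeries.coeff_smul,
          PowerSeries.coeff_mk, HahnSeries.coeff_smul] }
  refine ⟨toConv f, isShift_iff.2 ⟨h, fun i => dist_ext fun a => ?_⟩⟩
  rw [psCoeff_apply]
  exact PowerSeries.coeff_mk i fun i : ℕ => (A.ofConv a).coeff ((i : ℤ) - n)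

theorem exists_isShift_left (n : ℕ) (B : Dist H R⟦X⟧) : ∃ A, IsShift n B A := by
  refine ⟨(HahnSeries.single (-(n : ℤ)) (1 : R) : R⸨X⸩) • distMap toLaurent B, ?_⟩
  rw [IsShift, smul_smul, HahnSeries.single_mul_single, add_neg_cancel, mul_one]
  exact (one_smul _ _).symm

theorem IsShift.unique_right {n : ℕ} {B : Dist H R⟦X⟧} {A A' : Dist H R⸨X⸩} (h : IsShift n B A)
    (h' : IsShift n B A') : A = A' := by
  have h2 := congrArg (fun Z => (HahnSeries.single (-(n : ℤ)) (1 : R) : R⸨X⸩) • Z)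
    (h.symm.trans h')
  simpa [smul_smul] using h2

theorem toLaurent_X_pow (n : ℕ) :
    toLaurent ((PowerSeries.X : R⟦X⟧) ^ n) = HahnSeries.single (n : ℤ) (1 : R) :=
  HahnSeries.ofPowerSeries_X_pow n

/-- The gauge action on connections with a pole of order at most `n`. -/
theorem gauge_isShift_iff {n : ℕ} {g : Points H R⟦X⟧} {B B' : Dist H R⟦X⟧} {A A' : Dist H R⸨X⸩}
    (h : IsShift n B A) (h' : IsShift n B' A') :
    gauge g A = A' ↔
      toDist g * B - (PowerSeries.X : R⟦X⟧) ^ n • ddz (toDist g) = B' * toDist g := by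
  have e1 : distMap toLaurent (toDist g * B * toDist g⁻¹ -
      (PowerSeries.X : R⟦X⟧) ^ n • (ddz (toDist g) * toDist g⁻¹)) =
      (HahnSeries.single (n : ℤ) (1 : R) : R⸨X⸩) • gauge g A := by
    rw [gauge, map_sub, map_mul, map_mul, h, distMap_smul, toLaurent_X_pow, smul_sub,
      mul_smul_comm, smul_mul_assoc]
  have e2 : gauge g A = A' ↔ toDist g * B * toDist g⁻¹ -
      (PowerSeries.X : R⟦X⟧) ^ n • (ddz (toDist g) * toDist g⁻¹) = B' := by
    constructor
    · intro hg
      exact distMap_injective toLaurent_injective (by rw [e1, hg, ← h'])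
    · intro hg
      have : IsShift n B' (gauge g A) := by rw [IsShift, ← e1, hg]
      exact this.unique_right h'
  rw [e2]
  constructor
  · rintro rfl
    rw [sub_mul, smul_mul_assoc, mul_assoc, mul_assoc (ddz _), toDist_inv_mul, mul_one, mul_one]
  · intro hg
    have := congrArg (· * toDist g⁻¹) hg
    simp only [sub_mul, smul_mul_assoc, mul_assoc, toDist_mul_inv, mul_one] at this
    rw [mul_assoc, this]

end Truncation

/-! ### Uniqueness of the normal form -/

section Uniqueness

open scoped PowerSeries LaurentSeries

variable {H : Type u} [CommRing H] [HopfAlgebra ℂ H]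
variable {R : Type v} [CommRing R] [Algebra ℂ R]
variable {𝔥 𝔟 : LieSubalgebra ℂ (lieAlg H ℂ)} {κ : Type*} [Fintype κ]

theorem X_pow_smul_apply (n : ℕ) (D : Dist H R⟦X⟧) (a : H) :
    ((PowerSeries.X : R⟦X⟧) ^ n • D).ofConv a = PowerSeries.X ^ n * D.ofConv a := rfl

theorem X_pow_mul_cancel {R : Type*} [CommRing R] {n : ℕ} {f g : R⟦X⟧}
    (h : (PowerSeries.X : R⟦X⟧) ^ n * f = PowerSeries.X ^ n * g) : f = g := by
  ext i
  have := congrArg (PowerSeries.coeff (i + n)) h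
  rwa [PowerSeries.coeff_X_pow_mul, PowerSeries.coeff_X_pow_mul] at this

theorem X_pow_smul_cancel {n : ℕ} {D E : Dist H R⟦X⟧}
    (h : (PowerSeries.X : R⟦X⟧) ^ n • D = (PowerSeries.X : R⟦X⟧) ^ n • E) : D = E :=
  dist_ext fun a => X_pow_mul_cancel (congrArg (fun Z : Dist H R⟦X⟧ => Z.ofConv a) h)

theorem exists_eq_X_pow_smul {n : ℕ} {D : Dist H R⟦X⟧} (h : distMap (truncMap R n) D = 0) :
    ∃ E, D = (PowerSeries.X : R⟦X⟧) ^ n • E := by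
  let f : H →ₗ[ℂ] R⟦X⟧ :=
    { toFun := fun a => PowerSeries.mk fun i => PowerSeries.coeff (i + n) (D.ofConv a)
      map_add' := fun a b => by
        ext i
        simp
      map_smul' := fun c a => by
        ext i
        rw [PowerSeries.coeff_mk, map_smul, RingHom.id_apply, PowerSeries.coeff_smul,
          PowerSeries.coeff_smul, PowerSeries.coeff_mk] }
  refine ⟨toConv f, dist_ext fun a => ?_⟩
  have h0 : truncMap R n (D.ofConv a) = 0 := congrArg (fun Z : Dist H (Trunc R n) => Z.ofConv a) h
  obtain ⟨q, hq⟩ := truncMap_eq_zero.1 h0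
  rw [X_pow_smul_apply, hq]
  congr 1
  ext i
  change _ = PowerSeries.coeff i (PowerSeries.mk fun i => PowerSeries.coeff (i + n) (D.ofConv a))
  rw [PowerSeries.coeff_mk, hq, PowerSeries.coeff_X_pow_mul]

theorem psCoeff_X_pow_smul (n i : ℕ) (D : Dist H R⟦X⟧) :
    psCoeff (i + n) ((PowerSeries.X : R⟦X⟧) ^ n • D) = psCoeff i D :=
  dist_ext fun a => by
    rw [psCoeff_apply, X_pow_smul_apply, PowerSeries.coeff_X_pow_mul, psCoeff_apply]

theorem distMap_X_pow_smul {m n : ℕ} (h : n ≤ m) (D : Dist H R⟦X⟧) :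
    distMap (truncMap R n) ((PowerSeries.X : R⟦X⟧) ^ m • D) = 0 := by
  rw [distMap_smul, truncMap_X_pow h]
  exact zero_smul (Trunc R n) (distMap (truncMap R n) D)

theorem ddz_X_pow_smul {n : ℕ} (hn : 1 ≤ n) (D : Dist H R⟦X⟧) :
    ddz ((PowerSeries.X : R⟦X⟧) ^ n • D) = (PowerSeries.X : R⟦X⟧) ^ (n - 1) •
      ((n : R⟦X⟧) • D + (PowerSeries.X : R⟦X⟧) • ddz D) := by
  obtain ⟨n, rfl⟩ : ∃ m, n = m + 1 := ⟨n - 1, by omega⟩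
  refine dist_ext fun a => ?_
  change PowerSeries.derivative R (PowerSeries.X ^ (n + 1) * D.ofConv a) =
    PowerSeries.X ^ n * (((n + 1 : ℕ) : R⟦X⟧) * D.ofConv a +
      PowerSeries.X * PowerSeries.derivative R (D.ofConv a))
  rw [Derivation.leibniz, Derivation.leibniz_pow, PowerSeries.derivative_X]
  simp only [smul_eq_mul, Nat.add_sub_cancel, mul_one, nsmul_eq_mul]
  ring

theorem ddz_add (X Y : Dist H R⟦X⟧) : ddz (X + Y) = ddz X + ddz Y :=
  map_add (distLin ((PowerSeries.derivative R).toLinearMap.restrictScalars ℂ)) X Y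

/-- A connection with Cartan coefficients below order `n - 1` is determined by its gauge class. -/
theorem RootChart.eq_of_gauge (C : RootChart 𝔥 𝔟 κ) [Module.Finite ℂ (lieAlg H ℂ)]
    [LieAlgebra.IsSolvable 𝔟] {n : ℕ} (hn : 1 ≤ n) {B B' : Dist H R⟦X⟧}
    (hB : ∀ i, psCoeff i B ∈ scalarExt 𝔥.toSubmodule R)
    (hB' : ∀ i, psCoeff i B' ∈ scalarExt 𝔥.toSubmodule R)
    (hz : ∀ i, 2 * n - 1 ≤ i → psCoeff i B = 0) (hz' : ∀ i, 2 * n - 1 ≤ i → psCoeff i B' = 0)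
    (hu : ∀ k, IsUnit ((psCoeff 0 B).ofConv (C.rootFun k)))
    {g : Points H R⟦X⟧} (hg : g ∈ unipotentLoops R 𝔟 n)
    (he : toDist g * B - (PowerSeries.X : R⟦X⟧) ^ n • ddz (toDist g) = B' * toDist g) :
    B = B' := by
  have mB := mem_scalarExt_of_psCoeff hB
  have mB' := mem_scalarExt_of_psCoeff hB'
  -- Modulo `z^n` the derivative term drops out and only conjugation remains.
  have h1 : toDist (pointsMap (truncMap R n) g) * distMap (truncMap R n) B =
      distMap (truncMap R n) B' * toDist (pointsMap (truncMap R n) g) := by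
    have := congrArg (distMap (truncMap R n)) he
    rwa [map_sub, map_mul, map_mul, distMap_X_pow_smul le_rfl, sub_zero] at this
  have hcon := C.trunc_mem_contracted hg
  have hBB := C.eq_of_contracted_conj (distMap_mem_scalarExt (truncMap R n) _ mB)
    (distMap_mem_scalarExt (truncMap R n) _ mB') hcon h1
  rw [← hBB] at h1
  have hg1 := C.eq_one_of_contracted_comm (distMap_mem_scalarExt (truncMap R n) _ mB)
    (fun k => ((PowerSeries.isUnit_iff_constantCoeff.2 (by
      rw [← PowerSeries.coeff_zero_eq_constantCoeff_apply]; exact hu k)).map (truncMap R n)))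
    hcon h1
  obtain ⟨E, hE⟩ := exists_eq_X_pow_smul (n := n) (D := toDist g - 1) (by
    rw [map_sub, ← toDist_pointsMap, hg1, toDist_one, map_one, sub_self])
  obtain ⟨D, hD⟩ := exists_eq_X_pow_smul (n := n) (D := B' - B) (by
    rw [map_sub, hBB, sub_self])
  rw [sub_eq_iff_eq_add] at hE
  have hB'e : B' = B + (PowerSeries.X : R⟦X⟧) ^ n • D := by rw [← hD]; abel
  -- The gauge relation divided by `z^n`; differentiating `z^n E` costs one order, hence the
  -- exponent `n - 1`.
  have hDe : D = E * B - B' * E - (PowerSeries.X : R⟦X⟧) ^ (n - 1) •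
      ((n : R⟦X⟧) • E + (PowerSeries.X : R⟦X⟧) • ddz E) := by
    refine X_pow_smul_cancel (n := n) ?_
    rw [← hD]
    rw [hE, ddz_add, ddz_one, ddz_X_pow_smul hn, add_zero, add_mul, mul_add, one_mul, mul_one,
      smul_mul_assoc, mul_smul_comm] at he
    rw [smul_sub, smul_sub]
    generalize (PowerSeries.X : R⟦X⟧) ^ n • (E * B) = p at he ⊢
    generalize (PowerSeries.X : R⟦X⟧) ^ n • (B' * E) = q at he ⊢
    generalize (PowerSeries.X : R⟦X⟧) ^ n • (PowerSeries.X : R⟦X⟧) ^ (n - 1) •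
      ((n : R⟦X⟧) • E + (PowerSeries.X : R⟦X⟧) • ddz E) = r at he ⊢
    rw [sub_eq_iff_eq_add] at he
    calc B' - B = (q + B' + r) - q - r - B := by abel
      _ = p - q - r := by rw [← he]; abel
  have hDc : ∀ i, psCoeff i D ∈ scalarExt 𝔥.toSubmodule R := by
    intro i
    rw [← psCoeff_X_pow_smul n, ← hD]
    exact sub_mem (hB' _) (hB _)
  -- Multiplicativity of `g = 1 + z^n E` is the Leibniz rule for `E` up to the error `z^n E(a)
  -- E(b)`.
  have hEt : IsTangent (distMap (truncMap R (n - 1)) E) := by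
    intro a b
    have hga : ∀ a, g.ofConv a = (PowerSeries.X : R⟦X⟧) ^ n * E.ofConv a +
        algebraMap ℂ _ (Coalgebra.counit a) := fun a =>
      congrArg (fun Z : Dist H R⟦X⟧ => Z.ofConv a) hE
    have h2 : E.ofConv (a * b) = algebraMap ℂ _ (Coalgebra.counit (R := ℂ) a) * E.ofConv b +
        algebraMap ℂ _ (Coalgebra.counit (R := ℂ) b) * E.ofConv a +
        (PowerSeries.X : R⟦X⟧) ^ n * (E.ofConv a * E.ofConv b) := by
      refine X_pow_mul_cancel (n := n) ?_
      have := hga (a * b)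
      rw [map_mul g.ofConv, hga a, hga b, Bialgebra.counit_mul, map_mul (algebraMap ℂ R⟦X⟧)] at this
      linear_combination -this
    rw [distMap_apply, h2, map_add, map_add, map_mul _ ((PowerSeries.X : R⟦X⟧) ^ n),
      truncMap_X_pow (by omega), zero_mul, add_zero, map_mul, map_mul, AlgHom.commutes,
      AlgHom.commutes, ← Algebra.smul_def, ← Algebra.smul_def]
    rfl
  have hlie : ⁅distMap (truncMap R (n - 1)) B, distMap (truncMap R (n - 1)) E⁆ =
      - distMap (truncMap R (n - 1)) D := by
    have := congrArg (distMap (truncMap R (n - 1))) hDe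
    rw [map_sub, distMap_X_pow_smul le_rfl, sub_zero, map_sub, map_mul, map_mul, hB'e, map_add,
      distMap_X_pow_smul (by omega), add_zero] at this
    rw [this, Dist.lie_def]
    abel
  -- Here `D` is Cartan and also a bracket with the Cartan element `B`, so it vanishes. This raises
  -- the agreement of `B` and `B'` from order `n` to order `n + (n - 1)`.
  have hDm : distMap (truncMap R (n - 1)) D = 0 := by
    have := C.lie_eq_zero_of_mem_cartan (distMap_mem_scalarExt (truncMap R (n - 1)) _ mB) hEt
      (by rw [hlie]; exact neg_mem (distMap_mem_scalarExt _ _ (mem_scalarExt_of_psCoeff hDc)))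
    rwa [hlie, neg_eq_zero] at this
  obtain ⟨F, rfl⟩ := exists_eq_X_pow_smul hDm
  rw [smul_smul, ← pow_add] at hD
  refine dist_ext fun a => ?_
  ext i
  by_cases hi : i < 2 * n - 1
  · have h3 := congrArg (fun Z : Dist H R⟦X⟧ => PowerSeries.coeff i (Z.ofConv a)) hD
    simp only [X_pow_smul_apply] at h3
    rw [PowerSeries.X_pow_dvd_iff.1 (dvd_mul_right _ _) i (by omega), ofConv_sub,
      LinearMap.sub_apply, map_sub, sub_eq_zero] at h3
    exact h3.symm
  · exact congrArg (fun Z : Dist H R => Z.ofConv a)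
      ((hz i (by omega)).trans (hz' i (by omega)).symm)

end Uniqueness

/-! ### Conjugation into the Cartan subalgebra -/

section Polar

variable {H : Type u} [CommRing H] [HopfAlgebra ℂ H]
variable {S : Type v} [CommRing S] [Algebra ℂ S]
variable {𝔥 𝔟 : LieSubalgebra ℂ (lieAlg H ℂ)} {κ : Type*} [Fintype κ]

/-- The polynomial loop `exp (s u)` with its derivative. -/
theorem exists_polyExp_deriv {u : Dist H S} (hu : IsTangent u)
    (hN : ∀ a, ∃ N : ℕ, ∀ k ≥ N, (u ^ k).ofConv a = 0) :
    ∃ g : Points H (Polynomial S), LocSum (divPow u) (toDist (pointsMap (evalAt 1) g)) ∧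
      pointsMap (evalAt 0) g = 1 ∧
      distLin ((Polynomial.derivative' (R := S)).restrictScalars ℂ).toLinearMap (toDist g) =
        distMap (constPoly S) u * toDist g := by
  obtain ⟨g, hg⟩ := exists_polyExp hu hN
  have hco : ∀ j, distLin ((Polynomial.lcoeff S j).restrictScalars ℂ) (toDist g) = divPow u j :=
    fun j => dist_ext fun a => hg a j
  refine ⟨g, ?_, ?_, ?_⟩
  · intro a
    refine ⟨(g.ofConv a).natDegree + 1, fun M hM => ?_⟩
    change evalAt 1 (g.ofConv a) = _
    rw [evalAt_apply, Polynomial.eval_eq_sum_range' (show (g.ofConv a).natDegree < M by omega)]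
    simp [hg]
  · refine toDist_injective (dist_ext fun a => ?_)
    change evalAt 0 (g.ofConv a) = _
    rw [evalAt_apply, ← Polynomial.coeff_zero_eq_eval_zero, hg, divPow_zero]
    rfl
  · refine dist_ext fun a => ?_
    ext j
    have h1 : ((distMap (constPoly S) u * toDist g).ofConv a).coeff j =
        (u * divPow u j).ofConv a := by
      rw [← hco, ← distLin_distMap_mul (constPoly S) ((Polynomial.lcoeff S j).restrictScalars ℂ)
        (fun s x => Polynomial.coeff_C_mul x)]
      rfl
    rw [h1, ← divPow_succ]
    change (Polynomial.derivative (g.ofConv a)).coeff j = _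
    rw [Polynomial.coeff_derivative, hg, ofConv_smul, LinearMap.smul_apply, Algebra.smul_def]
    push_cast
    ring

/-- The adjoint action of `exp u` in terms of iterated commutators. -/
theorem exists_conj_expansion {u : Dist H S} (hu : IsTangent u)
    (hN : ∀ a, ∃ N : ℕ, ∀ k ≥ N, (u ^ k).ofConv a = 0) (b : Dist H S) :
    ∃ (g : Points H S) (c : ℕ → Dist H S), LocSum (divPow u) (toDist g) ∧ c 0 = b ∧
      (∀ k : ℕ, ((k : ℂ) + 1) • c (k + 1) = ⁅u, c k⁆) ∧
      LocSum c (toDist g * b * toDist g⁻¹) := by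
  obtain ⟨g, h1, h0, hd⟩ := exists_polyExp_deriv hu hN
  set D := (Polynomial.derivative' (R := S)).restrictScalars ℂ with hD
  let co : ℕ → Polynomial S →ₗ[ℂ] S := fun j => (Polynomial.lcoeff S j).restrictScalars ℂ
  have hco : ∀ (j : ℕ) s x, co j (constPoly S s * x) = s * co j x :=
    fun j s x => Polynomial.coeff_C_mul x
  -- The family `exp(su) b exp(-su)` satisfies `B' = [u, B]`. Its Taylor coefficients in `s` obey
  -- the stated recursion, and their sum is the value at `s = 1`.
  let B : Dist H (Polynomial S) := toDist g * distMap (constPoly S) b * toDist g⁻¹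
  have hDc : ∀ x : Dist H S, distLin D.toLinearMap (distMap (constPoly S) x) = 0 := fun x =>
    dist_ext fun a => Polynomial.derivative_C
  have hinv : distLin D.toLinearMap (toDist g⁻¹) = - (toDist g⁻¹ * distMap (constPoly S) u) := by
    have h2 : distLin D.toLinearMap (toDist g⁻¹ * toDist g) = 0 := by
      rw [toDist_inv_mul, ← map_one (distMap (constPoly S)), hDc]
    rw [distLin_derivation_mul, hd] at h2
    have h3 := congrArg (· * toDist g⁻¹) h2
    simp only [add_mul, mul_assoc, toDist_mul_inv, mul_one, zero_mul] at h3
    exact eq_neg_of_add_eq_zero_left h3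
  have hB : distLin D.toLinearMap B = ⁅distMap (constPoly S) u, B⁆ := by
    rw [distLin_derivation_mul, distLin_derivation_mul, hDc, hinv, hd, Dist.lie_def]
    simp only [B, mul_zero, add_zero, mul_neg, mul_assoc]
    rw [sub_eq_add_neg]
  refine ⟨pointsMap (evalAt 1) g, fun j => distLin (co j) B, h1, ?_, ?_, ?_⟩
  · have : distMap (evalAt 0) B = b := by
      simp only [B, map_mul, evalAt_const, ← toDist_pointsMap, map_inv, h0, inv_one, toDist_one,
        one_mul, mul_one]
    rw [← this]
    refine dist_ext fun a => ?_
    rw [distMap_apply, evalAt_apply, ← Polynomial.coeff_zero_eq_eval_zero]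
    rfl
  · intro k
    have h2 := congrArg (distLin (co k)) hB
    rw [Dist.lie_def, map_sub, distLin_distMap_mul _ _ (hco k),
      distLin_mul_distMap _ _ (hco k), ← Dist.lie_def] at h2
    rw [← h2]
    refine dist_ext fun a => ?_
    change _ = (Polynomial.derivative (B.ofConv a)).coeff k
    rw [Polynomial.coeff_derivative, ofConv_smul, LinearMap.smul_apply, Algebra.smul_def, mul_comm]
    simp only [map_add, map_natCast, map_one]
    rfl
  · intro a
    refine ⟨(B.ofConv a).natDegree + 1, fun M hM => ?_⟩
    have : toDist (pointsMap (evalAt 1) g) * b * toDist (pointsMap (evalAt 1) g)⁻¹ =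
        distMap (evalAt 1) B := by
      simp only [B, map_mul, evalAt_const, ← toDist_pointsMap, map_inv]
    rw [this, distMap_apply, evalAt_apply,
      Polynomial.eval_eq_sum_range' (show (B.ofConv a).natDegree < M by omega)]
    exact Finset.sum_congr rfl fun i _ => by rw [one_pow, mul_one]; rfl

namespace RootChart

variable (C : RootChart 𝔥 𝔟 κ)

/-- The solution of `[h, u] = e` for `h` regular. -/
theorem exists_lie_eq {h : Dist H S} (hh : h ∈ scalarExt 𝔥.toSubmodule S)
    (hu : ∀ k, IsUnit (h.ofConv (C.rootFun k))) (c : κ → S) :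
    ∃ d : κ → S, (∀ k, c k = 0 → d k = 0) ∧
      ⁅h, ∑ k, d k • C.vecExt S k⁆ = ∑ k, c k • C.vecExt S k := by
  refine ⟨fun k => c k * ↑(hu k).unit⁻¹, fun k hk => by simp only [hk, zero_mul], ?_⟩
  rw [lie_sum]
  refine Finset.sum_congr rfl fun k _ => ?_
  rw [lie_smul, C.lie_vecExt hh, smul_smul, mul_assoc]
  congr 1
  rw [IsUnit.val_inv_mul, mul_one]

theorem lie_filt_mem {i j : ℤ} {X Y : Dist H S} (hX : X ∈ scalarExt (C.filt i) S)
    (hY : Y ∈ scalarExt (C.filt j) S) : ⁅X, Y⁆ ∈ scalarExt (C.filt (i + j)) S :=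
  lie_mem_scalarExt (fun _ hx _ hy => C.lie_filt hx hy) hX hY

theorem filt_mono_ext {i j : ℤ} (h : i ≤ j) {X : Dist H S} (hX : X ∈ scalarExt (C.filt j) S) :
    X ∈ scalarExt (C.filt i) S := scalarExt_mono (C.filt_anti h) hX

/-- Choose `u` with `[h, u] = e`, in the same filtration step as `e`. In the expansion of `Ad(exp
u)(h + e)` the term `[u, h] = -e` cancels `e`, and all other corrections involve at least two
elements of `filt j`, so they lie in `filt (2j) ≤ filt (j + 1)`. -/
theorem exists_conj_step [Module.Finite ℂ (lieAlg H ℂ)] [LieAlgebra.IsSolvable 𝔟]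
    {h : Dist H S} (hh : h ∈ scalarExt 𝔥.toSubmodule S)
    (hu : ∀ k, IsUnit (h.ofConv (C.rootFun k))) {j : ℤ} (hj : 1 ≤ j) {e : Dist H S}
    (he : e ∈ scalarExt (C.filt j) S) :
    ∃ (u : Dist H S) (g : Points H S), u ∈ scalarExt (nilPart 𝔟) S ∧
      LocSum (divPow u) (toDist g) ∧
      toDist g * (h + e) * toDist g⁻¹ - h ∈ scalarExt (C.filt (j + 1)) S := by
  obtain ⟨he1, he0⟩ := C.eq_sum_of_mem_filt he
  obtain ⟨d, hd0, hd⟩ := C.exists_lie_eq hh hu fun k => e.ofConv (C.crdFun k)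
  rw [← he1] at hd
  set u := ∑ k, d k • C.vecExt S k with hu_def
  have huj : u ∈ scalarExt (C.filt j) S := C.sum_mem_filt _ fun k hk => hd0 k (he0 k hk)
  have hun : u ∈ scalarExt (nilPart 𝔟) S := by
    rw [C.nilPart_eq]; exact C.filt_mono_ext hj huj
  obtain ⟨g, c, hg, hc0, hc, hs⟩ := exists_conj_expansion (isTangent_of_mem_scalarExt hun)
    (exists_pow_apply_eq_zero hun) (h + e)
  refine ⟨u, g, hun, hg, ?_⟩
  have hscal : ∀ (k : ℕ) (V : Submodule ℂ (lieAlg H ℂ)) (X : Dist H S),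
      ((k : ℂ) + 1) • X ∈ scalarExt V S → X ∈ scalarExt V S := by
    intro k V X hX
    have h1 := Submodule.smul_mem _ (algebraMap ℂ S ((k : ℂ) + 1)⁻¹) hX
    have h2 : algebraMap ℂ S ((k : ℂ) + 1)⁻¹ • ((k : ℂ) + 1) • X = X := by
      refine dist_ext fun a => ?_
      rw [smul_ofConv, ofConv_smul, LinearMap.smul_apply, ← Algebra.smul_def, smul_smul,
        inv_mul_cancel₀ (Nat.cast_add_one_ne_zero k), one_smul]
    rwa [h2] at h1
  have hlie : ⁅u, h⁆ = -e := by rw [← lie_skew, hd]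
  have hc1 : c 1 + e ∈ scalarExt (C.filt (j + 1)) S := by
    have h1 := hc 0
    rw [hc0, lie_add, hlie, Nat.cast_zero, zero_add, one_smul, zero_add] at h1
    rw [h1, neg_add_cancel_comm]
    exact C.filt_mono_ext (by omega) (C.lie_filt_mem huj he)
  have hc1' : c 1 ∈ scalarExt (C.filt j) S := by
    have := sub_mem (C.filt_mono_ext (by omega : j ≤ j + 1) hc1) he
    rwa [add_sub_cancel_right] at this
  have hc2 : ∀ k : ℕ, c (k + 2) ∈ scalarExt (C.filt (j + 1)) S := by
    intro k
    induction k with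
    | zero =>
      refine hscal 1 _ _ ?_
      rw [hc 1]
      exact C.filt_mono_ext (by omega) (C.lie_filt_mem huj hc1')
    | succ k ih =>
      refine hscal (k + 2) _ _ ?_
      rw [hc (k + 2)]
      exact C.filt_mono_ext (by omega) (C.lie_filt_mem huj ih)
  have htan : IsTangent (h + e) := (lieAlg H S).add_mem (isTangent_of_mem_scalarExt hh)
    (isTangent_of_mem_scalarExt he)
  rw [mem_scalarExt_iff]
  -- Membership is tested at one function at a time, where the locally finite expansion is a finite
  -- sum.
  refine ⟨(lieAlg H S).sub_mem (htan.conj g) (isTangent_of_mem_scalarExt hh), fun f hf => ?_⟩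
  have hk : ∀ X ∈ scalarExt (C.filt (j + 1)) S, X.ofConv f = 0 := fun X hX =>
    (mem_scalarExt_iff.1 hX).2 f hf
  obtain ⟨N, hN⟩ := hs f
  rw [ofConv_sub, LinearMap.sub_apply, hN (N + 2) (by omega), Finset.sum_range_succ',
    Finset.sum_range_succ', Finset.sum_eq_zero fun i _ => hk _ (hc2 i), zero_add, hc0]
  have h3 := hk _ hc1
  rw [ofConv_add, LinearMap.add_apply] at h3
  rw [ofConv_add, LinearMap.add_apply, zero_add]
  linear_combination h3

/-- An element of `𝔟 ⊗ S` with regular Cartan part `h` is conjugate to `h`. -/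
theorem exists_conj_cartan [Module.Finite ℂ (lieAlg H ℂ)] [LieAlgebra.IsSolvable 𝔟]
    {h : Dist H S} (hh : h ∈ scalarExt 𝔥.toSubmodule S)
    (hu : ∀ k, IsUnit (h.ofConv (C.rootFun k))) {e : Dist H S}
    (he : e ∈ scalarExt (C.filt 1) S) :
    ∃ g ∈ Subgroup.closure {g : Points H S | ∃ u ∈ scalarExt (nilPart 𝔟) S,
      LocSum (divPow u) (toDist g)}, toDist g * (h + e) = h * toDist g := by
  have key : ∀ j : ℕ, ∃ g ∈ Subgroup.closure {g : Points H S | ∃ u ∈ scalarExt (nilPart 𝔟) S,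
      LocSum (divPow u) (toDist g)},
      toDist g * (h + e) * toDist g⁻¹ - h ∈ scalarExt (C.filt ((j : ℤ) + 1)) S := by
    intro j
    induction j with
    | zero =>
      refine ⟨1, one_mem _, ?_⟩
      simpa [toDist_one] using he
    | succ j ih =>
      obtain ⟨g, hg, hm⟩ := ih
      obtain ⟨u, g', hun, hg', hm'⟩ := C.exists_conj_step hh hu (by omega) hm
      refine ⟨g' * g, mul_mem (Subgroup.subset_closure ⟨u, hun, hg'⟩) hg, ?_⟩
      rw [add_sub_cancel] at hm'
      rw [mul_inv_rev, toDist_mul, toDist_mul]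
      push_cast
      simpa only [mul_assoc] using hm'
  -- Finitely many steps suffice because only finitely many weights occur.
  obtain ⟨N, hN⟩ := C.filt_eq_bot
  obtain ⟨g, hg, hm⟩ := key N
  refine ⟨g, hg, ?_⟩
  have hz : toDist g * (h + e) * toDist g⁻¹ - h = 0 := by
    refine dist_ext fun a => (mem_scalarExt_iff.1 hm).2 a fun v hv => ?_
    have := C.filt_anti (show (N : ℤ) ≤ N + 1 by omega) hv
    rw [hN, Submodule.mem_bot] at this
    rw [this]
    rfl
  have := congrArg (· * toDist g) (sub_eq_zero.1 hz)
  simpa only [mul_assoc, toDist_inv_mul, mul_one] using this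

end RootChart

end Polar

/-! ### The gauge action to first order in `z^m` -/

section Gauge

open scoped PowerSeries LaurentSeries

variable {H : Type u} [CommRing H] [HopfAlgebra ℂ H]
variable {R : Type v} [CommRing R] [Algebra ℂ R]
variable {𝔥 𝔟 : LieSubalgebra ℂ (lieAlg H ℂ)} {κ : Type*} [Fintype κ]

/-- The gauge action on `z^n` times a connection. -/
def shiftGauge (n : ℕ) (g : Points H R⟦X⟧) (B : Dist H R⟦X⟧) : Dist H R⟦X⟧ :=
  toDist g * B * toDist g⁻¹ - (PowerSeries.X : R⟦X⟧) ^ n • (ddz (toDist g) * toDist g⁻¹)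

theorem shiftGauge_eq_iff {n : ℕ} {g : Points H R⟦X⟧} {B B' : Dist H R⟦X⟧} :
    shiftGauge n g B = B' ↔
      toDist g * B - (PowerSeries.X : R⟦X⟧) ^ n • ddz (toDist g) = B' * toDist g := by
  constructor
  · rintro rfl
    rw [shiftGauge, sub_mul, smul_mul_assoc, mul_assoc, mul_assoc (ddz _), toDist_inv_mul, mul_one,
      mul_one]
  · intro hg
    have := congrArg (· * toDist g⁻¹) hg
    simp only [sub_mul, smul_mul_assoc, mul_assoc, toDist_mul_inv, mul_one] at this
    rw [shiftGauge, mul_assoc, this]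

theorem shiftGauge_mul (n : ℕ) (g h : Points H R⟦X⟧) (B : Dist H R⟦X⟧) :
    shiftGauge n (g * h) B = shiftGauge n g (shiftGauge n h B) := by
  rw [shiftGauge_eq_iff]
  have h1 := shiftGauge_eq_iff.1 (rfl : shiftGauge n h B = _)
  have h2 := shiftGauge_eq_iff.1 (rfl : shiftGauge n g (shiftGauge n h B) = _)
  rw [toDist_mul, ← mul_assoc (shiftGauge _ _ _), ← h2, sub_mul, mul_assoc _ (shiftGauge _ _ _),
    ← h1, ddz_mul, mul_sub, smul_add, smul_mul_assoc, mul_smul_comm, mul_assoc]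
  abel

theorem IsTangent.shiftGauge {n : ℕ} (g : Points H R⟦X⟧) {B : Dist H R⟦X⟧} (hB : IsTangent B) :
    IsTangent (shiftGauge n g B) := by
  have h1 : IsTangent (ddz (toDist g) * toDist g⁻¹) :=
    isTangent_derivation_mul_inv ((PowerSeries.derivative R).restrictScalars ℂ) g
  exact (lieAlg H R⟦X⟧).sub_mem (hB.conj g) ((lieAlg H R⟦X⟧).smul_mem _ h1)

theorem trunc_eq_iff {m : ℕ} {X Y : Dist H R⟦X⟧} :
    distMap (truncMap R m) X = distMap (truncMap R m) Y ↔
      ∀ i < m, psCoeff i X = psCoeff i Y := by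
  rw [← sub_eq_zero, ← map_sub]
  constructor
  · intro h i hi
    refine dist_ext fun a => ?_
    have h1 : truncMap R m ((X - Y).ofConv a) = 0 :=
      congrArg (fun Z : Dist H (Trunc R m) => Z.ofConv a) h
    have h2 := PowerSeries.X_pow_dvd_iff.1 (truncMap_eq_zero.1 h1) i hi
    rw [ofConv_sub, LinearMap.sub_apply, map_sub, sub_eq_zero] at h2
    exact h2
  · intro h
    refine dist_ext fun a => truncMap_eq_zero.2 (PowerSeries.X_pow_dvd_iff.2 fun i hi => ?_)
    rw [ofConv_sub, LinearMap.sub_apply, map_sub, sub_eq_zero]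
    exact congrArg (fun Z : Dist H R => Z.ofConv a) (h i hi)

theorem exists_psCoeff (f : ℕ → Dist H R) : ∃ X : Dist H R⟦X⟧, ∀ i, psCoeff i X = f i := by
  let F : H →ₗ[ℂ] R⟦X⟧ :=
    { toFun := fun a => PowerSeries.mk fun i => (f i).ofConv a
      map_add' := fun a b => by
        ext i
        simp
      map_smul' := fun c a => by
        ext i
        rw [PowerSeries.coeff_mk, map_smul, RingHom.id_apply, PowerSeries.coeff_smul,
          PowerSeries.coeff_mk] }
  exact ⟨toConv F, fun i => dist_ext fun a => PowerSeries.coeff_mk i fun i => (f i).ofConv a⟩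

theorem ps_ext {X Y : Dist H R⟦X⟧} (h : ∀ i, psCoeff i X = psCoeff i Y) : X = Y :=
  dist_ext fun a => by
    ext i
    exact congrArg (fun Z : Dist H R => Z.ofConv a) (h i)

theorem exists_eq_of_trunc_eq {m : ℕ} {X Y : Dist H R⟦X⟧}
    (h : distMap (truncMap R m) X = distMap (truncMap R m) Y) :
    ∃ E, X = Y + (PowerSeries.X : R⟦X⟧) ^ m • E := by
  obtain ⟨E, hE⟩ := exists_eq_X_pow_smul (n := m) (D := X - Y) (by rw [map_sub, h, sub_self])
  exact ⟨E, by rw [← hE]; abel⟩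

/-- Differentiation loses one order in `z` and the factor `z^n` restores it. Consequently the action
modulo `z^m` depends only on the loop modulo `z^m`. -/
theorem trunc_ddz {n m : ℕ} (hn : 1 ≤ n) (hm : 1 ≤ m) {X Y : Dist H R⟦X⟧}
    (h : distMap (truncMap R m) X = distMap (truncMap R m) Y) :
    distMap (truncMap R m) ((PowerSeries.X : R⟦X⟧) ^ n • ddz X) =
      distMap (truncMap R m) ((PowerSeries.X : R⟦X⟧) ^ n • ddz Y) := by
  obtain ⟨E, rfl⟩ := exists_eq_of_trunc_eq h
  rw [ddz_add, ddz_X_pow_smul hm, smul_add, smul_smul, ← pow_add, map_add,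
    distMap_X_pow_smul (m := n + (m - 1)) (by omega), add_zero]

theorem trunc_shiftGauge {n m : ℕ} (hn : 1 ≤ n) (hm : 1 ≤ m) {g g' : Points H R⟦X⟧}
    (h : distMap (truncMap R m) (toDist g) = distMap (truncMap R m) (toDist g'))
    (B : Dist H R⟦X⟧) :
    distMap (truncMap R m) (shiftGauge n g B) = distMap (truncMap R m) (shiftGauge n g' B) := by
  have hp : pointsMap (truncMap R m) g = pointsMap (truncMap R m) g' := toDist_injective h
  have hi : distMap (truncMap R m) (toDist g⁻¹) = distMap (truncMap R m) (toDist g'⁻¹) := by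
    rw [← toDist_pointsMap, ← toDist_pointsMap, map_inv, map_inv, hp]
  rw [shiftGauge, shiftGauge, map_sub, map_sub, ← smul_mul_assoc, ← smul_mul_assoc]
  simp only [map_mul]
  rw [h, hi, trunc_ddz hn hm h]

theorem pow_trunc_eq_zero {X : Dist H R⟦X⟧} (hX : ∀ a, (PowerSeries.X : R⟦X⟧) ∣ X.ofConv a)
    {m k : ℕ} (h : m ≤ k) : distMap (truncMap R m) (divPow X k) = 0 := by
  refine dist_ext fun a => truncMap_eq_zero.2 ?_
  rw [divPow_apply, Algebra.smul_def]
  exact Dvd.dvd.mul_left ((pow_dvd_pow _ h).trans (pow_apply_dvd hX k a)) _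

theorem IsExp.trunc_eq {X : Dist H R⟦X⟧} (hX : ∀ a, (PowerSeries.X : R⟦X⟧) ∣ X.ofConv a)
    {g : Points H R⟦X⟧} (hg : IsExp X g) {m M : ℕ} (h : m ≤ M) :
    distMap (truncMap R m) (toDist g) =
      ∑ k ∈ Finset.range M, distMap (truncMap R m) (divPow X k) := by
  refine dist_ext fun a => ?_
  obtain ⟨N, hN⟩ := (hg.locSum_trunc m) a
  rw [← toDist_pointsMap, hN (max N M) (le_max_left _ _), sum_ofConv]
  simp only [distMap_divPow]
  refine (Finset.sum_subset (Finset.range_mono (le_max_right N M)) fun k _ hk => ?_).symm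
  rw [Finset.mem_range] at hk
  rw [← distMap_divPow, pow_trunc_eq_zero hX (by omega)]
  rfl

theorem IsExp.trunc_congr {X Y : Dist H R⟦X⟧} (hX : ∀ a, (PowerSeries.X : R⟦X⟧) ∣ X.ofConv a)
    (hY : ∀ a, (PowerSeries.X : R⟦X⟧) ∣ Y.ofConv a) {g h : Points H R⟦X⟧} (hg : IsExp X g)
    (hh : IsExp Y h) {m : ℕ} (he : distMap (truncMap R m) X = distMap (truncMap R m) Y) :
    distMap (truncMap R m) (toDist g) = distMap (truncMap R m) (toDist h) := by
  rw [hg.trunc_eq hX le_rfl, hh.trunc_eq hY le_rfl]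
  simp only [distMap_divPow, he]

theorem isExp_zero : IsExp (0 : Dist H R⟦X⟧) 1 := by
  intro a m
  refine ⟨1, fun M hM => ?_⟩
  obtain ⟨M, rfl⟩ : ∃ k, M = k + 1 := ⟨M - 1, by omega⟩
  rw [Finset.sum_range_succ', Finset.sum_eq_zero fun k _ => by
    rw [zero_pow (Nat.succ_ne_zero k)]; exact smul_zero _]
  rw [zero_add, Nat.factorial_zero, Nat.cast_one, inv_one, one_smul, pow_zero]
  rfl

/-- Applied modulo `z^(m+1)` with `y = z^m Y` and `x` divisible by `z`: the increment enters the
exponential series only through its linear term. -/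
theorem add_pow_of_mul_eq_zero {A : Type*} [Ring A] {x y : A} (hxy : x * y = 0) (hyx : y * x = 0)
    (hyy : y * y = 0) (k : ℕ) : (x + y) ^ (k + 2) = x ^ (k + 2) := by
  induction k with
  | zero => rw [pow_two, pow_two, add_mul, mul_add, mul_add, hxy, hyx, hyy, add_zero, add_zero,
      add_zero]
  | succ k ih => rw [pow_succ, ih, mul_add, pow_succ x (k + 1), mul_assoc _ x y, hxy, mul_zero,
      add_zero, pow_succ x (k + 2), pow_succ x (k + 1)]

/-- The exponential of `X + z^m Y` to first order. -/
theorem IsExp.trunc_add {X Y : Dist H R⟦X⟧} (hX : ∀ a, (PowerSeries.X : R⟦X⟧) ∣ X.ofConv a)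
    {m : ℕ} (hm : 1 ≤ m) {g h : Points H R⟦X⟧} (hg : IsExp X g)
    (hh : IsExp (X + (PowerSeries.X : R⟦X⟧) ^ m • Y) h) :
    distMap (truncMap R (m + 1)) (toDist h) =
      distMap (truncMap R (m + 1)) (toDist g + (PowerSeries.X : R⟦X⟧) ^ m • Y) := by
  have hdvd : ∀ a, (PowerSeries.X : R⟦X⟧) ∣ (X + (PowerSeries.X : R⟦X⟧) ^ m • Y).ofConv a :=
    fun a => dvd_add (hX a) (Dvd.dvd.mul_right (dvd_pow_self _ (by omega)) _)
  obtain ⟨X', rfl⟩ : ∃ X', X = (PowerSeries.X : R⟦X⟧) ^ 1 • X' :=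
    exists_eq_X_pow_smul (dist_ext fun a => truncMap_eq_zero.2 (by rw [pow_one]; exact hX a))
  set T := distMap (H := H) (truncMap R (m + 1))
  set x := T ((PowerSeries.X : R⟦X⟧) ^ 1 • X')
  set y := T ((PowerSeries.X : R⟦X⟧) ^ m • Y)
  have hxy : x * y = 0 := by
    rw [← map_mul, smul_mul_assoc, mul_smul_comm, smul_smul, ← pow_add]
    exact distMap_X_pow_smul (by omega) _
  have hyx : y * x = 0 := by
    rw [← map_mul, smul_mul_assoc, mul_smul_comm, smul_smul, ← pow_add]
    exact distMap_X_pow_smul le_rfl _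
  have hyy : y * y = 0 := by
    rw [← map_mul, smul_mul_assoc, mul_smul_comm, smul_smul, ← pow_add]
    exact distMap_X_pow_smul (by omega) _
  have hpow := add_pow_of_mul_eq_zero hxy hyx hyy
  rw [hh.trunc_eq hdvd (show m + 1 ≤ m + 2 by omega), map_add,
    hg.trunc_eq hX (show m + 1 ≤ m + 2 by omega)]
  simp only [distMap_divPow, map_add]
  rw [Finset.sum_range_succ', Finset.sum_range_succ', Finset.sum_range_succ',
    Finset.sum_range_succ' (fun k => divPow x (k + 1)), divPow_zero, divPow_zero, zero_add,
    divPow_one, divPow_one]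
  rw [Finset.sum_congr rfl fun k _ => show divPow (x + y) (k + 1 + 1) = divPow x (k + 1 + 1) by
    rw [divPow, hpow, divPow]]
  abel

/-- The effect of `z^m Y` on the gauge transform. -/
theorem trunc_shiftGauge_add {n m : ℕ} (hn : 2 ≤ n) (hm : 1 ≤ m) {g h : Points H R⟦X⟧}
    {B Y : Dist H R⟦X⟧} (hg : distMap (truncMap R 1) (toDist g) = 1)
    (hh : distMap (truncMap R (m + 1)) (toDist h) =
      distMap (truncMap R (m + 1)) (toDist g + (PowerSeries.X : R⟦X⟧) ^ m • Y)) :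
    distMap (truncMap R (m + 1)) (shiftGauge n h B) =
      distMap (truncMap R (m + 1)) (shiftGauge n g B + (PowerSeries.X : R⟦X⟧) ^ m • ⁅Y, B⁆) := by
  have h1 := shiftGauge_eq_iff.1 (rfl : shiftGauge n h B = _)
  have h2 := shiftGauge_eq_iff.1 (rfl : shiftGauge n g B = _)
  -- Both `g ≡ 1` and its gauge transform of `B`, which is `≡ B`, are needed only modulo `z`, since
  -- they meet `Y` multiplied by `z^m`.
  obtain ⟨E, hE⟩ := exists_eq_of_trunc_eq (hg.trans (map_one _).symm)
  have hB' : ∃ F, shiftGauge n g B = B + (PowerSeries.X : R⟦X⟧) ^ 1 • F := by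
    refine exists_eq_of_trunc_eq ?_
    rw [trunc_shiftGauge (by omega) le_rfl (g' := 1) (hg.trans (map_one _).symm), shiftGauge]
    simp [toDist_one, ddz_one]
  obtain ⟨F, hF⟩ := hB'
  have hT := fun (p : ℕ) (hp : m + 1 ≤ p) (D : Dist H R⟦X⟧) =>
    distMap_X_pow_smul (R := R) (H := H) (n := m + 1) hp D
  have key : distMap (truncMap R (m + 1))
      (toDist h * B - (PowerSeries.X : R⟦X⟧) ^ n • ddz (toDist h)) =
      distMap (truncMap R (m + 1))
        ((shiftGauge n g B + (PowerSeries.X : R⟦X⟧) ^ m • ⁅Y, B⁆) * toDist h) := by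
    have e1 : distMap (truncMap R (m + 1)) (shiftGauge n g B * (PowerSeries.X : R⟦X⟧) ^ m • Y) =
        distMap (truncMap R (m + 1)) ((PowerSeries.X : R⟦X⟧) ^ m • (B * Y)) := by
      rw [hF, mul_smul_comm, add_mul, smul_mul_assoc, smul_add, smul_smul, ← pow_add, map_add,
        hT (m + 1) le_rfl, add_zero]
    have e2 : distMap (truncMap R (m + 1)) ((PowerSeries.X : R⟦X⟧) ^ m • ⁅Y, B⁆ * toDist g) =
        distMap (truncMap R (m + 1)) ((PowerSeries.X : R⟦X⟧) ^ m • ⁅Y, B⁆) := by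
      rw [hE, mul_add, mul_one, smul_mul_assoc, mul_smul_comm, smul_smul, ← pow_add, map_add,
        hT (m + 1) le_rfl, add_zero]
    have e3 : distMap (truncMap R (m + 1)) ((PowerSeries.X : R⟦X⟧) ^ m • ⁅Y, B⁆ *
        (PowerSeries.X : R⟦X⟧) ^ m • Y) = 0 := by
      rw [smul_mul_assoc, mul_smul_comm, smul_smul, ← pow_add, hT (m + m) (by omega)]
    rw [map_sub, map_mul, trunc_ddz (by omega) (by omega) hh, hh, ← map_mul, ← map_sub, map_mul,
      hh, ← map_mul]
    -- The derivative of `z^m Y` contributes in order `n + (m - 1) ≥ m + 1`; this is where `n ≥ 2`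
    -- enters.
    rw [ddz_add, ddz_X_pow_smul hm, smul_add, smul_smul, ← pow_add, add_mul, add_mul, mul_add,
      mul_add, ← h2, map_sub, map_add, map_add, hT (n + (m - 1)) (by omega), map_add, map_add,
      map_add, e1, e2, e3, map_sub, smul_mul_assoc, Dist.lie_def, smul_sub, map_sub]
    abel
  rw [h1, map_mul, map_mul] at key
  have hu : distMap (truncMap R (m + 1)) (toDist h) * distMap (truncMap R (m + 1)) (toDist h⁻¹) =
      1 := by rw [← map_mul, toDist_mul_inv, map_one]
  have := congrArg (· * distMap (truncMap R (m + 1)) (toDist h⁻¹)) key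
  simpa only [mul_assoc, hu, mul_one] using this

end Gauge

/-! ### Existence of the normal form -/

section Existence

open scoped PowerSeries LaurentSeries

variable {H : Type u} [CommRing H] [HopfAlgebra ℂ H]
variable {R : Type v} [CommRing R] [Algebra ℂ R]
variable {𝔥 𝔟 : LieSubalgebra ℂ (lieAlg H ℂ)} {κ : Type*} [Fintype κ]

theorem psCoeff_zero_mul (X Y : Dist H R⟦X⟧) : psCoeff 0 (X * Y) = psCoeff 0 X * psCoeff 0 Y := by
  refine dist_ext fun a => ?_
  let 𝓐 := Coalgebra.Repr.arbitrary ℂ a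
  rw [psCoeff_apply, 𝓐.convMul_apply, 𝓐.convMul_apply, map_sum]
  simp only [PowerSeries.coeff_zero_eq_constantCoeff, map_mul, psCoeff_apply]

theorem psCoeff_add (i : ℕ) (X Y : Dist H R⟦X⟧) : psCoeff i (X + Y) = psCoeff i X + psCoeff i Y :=
  map_add (distLin ((PowerSeries.coeff (R := R) i).restrictScalars ℂ)) X Y

theorem psCoeff_sub (i : ℕ) (X Y : Dist H R⟦X⟧) : psCoeff i (X - Y) = psCoeff i X - psCoeff i Y :=
  map_sub (distLin ((PowerSeries.coeff (R := R) i).restrictScalars ℂ)) X Y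

theorem psCoeff_X_pow_smul_self (m : ℕ) (D : Dist H R⟦X⟧) :
    psCoeff m ((PowerSeries.X : R⟦X⟧) ^ m • D) = psCoeff 0 D := by
  have := psCoeff_X_pow_smul m 0 D
  rwa [zero_add] at this

theorem psCoeff_X_pow_smul_of_lt {i m : ℕ} (h : i < m) (D : Dist H R⟦X⟧) :
    psCoeff i ((PowerSeries.X : R⟦X⟧) ^ m • D) = 0 :=
  dist_ext fun _ => PowerSeries.X_pow_dvd_iff.1 (dvd_mul_right _ _) i h

theorem psCoeff_mem_scalarExt [Module.Finite ℂ (lieAlg H ℂ)] {V : Submodule ℂ (lieAlg H ℂ)}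
    {X : Dist H R⟦X⟧} (hX : X ∈ scalarExt V R⟦X⟧) (i : ℕ) : psCoeff i X ∈ scalarExt V R :=
  distLin_mem_scalarExt ((PowerSeries.coeff (R := R) i).restrictScalars ℂ) hX

theorem X_dvd_of_psCoeff {X : Dist H R⟦X⟧} (h : psCoeff 0 X = 0) (a : H) :
    (PowerSeries.X : R⟦X⟧) ∣ X.ofConv a := by
  rw [PowerSeries.X_dvd_iff, ← PowerSeries.coeff_zero_eq_constantCoeff_apply]
  exact congrArg (fun Z : Dist H R => Z.ofConv a) h

theorem mem_unipotentLoops {n : ℕ} {X : Dist H R⟦X⟧} {g : Points H R⟦X⟧} (hX : IsTangent X)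
    (h0 : ∀ i < n, psCoeff i X = 0) (hg : IsExp X g) : g ∈ unipotentLoops R 𝔟 n :=
  Subgroup.subset_closure ⟨X, hX, fun i hi => by rw [h0 i hi]; exact Submodule.zero_mem _, hg⟩

/-- One step of the removal of the nonpolar root components. -/
theorem RootChart.exists_step (C : RootChart 𝔥 𝔟 κ) {n : ℕ} (hn : 2 ≤ n)
    [Module.Finite ℂ (lieAlg H ℂ)] {B : Dist H R⟦X⟧} (hB : IsTangent B)
    (h0 : psCoeff 0 B ∈ scalarExt 𝔥.toSubmodule R)
    (hu : ∀ k, IsUnit ((psCoeff 0 B).ofConv (C.rootFun k))) {X : Dist H R⟦X⟧} (hX : IsTangent X)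
    (hX0 : ∀ i < n, psCoeff i X = 0) {m : ℕ} (hm : n ≤ m) :
    ∃ X', IsTangent X' ∧ (∀ i < m, psCoeff i X' = psCoeff i X) ∧
      ∀ g, IsExp X' g → psCoeff m (shiftGauge n g B) ∈ scalarExt 𝔥.toSubmodule R := by
  have hd := X_dvd_of_psCoeff (hX0 0 (by omega))
  obtain ⟨g, hg⟩ := exists_isExp hX hd
  have hGt : IsTangent (psCoeff m (shiftGauge n g B)) := (hB.shiftGauge g).psCoeff m
  -- The correction `[Y_0, B_0] = -[B_0, Y_0]` must cancel the root components of the current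
  -- coefficient of `z^m`.
  obtain ⟨d, -, hd'⟩ := C.exists_lie_eq h0 hu
    fun k => (psCoeff m (shiftGauge n g B)).ofConv (C.crdFun k)
  obtain ⟨Y, hY⟩ := exists_psCoeff fun i => if i = 0 then ∑ k, d k • C.vecExt R k else 0
  have hY0 : psCoeff 0 Y = ∑ k, d k • C.vecExt R k := hY 0
  have hYt : IsTangent Y := isTangent_of_psCoeff fun i => by
    rw [hY]
    split_ifs
    · exact sum_mem fun k _ => (lieAlg H R).smul_mem _ (C.vecExt_tangent k)
    · exact (lieAlg H R).zero_mem
  refine ⟨X + (PowerSeries.X : R⟦X⟧) ^ m • Y,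
    (lieAlg H R⟦X⟧).add_mem hX ((lieAlg H R⟦X⟧).smul_mem _ hYt), fun i hi => ?_, fun g' hg' => ?_⟩
  · rw [psCoeff_add, psCoeff_X_pow_smul_of_lt hi, add_zero]
  · have h1 : distMap (truncMap R 1) (toDist g) = 1 := by
      rw [hg.trunc_eq hd le_rfl, Finset.sum_range_one, divPow_zero, map_one]
    have h2 := trunc_shiftGauge_add hn (by omega) (B := B) h1 (hg.trunc_add hd (by omega) hg')
    rw [trunc_eq_iff.1 h2 m (by omega), psCoeff_add, psCoeff_X_pow_smul_self, Dist.lie_def,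
      psCoeff_sub, psCoeff_zero_mul, psCoeff_zero_mul, ← Dist.lie_def, hY0, ← lie_skew, hd',
      ← sub_eq_add_neg]
    exact C.sub_sum_mem hGt

/-- Removal of the nonpolar root components. -/
theorem RootChart.exists_nonpolar (C : RootChart 𝔥 𝔟 κ) {n : ℕ} (hn : 2 ≤ n)
    [Module.Finite ℂ (lieAlg H ℂ)] {B : Dist H R⟦X⟧} (hB : IsTangent B)
    (h0 : ∀ i < n, psCoeff i B ∈ scalarExt 𝔥.toSubmodule R)
    (hu : ∀ k, IsUnit ((psCoeff 0 B).ofConv (C.rootFun k))) :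
    ∃ g ∈ unipotentLoops R 𝔟 n, psCoeff 0 (shiftGauge n g B) = psCoeff 0 B ∧
      ∀ i, psCoeff i (shiftGauge n g B) ∈ scalarExt 𝔥.toSubmodule R := by
  -- The recursion refines one exponent instead of multiplying loops. Each coefficient stabilizes,
  -- so the limit is again an exponent, and no infinite product is needed.
  let P := {X : Dist H R⟦X⟧ // IsTangent X ∧ ∀ i < n, psCoeff i X = 0}
  have step : ∀ (X : P) (j : ℕ), ∃ X' : P, (∀ i < n + j, psCoeff i X'.1 = psCoeff i X.1) ∧
      ∀ g, IsExp X'.1 g → psCoeff (n + j) (shiftGauge n g B) ∈ scalarExt 𝔥.toSubmodule R := by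
    intro X j
    obtain ⟨X', h1, h2, h3⟩ := C.exists_step hn hB (h0 0 (by omega)) hu X.2.1 X.2.2
      (show n ≤ n + j by omega)
    exact ⟨⟨X', h1, fun i hi => (h2 i (by omega)).trans (X.2.2 i hi)⟩, h2, h3⟩
  choose f hf1 hf2 using step
  let s : ℕ → P := fun j => Nat.rec ⟨0, (lieAlg H R⟦X⟧).zero_mem, fun i _ => rfl⟩
    (fun j X => f X j) j
  have hs : ∀ j, s (j + 1) = f (s j) j := fun _ => rfl
  have hstab : ∀ j l i : ℕ, i < n + j → psCoeff i (s (j + l)).1 = psCoeff i (s j).1 := by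
    intro j l i hi
    induction l with
    | zero => rfl
    | succ l ih => rw [← add_assoc, hs, hf1 _ _ _ (by omega), ih]
  have hstab' : ∀ j l i : ℕ, i < n + j → i < n + l → psCoeff i (s l).1 = psCoeff i (s j).1 := by
    intro j l i hj hl
    rw [← hstab j l i hj, ← hstab l j i hl, add_comm]
  obtain ⟨X, hX⟩ := exists_psCoeff fun i => psCoeff i (s (i + 1)).1
  have hXs : ∀ j i : ℕ, i < n + j → psCoeff i X = psCoeff i (s j).1 := fun j i hi => by
    rw [hX, hstab' j (i + 1) i hi (by omega)]
  have hXt : IsTangent X := isTangent_of_psCoeff fun i => by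
    rw [hX]
    exact (s (i + 1)).2.1.psCoeff i
  have hX0 : ∀ i < n, psCoeff i X = 0 := fun i hi => by
    rw [hX]
    exact (s (i + 1)).2.2 i hi
  have hd := X_dvd_of_psCoeff (hX0 0 (by omega))
  obtain ⟨g, hg⟩ := exists_isExp hXt hd
  have hlow : ∀ i < n, psCoeff i (shiftGauge n g B) = psCoeff i B := by
    have h1 : distMap (truncMap R n) (toDist g) = distMap (truncMap R n) (toDist 1) :=
      hg.trunc_congr hd (fun _ => dvd_zero _) isExp_zero (trunc_eq_iff.2 fun i hi => hX0 i hi)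
    have h2 := trunc_eq_iff.1 (trunc_shiftGauge (n := n) (by omega) (by omega) h1 B)
    intro i hi
    rw [h2 i hi, shiftGauge]
    simp [toDist_one, ddz_one]
  refine ⟨g, mem_unipotentLoops hXt hX0 hg, hlow 0 (by omega), fun i => ?_⟩
  by_cases hi : i < n
  · rw [hlow i hi]
    exact h0 i hi
  · obtain ⟨j, rfl⟩ := Nat.exists_eq_add_of_le (not_lt.1 hi)
    have hd' := X_dvd_of_psCoeff ((s (j + 1)).2.2 0 (by omega))
    obtain ⟨g', hg'⟩ := exists_isExp (s (j + 1)).2.1 hd'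
    -- The coefficient of `z^(n+j)` sees the exponent only up to that order, where the limit agrees
    -- with stage `j + 1`.
    have h1 := hg.trunc_congr hd hd' hg' (m := n + j + 1)
      (trunc_eq_iff.2 fun i hi => hXs (j + 1) i (by omega))
    rw [trunc_eq_iff.1 (trunc_shiftGauge (n := n) (by omega) (by omega) h1 B) (n + j) (by omega)]
    exact hf2 _ _ _ hg'

theorem ddz_divPow_succ {X : Dist H R⟦X⟧} (hc : Commute X (ddz X)) (k : ℕ) :
    ddz (divPow X (k + 1)) = ddz X * divPow X k := by
  have hp : ddz (X ^ (k + 1)) = ((k : ℂ) + 1) • (ddz X * X ^ k) := by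
    induction k with
    | zero => simp
    | succ k ih =>
      rw [pow_succ, ddz_mul, ih, smul_mul_assoc, mul_assoc, ← pow_succ,
        (hc.pow_left (k + 1)).eq, Nat.cast_succ, add_smul ((k : ℂ) + 1) 1, one_smul]
  have hsm : ∀ (c : ℂ) (Z : Dist H R⟦X⟧), ddz (c • Z) = c • ddz Z := fun c Z =>
    map_smul (distLin ((PowerSeries.derivative R).toLinearMap.restrictScalars ℂ)) c Z
  rw [divPow, divPow, hsm, hp, smul_smul, mul_smul_comm]
  congr 1
  rw [Nat.factorial_succ]
  have h1 : ((k : ℂ) + 1) ≠ 0 := Nat.cast_add_one_ne_zero k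
  have h2 : (k.factorial : ℂ) ≠ 0 := Nat.cast_ne_zero.2 (Nat.factorial_ne_zero k)
  push_cast
  field_simp

theorem eq_of_forall_trunc_eq {X Y : Dist H R⟦X⟧}
    (h : ∀ n, distMap (truncMap R n) X = distMap (truncMap R n) Y) : X = Y :=
  ps_ext fun i => trunc_eq_iff.1 (h (i + 1)) i (by omega)

/-- Termwise differentiation of the series. To obtain the identity modulo `z^n`, the series is
truncated modulo `z^(n+1)`, because the derivative of the remainder loses one order. -/
theorem IsExp.ddz_eq {X : Dist H R⟦X⟧} (hX : ∀ a, (PowerSeries.X : R⟦X⟧) ∣ X.ofConv a)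
    (hc : Commute X (ddz X)) {g : Points H R⟦X⟧} (hg : IsExp X g) :
    ddz (toDist g) = ddz X * toDist g := by
  refine eq_of_forall_trunc_eq fun n => ?_
  obtain ⟨E, hE⟩ := exists_eq_of_trunc_eq (m := n + 1) (X := toDist g)
    (Y := ∑ k ∈ Finset.range (n + 2), divPow X k) (by
      rw [hg.trunc_eq hX (show n + 1 ≤ n + 2 by omega), map_sum])
  have hsum : ddz (∑ k ∈ Finset.range (n + 2), divPow X k) =
      ∑ k ∈ Finset.range (n + 2), ddz (divPow X k) :=
    map_sum (distLin ((PowerSeries.derivative R).toLinearMap.restrictScalars ℂ)) _ _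
  rw [map_mul, hg.trunc_eq hX (show n ≤ n + 1 by omega), hE, ddz_add, ddz_X_pow_smul (by omega),
    map_add, Nat.add_sub_cancel, distMap_X_pow_smul le_rfl, add_zero, hsum, Finset.sum_range_succ',
    divPow_zero, ddz_one, add_zero, map_sum, Finset.mul_sum]
  exact Finset.sum_congr rfl fun k _ => by rw [ddz_divPow_succ hc, map_mul]

theorem IsExp.commute {X B : Dist H R⟦X⟧} (hX : ∀ a, (PowerSeries.X : R⟦X⟧) ∣ X.ofConv a)
    (hc : Commute X B) {g : Points H R⟦X⟧} (hg : IsExp X g) : Commute (toDist g) B := by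
  refine eq_of_forall_trunc_eq fun n => ?_
  rw [map_mul, map_mul, hg.trunc_eq hX le_rfl, Finset.sum_mul, Finset.mul_sum]
  refine Finset.sum_congr rfl fun k _ => ?_
  rw [← map_mul, ← map_mul, divPow, smul_mul_assoc, mul_smul_comm, (hc.pow_left k).eq]

/-- Removal of the Cartan components of high order. -/
theorem RootChart.exists_cartan (C : RootChart 𝔥 𝔟 κ) {n : ℕ} (hn : 2 ≤ n)
    [Module.Finite ℂ (lieAlg H ℂ)] {B : Dist H R⟦X⟧}
    (hB : ∀ i, psCoeff i B ∈ scalarExt 𝔥.toSubmodule R) :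
    ∃ g ∈ unipotentLoops R 𝔟 n, ∀ i, psCoeff i (shiftGauge n g B) =
      if i < 2 * n - 1 then psCoeff i B else 0 := by
  -- Integrate the tail of `B`: `z^n X'` is to equal the part of `B` of order at least `2n - 1`. The
  -- bound `n ≤ j` keeps Cartan terms out of the coefficients that must lie in `𝔲`, and `j = n`
  -- corresponds to the order `2n - 1`.
  obtain ⟨X, hX⟩ := exists_psCoeff fun j =>
    if n ≤ j then (algebraMap ℂ R (j : ℂ)⁻¹) • psCoeff (j + n - 1) B else 0
  have hXm : X ∈ scalarExt 𝔥.toSubmodule R⟦X⟧ := mem_scalarExt_of_psCoeff fun i => by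
    rw [hX]
    split_ifs
    · exact Submodule.smul_mem _ _ (hB _)
    · exact Submodule.zero_mem _
  have hXt := isTangent_of_mem_scalarExt hXm
  have hX0 : ∀ i < n, psCoeff i X = 0 := fun i hi => by rw [hX, if_neg (by omega)]
  have hdm : ddz X ∈ scalarExt 𝔥.toSubmodule R⟦X⟧ :=
    distLin_mem_scalarExt ((PowerSeries.derivative R).toLinearMap.restrictScalars ℂ) hXm
  have hcomm : ∀ Y ∈ scalarExt 𝔥.toSubmodule R⟦X⟧, Commute X Y := fun Y hY =>
    sub_eq_zero.1 (C.lie_cartanExt hXm hY)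
  have hd := X_dvd_of_psCoeff (hX0 0 (by omega))
  obtain ⟨g, hg⟩ := exists_isExp hXt hd
  have hgauge : shiftGauge n g B = B - (PowerSeries.X : R⟦X⟧) ^ n • ddz X := by
    rw [shiftGauge, hg.ddz_eq hd (hcomm _ hdm), mul_assoc (ddz X), toDist_mul_inv, mul_one,
      (hg.commute hd (hcomm _ (mem_scalarExt_of_psCoeff hB))).eq, mul_assoc, toDist_mul_inv,
      mul_one]
  have hdc : ∀ i, psCoeff i (ddz X) = algebraMap ℂ R ((i : ℂ) + 1) • psCoeff (i + 1) X := by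
    intro i
    refine dist_ext fun a => ?_
    change PowerSeries.coeff i (PowerSeries.derivative R (X.ofConv a)) = _
    rw [PowerSeries.coeff_derivative, smul_ofConv, psCoeff_apply, mul_comm]
    congr 1
    simp
  refine ⟨g, mem_unipotentLoops hXt hX0 hg, fun i => ?_⟩
  rw [hgauge, psCoeff_sub]
  by_cases hi : i < n
  · rw [psCoeff_X_pow_smul_of_lt hi, sub_zero, if_pos (by omega)]
  · obtain ⟨j, rfl⟩ := Nat.exists_eq_add_of_le' (not_lt.1 hi)
    rw [psCoeff_X_pow_smul, hdc, hX]
    split_ifs with h1 h2 h2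
    · omega
    · rw [smul_smul, ← map_mul, Nat.cast_succ, mul_inv_cancel₀ (Nat.cast_add_one_ne_zero j),
        map_one, one_smul, show j + 1 + n - 1 = j + n by omega, sub_self]
    · rw [smul_zero, sub_zero]
    · omega

theorem RootChart.eq_of_sub_mem_filt (C : RootChart 𝔥 𝔟 κ) {h h' : Dist H R}
    (hh : h ∈ scalarExt 𝔥.toSubmodule R) (hh' : h' ∈ scalarExt 𝔥.toSubmodule R)
    [Module.Finite ℂ (lieAlg H ℂ)] (hs : h - h' ∈ scalarExt (C.filt 1) R) : h = h' := by
  rw [← sub_eq_zero, (C.eq_sum_of_mem_filt hs).1]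
  exact Finset.sum_eq_zero fun k _ => by rw [C.cartan_apply (sub_mem hh hh'), zero_smul]

/-- Diagonalization of the polar part. -/
theorem RootChart.exists_polar (C : RootChart 𝔥 𝔟 κ) {n : ℕ} (hn : 2 ≤ n)
    [Module.Finite ℂ (lieAlg H ℂ)] [LieAlgebra.IsSolvable 𝔟] {B : Dist H R⟦X⟧}
    (hB : ∀ i < n, psCoeff i B ∈ scalarExt 𝔟.toSubmodule R)
    {h : Dist H R} (hh : h ∈ scalarExt 𝔥.toSubmodule R)
    (he : psCoeff 0 B - h ∈ scalarExt (C.filt 1) R)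
    (hu : ∀ k, IsUnit (h.ofConv (C.rootFun k))) :
    ∃ g ∈ unipotentLoops R 𝔟 n, psCoeff 0 (shiftGauge n g B) = h ∧
      ∀ i < n, psCoeff i (shiftGauge n g B) ∈ scalarExt 𝔥.toSubmodule R := by
  -- The higher coefficients of `B` need not lie in `𝔟`. They are cut off so that the conjugation
  -- can be done over `R⟦X⟧`, which changes nothing modulo `z^n`.
  obtain ⟨b, hb⟩ := exists_psCoeff fun i => if i < n then psCoeff i B else 0
  have hbm : b ∈ scalarExt 𝔟.toSubmodule R⟦X⟧ := mem_scalarExt_of_psCoeff fun i => by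
    rw [hb]
    split_ifs with hi
    · exact hB i hi
    · exact Submodule.zero_mem _
  obtain ⟨h', hh', e, hem, rfl⟩ := C.exists_of_mem_borel hbm
  have hh0 : psCoeff 0 h' = h := by
    refine (C.eq_of_sub_mem_filt hh (psCoeff_mem_scalarExt hh' 0) ?_).symm
    have h1 := hb 0
    rw [if_pos (by omega), psCoeff_add] at h1
    rw [← h1] at he
    have := sub_mem (psCoeff_mem_scalarExt hem 0) he
    rwa [show psCoeff 0 e - (psCoeff 0 h' + psCoeff 0 e - h) = h - psCoeff 0 h' by abel] at this
  obtain ⟨g, hg, hc⟩ := C.exists_conj_cartan hh' (fun k => by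
    rw [PowerSeries.isUnit_iff_constantCoeff, ← PowerSeries.coeff_zero_eq_constantCoeff_apply,
      ← psCoeff_apply, hh0]
    exact hu k) hem
  have hgU : g ∈ unipotentLoops R 𝔟 n := by
    refine Subgroup.closure_mono ?_ hg
    rintro g ⟨u, hun, hug⟩
    refine ⟨u, isTangent_of_mem_scalarExt hun, fun i _ => psCoeff_mem_scalarExt hun i,
      fun a m => ?_⟩
    obtain ⟨N, hN⟩ := hug a
    refine ⟨N, fun M hM => ?_⟩
    have := congrArg (PowerSeries.coeff m) (hN M hM)
    rw [map_sum] at this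
    exact this
  have hT : distMap (truncMap R n) (shiftGauge n g B) = distMap (truncMap R n) h' := by
    have h1 : distMap (truncMap R n) B = distMap (truncMap R n) (h' + e) :=
      trunc_eq_iff.2 fun i hi => by rw [hb, if_pos hi]
    have h2 : toDist g * (h' + e) * toDist g⁻¹ = h' := by
      rw [hc, mul_assoc, toDist_mul_inv, mul_one]
    rw [shiftGauge, map_sub, distMap_X_pow_smul le_rfl, sub_zero, map_mul, map_mul, h1, ← map_mul,
      ← map_mul, h2]
  rw [trunc_eq_iff] at hT
  exact ⟨g, hgU, (hT 0 (by omega)).trans hh0, fun i hi => by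
    rw [hT i hi]; exact psCoeff_mem_scalarExt hh' i⟩

/-- Existence of the normal form. -/
theorem RootChart.exists_normalForm (C : RootChart 𝔥 𝔟 κ) {n : ℕ} (hn : 2 ≤ n)
    [Module.Finite ℂ (lieAlg H ℂ)] [LieAlgebra.IsSolvable 𝔟] {B : Dist H R⟦X⟧} (hBt : IsTangent B)
    (hB : ∀ i < n, psCoeff i B ∈ scalarExt 𝔟.toSubmodule R)
    {h : Dist H R} (hh : h ∈ scalarExt 𝔥.toSubmodule R)
    (he : psCoeff 0 B - h ∈ scalarExt (C.filt 1) R)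
    (hu : ∀ k, IsUnit (h.ofConv (C.rootFun k))) :
    ∃ g ∈ unipotentLoops R 𝔟 n, psCoeff 0 (shiftGauge n g B) = h ∧
      (∀ i, psCoeff i (shiftGauge n g B) ∈ scalarExt 𝔥.toSubmodule R) ∧
      ∀ i, 2 * n - 1 ≤ i → psCoeff i (shiftGauge n g B) = 0 := by
  obtain ⟨g, hg, hg0, hgc⟩ := C.exists_polar hn hB hh he hu
  obtain ⟨g', hg', hg0', hgc'⟩ := C.exists_nonpolar hn (hBt.shiftGauge g) hgc
    (fun k => by rw [hg0]; exact hu k)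
  obtain ⟨g'', hg'', hgc''⟩ := C.exists_cartan hn hgc'
  refine ⟨g'' * (g' * g), mul_mem hg'' (mul_mem hg' hg), ?_, fun i => ?_, fun i hi => ?_⟩
  · rw [shiftGauge_mul, shiftGauge_mul, hgc'', if_pos (by omega), hg0', hg0]
  · rw [shiftGauge_mul, shiftGauge_mul, hgc'']
    split_ifs
    · exact hgc' i
    · exact Submodule.zero_mem _
  · rw [shiftGauge_mul, shiftGauge_mul, hgc'', if_neg (by omega)]

end Existence

/-! ### Kernels of triangular semisimple operators -/

section Triangular

variable {K V ι : Type*} [Field K] [AddCommGroup V] [Module K V] [Fintype ι]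

/-- The difference `f - g` strictly raises `w`, so both matrices are block triangular for `-w` with
the same diagonal blocks. -/
theorem charpoly_eq_of_triangular [DecidableEq ι] [FiniteDimensional K V] (b : Module.Basis ι K V) {f g : Module.End K V}
    {d : ι → K} {w : ι → ℤ} (hg : ∀ j, g (b j) = d j • b j)
    (hf : ∀ i j, ¬ w j < w i → b.repr (f (b j) - d j • b j) i = 0) : f.charpoly = g.charpoly := by
  rw [← LinearMap.charpoly_toMatrix f b, ← LinearMap.charpoly_toMatrix g b]
  have hG : ∀ i j, LinearMap.toMatrix b b g i j = b.repr (d j • b j) i := fun i j => by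
    rw [LinearMap.toMatrix_apply, hg]
  have hF : ∀ i j, ¬ w j < w i → LinearMap.toMatrix b b f i j = LinearMap.toMatrix b b g i j :=
    fun i j h => by
      have := hf i j h
      rw [map_sub, Finsupp.sub_apply, sub_eq_zero] at this
      rw [hG, LinearMap.toMatrix_apply, this]
  have hGt : (LinearMap.toMatrix b b g).BlockTriangular fun i => -w i := by
    intro i j h
    rw [hG, map_smul, Finsupp.smul_apply, Module.Basis.repr_self, Finsupp.single_eq_of_ne,
      smul_zero]
    rintro rfl
    exact lt_irrefl _ h
  have hFt : (LinearMap.toMatrix b b f).BlockTriangular fun i => -w i := by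
    intro i j h
    have h' : -w j < -w i := h
    rw [hF i j (by omega)]
    exact hGt h
  rw [hGt.charpoly, hFt.charpoly]
  refine Finset.prod_congr rfl fun a _ => congrArg _ ?_
  ext i j
  refine hF _ _ ?_
  have h1 := i.2
  have h2 := j.2
  omega

theorem isSemisimple_of_diagonal [FiniteDimensional K V] (b : Module.Basis ι K V)
    {g : Module.End K V} {d : ι → K} (hg : ∀ j, g (b j) = d j • b j) : g.IsSemisimple := by
  classical
  refine Module.End.isSemisimple_of_squarefree_aeval_eq_zero
    (p := ∏ c ∈ Finset.univ.image d, (Polynomial.X - Polynomial.C c)) ?_ ?_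
  · exact (Polynomial.separable_prod_X_sub_C_iff' (f := id).2 fun _ _ _ _ h => h).squarefree
  · refine b.ext fun j => ?_
    rw [Module.End.aeval_apply_of_hasEigenvector (μ := d j)
      ⟨Module.End.mem_eigenspace_iff.2 (hg j), b.ne_zero j⟩, Polynomial.eval_prod,
      Finset.prod_eq_zero (Finset.mem_image_of_mem d (Finset.mem_univ j)) (by simp), zero_smul,
      LinearMap.zero_apply]

theorem finrank_ker_of_diagonal (b : Module.Basis ι K V)
    {g : Module.End K V} {d : ι → K} (hg : ∀ j, g (b j) = d j • b j) :
    Module.finrank K (LinearMap.ker g) = Nat.card {i // d i = 0} := by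
  classical
  have hker : LinearMap.ker g = Submodule.span K (Set.range fun i : {i // d i = 0} => b i) := by
    apply le_antisymm
    · intro x hx
      have h1 : g x = ∑ i, (b.repr x i * d i) • b i := by
        conv_lhs => rw [← b.sum_repr x, map_sum]
        exact Finset.sum_congr rfl fun i _ => by rw [map_smul, hg, smul_smul]
      rw [LinearMap.mem_ker.1 hx] at h1
      have h2 := Fintype.linearIndependent_iff.1 b.linearIndependent _ h1.symm
      rw [← b.sum_repr x]
      refine Submodule.sum_mem _ fun i _ => ?_
      by_cases hi : d i = 0
      · exact Submodule.smul_mem _ _ (Submodule.subset_span ⟨⟨i, hi⟩, rfl⟩)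
      · rw [(mul_eq_zero.1 (h2 i)).resolve_right hi, zero_smul]
        exact Submodule.zero_mem _
    · rw [Submodule.span_le]
      rintro _ ⟨⟨i, hi⟩, rfl⟩
      exact LinearMap.mem_ker.2 (by simp only [hg, hi, zero_smul])
  rw [hker, Nat.card_eq_fintype_card]
  exact finrank_span_eq_card (b.linearIndependent.comp _ Subtype.val_injective)

/-- For a semisimple operator the kernel is the whole generalized eigenspace of `0`, so its
dimension is read off from the characteristic polynomial, which `f` shares with the diagonal
operator `g`. -/
theorem finrank_ker_of_triangular [FiniteDimensional K V] (b : Module.Basis ι K V)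
    {f g : Module.End K V} {d : ι → K} {w : ι → ℤ} (hg : ∀ j, g (b j) = d j • b j)
    (hf : ∀ i j, ¬ w j < w i → b.repr (f (b j) - d j • b j) i = 0) (hs : f.IsSemisimple) :
    Module.finrank K (LinearMap.ker f) = Nat.card {i // d i = 0} := by
  classical
  have hker : ∀ {φ : Module.End K V}, φ.IsSemisimple →
      Module.finrank K (LinearMap.ker φ) = φ.charpoly.natTrailingDegree := by
    intro φ hφ
    rw [← LinearMap.finrank_maxGenEigenspace_zero_eq,
      hφ.isFinitelySemisimple.maxGenEigenspace_eq_eigenspace, Module.End.eigenspace_zero]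
  rw [hker hs, charpoly_eq_of_triangular b hg hf, ← hker (isSemisimple_of_diagonal b hg),
    finrank_ker_of_diagonal b hg]

end Triangular

/-! ### Bases of `𝔤 ⊗ S` adapted to the roots -/

section Regular

variable {H : Type u} [CommRing H] [HopfAlgebra ℂ H]
variable {S : Type v} [CommRing S] [Algebra ℂ S]
variable {𝔥 𝔟 : LieSubalgebra ℂ (lieAlg H ℂ)} {κ : Type*} [Fintype κ]

theorem exists_dual_functions [Module.Finite ℂ (lieAlg H ℂ)] {ι : Type*}
    (b : Module.Basis ι ℂ (lieAlg H ℂ)) : ∃ f : ι → H, ∀ i x, b.repr x i = x.1.ofConv (f i) := by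
  choose f hf using fun i => exists_eval (b.coord i)
  exact ⟨f, hf⟩

theorem IsTangent.eq_sum [Module.Finite ℂ (lieAlg H ℂ)] {ι : Type*} [Fintype ι]
    (b : Module.Basis ι ℂ (lieAlg H ℂ)) {f : ι → H} (hf : ∀ i x, b.repr x i = x.1.ofConv (f i))
    {X : Dist H S} (hX : IsTangent X) : X = ∑ i, X.ofConv (f i) • baseExt S (b i).1 := by
  refine dist_ext fun a => ?_
  have h1 : X.ofConv (a - ∑ i, (b i).1.ofConv a • f i) = 0 := by
    refine hX.apply_eq_zero fun x => ?_
    rw [map_sub, map_sum, sub_eq_zero]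
    simp only [map_smul, ← hf]
    have h2 := congrArg (fun y : lieAlg H ℂ => y.1.ofConv a) (b.sum_repr x)
    let ev : lieAlg H ℂ →ₗ[ℂ] ℂ :=
      { toFun := fun x => x.1.ofConv a
        map_add' := fun x y => rfl
        map_smul' := fun c x => rfl }
    have h3 : ev (∑ i, b.repr x i • b i) = ∑ i, b.repr x i • ev (b i) := by
      rw [map_sum]
      exact Finset.sum_congr rfl fun i _ => map_smul _ _ _
    rw [b.sum_repr] at h3
    refine h3.trans (Finset.sum_congr rfl fun i _ => ?_)
    rw [smul_eq_mul, smul_eq_mul, mul_comm]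
    rfl
  rw [map_sub, map_sum, sub_eq_zero] at h1
  rw [h1, sum_ofConv]
  exact Finset.sum_congr rfl fun i _ => by
    rw [map_smul, smul_ofConv, baseExt_apply, Algebra.smul_def, mul_comm]

/-- The basis of `𝔤 ⊗ S` induced by a basis of `𝔤`. -/
def extBasis [Module.Finite ℂ (lieAlg H ℂ)] {ι : Type*} [Fintype ι]
    (b : Module.Basis ι ℂ (lieAlg H ℂ)) {f : ι → H} (hf : ∀ i x, b.repr x i = x.1.ofConv (f i))
    (S : Type v) [CommRing S] [Algebra ℂ S] : Module.Basis ι S (lieAlg H S) :=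
  Module.Basis.ofEquivFun
    { toFun := fun X i => X.1.ofConv (f i)
      map_add' := fun X Y => rfl
      map_smul' := fun c X => rfl
      invFun := fun c => ⟨∑ i, c i • baseExt S (b i).1,
        sum_mem fun i _ => (lieAlg H S).smul_mem _ (isTangent_baseExt (b i).2)⟩
      left_inv := fun X => Subtype.ext (IsTangent.eq_sum b hf X.2).symm
      right_inv := fun c => by
        classical
        ext j
        change (∑ i, c i • baseExt S (b i).1).ofConv (f j) = c j
        rw [sum_ofConv, Finset.sum_eq_single j]
        · rw [smul_ofConv, baseExt_apply, ← hf, b.repr_self, Finsupp.single_eq_same, map_one,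
            mul_one]
        · intro i _ hi
          rw [smul_ofConv, baseExt_apply, ← hf, b.repr_self, Finsupp.single_eq_of_ne hi.symm,
            map_zero, mul_zero]
        · simp }

theorem extBasis_repr [Module.Finite ℂ (lieAlg H ℂ)] {ι : Type*} [Fintype ι]
    (b : Module.Basis ι ℂ (lieAlg H ℂ)) {f : ι → H} (hf : ∀ i x, b.repr x i = x.1.ofConv (f i))
    (X : lieAlg H S) (i : ι) : (extBasis b hf S).repr X i = X.1.ofConv (f i) := rfl

theorem extBasis_apply [Module.Finite ℂ (lieAlg H ℂ)] {ι : Type*} [Fintype ι]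
    (b : Module.Basis ι ℂ (lieAlg H ℂ)) {f : ι → H} (hf : ∀ i x, b.repr x i = x.1.ofConv (f i))
    (i : ι) : ((extBasis b hf S) i).1 = baseExt S (b i).1 := by
  classical
  have h := (extBasis b hf S).repr_self i
  have h1 := IsTangent.eq_sum b hf ((extBasis b hf S) i).2
  rw [h1, Finset.sum_eq_single i]
  · rw [← extBasis_repr b hf, h, Finsupp.single_eq_same, one_smul]
  · intro j _ hj
    rw [← extBasis_repr b hf, h, Finsupp.single_eq_of_ne hj, zero_smul]
  · simp

namespace RootChart

variable (C : RootChart 𝔥 𝔟 κ)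

theorem exists_basis [Module.Finite ℂ (lieAlg H ℂ)] :
    ∃ b : Module.Basis (κ ⊕ Fin (Module.finrank ℂ 𝔥)) ℂ (lieAlg H ℂ),
      (∀ k, b (Sum.inl k) = C.vec k) ∧ ∀ i, b (Sum.inr i) ∈ 𝔥 := by
  classical
  let φ : lieAlg H ℂ →ₗ[ℂ] (κ → ℂ) × 𝔥 :=
    { toFun := fun x => (fun k => C.coord k x, ⟨x - ∑ k, C.coord k x • C.vec k, C.sub_mem x⟩)
      map_add' := fun x y => by
        refine Prod.ext ?_ (Subtype.ext ?_)
        · ext k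
          simp
        · change (x + y) - _ = (x - _) + (y - _)
          simp only [map_add, add_smul, Finset.sum_add_distrib]
          abel
      map_smul' := fun c x => by
        refine Prod.ext ?_ (Subtype.ext ?_)
        · ext k
          simp
        · simp [smul_sub, Finset.smul_sum, mul_smul] }
  let ψ : (κ → ℂ) × 𝔥 →ₗ[ℂ] lieAlg H ℂ :=
    { toFun := fun p => p.2.1 + ∑ k, p.1 k • C.vec k
      map_add' := fun p q => by
        change (p.2.1 + q.2.1) + ∑ k, (p.1 + q.1) k • C.vec k = _
        simp only [Pi.add_apply, add_smul, Finset.sum_add_distrib]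
        abel
      map_smul' := fun c p => by
        simp [smul_add, Finset.smul_sum, mul_smul] }
  have h1 : ∀ p k, C.coord k (ψ p) = p.1 k := by
    intro p k
    change C.coord k (p.2.1 + ∑ k, p.1 k • C.vec k) = _
    rw [map_add, C.coord_cartan k _ p.2.2, C.coord_sum, zero_add]
  let e : ((κ → ℂ) × 𝔥) ≃ₗ[ℂ] lieAlg H ℂ := LinearEquiv.ofLinearMap ψ φ
    (by
      ext1 x
      change (x - ∑ k, C.coord k x • C.vec k) + ∑ k, C.coord k x • C.vec k = x
      abel)
    (by
      refine LinearMap.ext fun p => Prod.ext (funext fun k => h1 p k) (Subtype.ext ?_)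
      change ψ p - ∑ k, C.coord k (ψ p) • C.vec k = p.2.1
      simp only [h1]
      change p.2.1 + ∑ k, p.1 k • C.vec k - _ = _
      abel)
  refine ⟨((Pi.basisFun ℂ κ).prod (Module.finBasis ℂ 𝔥)).map e, fun k => ?_, fun i => ?_⟩
  · rw [Module.Basis.map_apply]
    change ψ _ = _
    rw [show ((Pi.basisFun ℂ κ).prod (Module.finBasis ℂ 𝔥)) (Sum.inl k) =
      (Pi.single k (1 : ℂ), (0 : 𝔥)) from Prod.ext (by simp) (by simp)]
    change ((0 : 𝔥) : lieAlg H ℂ) + ∑ l, (Pi.single k (1 : ℂ) : κ → ℂ) l • C.vec l = _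
    rw [Finset.sum_eq_single k]
    · simp
    · intro l _ hl
      simp [hl]
    · simp
  · rw [Module.Basis.map_apply]
    change ψ _ ∈ 𝔥
    rw [show ((Pi.basisFun ℂ κ).prod (Module.finBasis ℂ 𝔥)) (Sum.inr i) =
      ((0 : κ → ℂ), Module.finBasis ℂ 𝔥 i) from Prod.ext (by simp) (by simp)]
    change ((Module.finBasis ℂ 𝔥 i : 𝔥) : lieAlg H ℂ) + ∑ l, (0 : κ → ℂ) l • C.vec l ∈ 𝔥
    simp

end RootChart

end Regular

/-! ### Regularity as invertibility of the roots -/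

section Regular

variable {H : Type u} [CommRing H] [HopfAlgebra ℂ H]
variable {K : Type v} [Field K] [Algebra ℂ K]
variable {R : Type v} [CommRing R] [Algebra ℂ R]
variable {𝔥 𝔟 : LieSubalgebra ℂ (lieAlg H ℂ)} {κ : Type*} [Fintype κ]

namespace RootChart

variable (C : RootChart 𝔥 𝔟 κ)

/-- The eigenvalues of the adjoint action of `h`. -/
def eigenvalue (h : Dist H R) {r : ℕ} : κ ⊕ Fin r → R :=
  Sum.elim (fun k => h.ofConv (C.rootFun k)) 0

theorem ad_extBasis [Module.Finite ℂ (lieAlg H ℂ)] {r : ℕ}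
    {b : Module.Basis (κ ⊕ Fin r) ℂ (lieAlg H ℂ)}
    (hb : ∀ k, b (Sum.inl k) = C.vec k) (hb' : ∀ i, b (Sum.inr i) ∈ 𝔥)
    {f : κ ⊕ Fin r → H} (hf : ∀ i x, b.repr x i = x.1.ofConv (f i))
    {h : Dist H R} (hh : h ∈ scalarExt 𝔥.toSubmodule R) (j : κ ⊕ Fin r) :
    ⁅h, ((extBasis b hf R) j).1⁆ = C.eigenvalue h j • ((extBasis b hf R) j).1 := by
  rw [extBasis_apply]
  rcases j with k | i
  · rw [hb]
    exact C.lie_vecExt hh k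
  · rw [C.lie_cartanExt hh (baseExt_mem_scalarExt (hb' i)), eigenvalue, Sum.elim_inr,
      Pi.zero_apply, zero_smul]

/-- Bracketing with a root vector shifts the eigenvalue of `rho` by its weight. For positive roots
this makes the adjoint action strictly triangular. -/
theorem repr_lie_vec [Module.Finite ℂ (lieAlg H ℂ)] {r : ℕ}
    {b : Module.Basis (κ ⊕ Fin r) ℂ (lieAlg H ℂ)}
    (hb : ∀ k, b (Sum.inl k) = C.vec k) (hb' : ∀ i, b (Sum.inr i) ∈ 𝔥) (k : κ)
    (i j : κ ⊕ Fin r)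
    (hij : Sum.elim C.wt (0 : Fin r → ℤ) i ≠ C.wt k + Sum.elim C.wt (0 : Fin r → ℤ) j) :
    b.repr ⁅C.vec k, b j⁆ i = 0 := by
  set w : κ ⊕ Fin r → ℤ := Sum.elim C.wt (0 : Fin r → ℤ) with hw
  have hρ : ∀ i, ⁅C.rho, b i⁆ = (w i : ℂ) • b i := by
    rintro (l | i)
    · rw [hb, C.lie_vec l _ C.rho_mem, C.root_rho]
      rfl
    · rw [C.lie_cartan _ C.rho_mem _ (hb' i), hw, Sum.elim_inr, Pi.zero_apply, Int.cast_zero,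
        zero_smul]
  have hcoord : ∀ z, b.repr ⁅C.rho, z⁆ i = w i * b.repr z i := by
    intro z
    have h1 : ⁅C.rho, z⁆ = ∑ l, (w l * b.repr z l) • b l := by
      conv_lhs => rw [← b.sum_repr z, lie_sum]
      exact Finset.sum_congr rfl fun l _ => by rw [lie_smul, hρ, smul_smul, mul_comm]
    rw [h1, b.repr_sum_self]
  have h2 := hcoord ⁅C.vec k, b j⁆
  rw [leibniz_lie, C.lie_vec k _ C.rho_mem, C.root_rho, hρ, smul_lie, lie_smul, ← add_smul,
    map_smul, Finsupp.smul_apply, smul_eq_mul, ← sub_eq_zero, ← sub_mul] at h2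
  refine (mul_eq_zero.1 h2).resolve_left fun h => hij ?_
  rw [sub_eq_zero] at h
  exact_mod_cast h.symm

theorem extBasis_repr_lie [Module.Finite ℂ (lieAlg H ℂ)] {r : ℕ}
    {b : Module.Basis (κ ⊕ Fin r) ℂ (lieAlg H ℂ)}
    (hb : ∀ k, b (Sum.inl k) = C.vec k) (hb' : ∀ i, b (Sum.inr i) ∈ 𝔥)
    {f : κ ⊕ Fin r → H} (hf : ∀ i x, b.repr x i = x.1.ofConv (f i))
    {e : Dist H R} (he : e ∈ scalarExt (C.filt 1) R) (i j : κ ⊕ Fin r)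
    (hij : ¬ Sum.elim C.wt (0 : Fin r → ℤ) j < Sum.elim C.wt (0 : Fin r → ℤ) i) :
    ⁅e, ((extBasis b hf R) j).1⁆.ofConv (f i) = 0 := by
  obtain ⟨h1, h2⟩ := C.eq_sum_of_mem_filt he
  rw [h1, extBasis_apply, sum_lie, sum_ofConv]
  refine Finset.sum_eq_zero fun k _ => ?_
  by_cases hk : k ∈ C.pos ∧ 1 ≤ C.wt k
  · rw [smul_lie, smul_ofConv, vecExt, ← baseExt_lie, baseExt_apply]
    have h3 := C.repr_lie_vec hb hb' k i j (by omega)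
    rw [hf] at h3
    change _ * algebraMap ℂ R (⁅C.vec k, b j⁆.1.ofConv (f i)) = 0
    rw [h3, map_zero, mul_zero]
  · rw [h2 k hk, zero_smul, zero_lie]
    rfl

theorem isRegularSemisimple_of_ne_zero [Module.Finite ℂ (lieAlg H ℂ)] {h : Dist H K}
    (hh : h ∈ scalarExt 𝔥.toSubmodule K) (hu : ∀ k, h.ofConv (C.rootFun k) ≠ 0) :
    IsRegularSemisimple (Module.finrank ℂ 𝔥) h := by
  obtain ⟨b, hb, hb'⟩ := C.exists_basis
  obtain ⟨f, hf⟩ := exists_dual_functions b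
  have : Module.Finite K (lieAlg H K) := Module.Finite.of_basis (extBasis b hf K)
  have hd : ∀ j, LieAlgebra.ad K (lieAlg H K) ⟨h, isTangent_of_mem_scalarExt hh⟩
      (extBasis b hf K j) = C.eigenvalue h j • extBasis b hf K j := fun j =>
    Subtype.ext (C.ad_extBasis hb hb' hf hh j)
  refine ⟨isTangent_of_mem_scalarExt hh, isSemisimple_of_diagonal _ hd, ?_⟩
  rw [finrank_ker_of_diagonal _ hd]
  have e : Fin (Module.finrank ℂ 𝔥) ≃
      {i : κ ⊕ Fin (Module.finrank ℂ 𝔥) // C.eigenvalue h i = 0} :=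
    { toFun := fun i => ⟨Sum.inr i, rfl⟩
      invFun := fun i => match i with
        | ⟨Sum.inl k, hk⟩ => absurd hk (hu k)
        | ⟨Sum.inr i, _⟩ => i
      left_inv := fun i => rfl
      right_inv := fun i => match i with
        | ⟨Sum.inl k, hk⟩ => absurd hk (hu k)
        | ⟨Sum.inr i, _⟩ => rfl }
  rw [← Nat.card_congr e, Nat.card_eq_fintype_card, Fintype.card_fin]

/-- The adjoint operator of `h + e` is triangular with the eigenvalues of `h` on the diagonal. Its
semisimplicity makes the dimension of the centralizer equal to the number of zero eigenvalues. The
basis of `𝔥` accounts for `r` of them, so no root may vanish at `h`. -/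
theorem ne_zero_of_isRegularSemisimple [Module.Finite ℂ (lieAlg H ℂ)] {h e : Dist H K}
    (hh : h ∈ scalarExt 𝔥.toSubmodule K) (he : e ∈ scalarExt (C.filt 1) K)
    (hr : IsRegularSemisimple (Module.finrank ℂ 𝔥) (h + e)) (k : κ) :
    h.ofConv (C.rootFun k) ≠ 0 := by
  classical
  obtain ⟨b, hb, hb'⟩ := C.exists_basis
  obtain ⟨f, hf⟩ := exists_dual_functions b
  have : Module.Finite K (lieAlg H K) := Module.Finite.of_basis (extBasis b hf K)
  have hd : ∀ j, LieAlgebra.ad K (lieAlg H K) ⟨h, isTangent_of_mem_scalarExt hh⟩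
      (extBasis b hf K j) = C.eigenvalue h j • extBasis b hf K j := fun j =>
    Subtype.ext (C.ad_extBasis hb hb' hf hh j)
  obtain ⟨hx, hs, hk⟩ := hr
  rw [finrank_ker_of_triangular (extBasis b hf K) (w := Sum.elim C.wt 0) hd (fun i j hij => by
    rw [extBasis_repr, ← C.extBasis_repr_lie hb hb' hf he i j hij]
    change (⁅h + e, (extBasis b hf K j).1⁆ - C.eigenvalue h j • (extBasis b hf K j).1).ofConv _ = _
    rw [add_lie, C.ad_extBasis hb hb' hf hh, add_sub_cancel_left]) hs] at hk
  intro h0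
  let φ : Option (Fin (Module.finrank ℂ 𝔥)) →
      {i : κ ⊕ Fin (Module.finrank ℂ 𝔥) // C.eigenvalue h i = 0} := fun o => match o with
    | none => ⟨Sum.inl k, h0⟩
    | some i => ⟨Sum.inr i, rfl⟩
  have hφ : Function.Injective φ := by
    rintro (_ | i) (_ | j) hij
    · rfl
    · exact absurd (congrArg Subtype.val hij) (by simp [φ])
    · exact absurd (congrArg Subtype.val hij) (by simp [φ])
    · simpa [φ] using congrArg Subtype.val hij
  have := Nat.card_le_card_of_injective φ hφ
  rw [hk, Nat.card_eq_fintype_card, Fintype.card_option, Fintype.card_fin] at this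
  omega

theorem isRegularFamily_of_isUnit [Module.Finite ℂ (lieAlg H ℂ)] {h : Dist H R}
    (hh : h ∈ scalarExt 𝔥.toSubmodule R) (hu : ∀ k, IsUnit (h.ofConv (C.rootFun k))) :
    IsRegularFamily (Module.finrank ℂ 𝔥) h := fun _ _ _ _ φ =>
  C.isRegularSemisimple_of_ne_zero (distMap_mem_scalarExt φ _ hh) fun k => ((hu k).map φ).ne_zero

/-- A nonunit lies in a maximal ideal and so vanishes at the corresponding geometric point, where
the element is still regular semisimple. -/
theorem isUnit_of_isRegularFamily [Module.Finite ℂ (lieAlg H ℂ)] {h e : Dist H R}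
    (hh : h ∈ scalarExt 𝔥.toSubmodule R) (he : e ∈ scalarExt (C.filt 1) R)
    (hr : IsRegularFamily (Module.finrank ℂ 𝔥) (h + e)) (k : κ) :
    IsUnit (h.ofConv (C.rootFun k)) := by
  by_contra hnu
  obtain ⟨I, hI, hmem⟩ := exists_max_ideal_of_mem_nonunits hnu
  let _ : Field (R ⧸ I) := Ideal.Quotient.field I
  let φ : R →ₐ[ℂ] AlgebraicClosure (R ⧸ I) :=
    (IsScalarTower.toAlgHom ℂ (R ⧸ I) (AlgebraicClosure (R ⧸ I))).comp (Ideal.Quotient.mkₐ ℂ I)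
  have h1 := hr (AlgebraicClosure (R ⧸ I)) φ
  rw [map_add] at h1
  refine C.ne_zero_of_isRegularSemisimple (distMap_mem_scalarExt φ _ hh)
    (distMap_mem_scalarExt φ _ he) h1 k ?_
  rw [distMap_apply]
  change algebraMap (R ⧸ I) (AlgebraicClosure (R ⧸ I)) (Ideal.Quotient.mk I _) = 0
  rw [Ideal.Quotient.eq_zero_iff_mem.2 hmem, map_zero]

end RootChart

theorem exists_rootChart {𝔥 𝔟 : LieSubalgebra ℂ (lieAlg H ℂ)} [Module.Finite ℂ (lieAlg H ℂ)]
    [LieAlgebra.IsKilling ℂ (lieAlg H ℂ)] [𝔥.IsCartanSubalgebra] [LieAlgebra.IsSolvable 𝔟]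
    (hle : 𝔥 ≤ 𝔟) : Nonempty (RootChart 𝔥 𝔟 𝔥.root) := by
  obtain ⟨F⟩ := exists_rootFrame hle
  choose c hc using fun k => exists_eval (F.coord k)
  choose d hd using fun k => exists_eval (F.root k)
  exact ⟨{ F with crdFun := c, rootFun := d, coord_eq := hc, root_eq := hd }⟩

end Regular

/-! ### Normal forms of connections; the isomorphism of functors -/

section NormalForm

open scoped PowerSeries LaurentSeries

variable {H : Type u} [CommRing H] [HopfAlgebra ℂ H]
variable {R : Type v} [CommRing R] [Algebra ℂ R]
variable {R' : Type v} [CommRing R'] [Algebra ℂ R']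
variable {𝔥 𝔟 : LieSubalgebra ℂ (lieAlg H ℂ)} {κ : Type*} [Fintype κ]

theorem ls_ext {A A' : Dist H R⸨X⸩} (h : ∀ k, lsCoeff k A = lsCoeff k A') : A = A' :=
  dist_ext fun a => by
    ext k
    exact congrArg (fun Z : Dist H R => Z.ofConv a) (h k)

theorem isTangent_of_lsCoeff {A : Dist H R⸨X⸩} (h : ∀ k, IsTangent (lsCoeff k A)) :
    IsTangent A := by
  intro a b
  ext k
  have := h k a b
  simp only [lsCoeff_apply] at this
  rw [this, HahnSeries.coeff_add]
  rfl

theorem IsShift.lsCoeff_nat {n : ℕ} {B : Dist H R⟦X⟧} {A : Dist H R⸨X⸩} (h : IsShift n B A)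
    (i : ℕ) : lsCoeff ((i : ℤ) - n) A = psCoeff i B := ((isShift_iff.1 h).2 i).symm

theorem IsShift.lsCoeff_cases {n : ℕ} {B : Dist H R⟦X⟧} {A : Dist H R⸨X⸩} (h : IsShift n B A)
    (k : ℤ) : (k < -(n : ℤ) ∧ lsCoeff k A = 0) ∨
      ∃ i : ℕ, k = (i : ℤ) - n ∧ lsCoeff k A = psCoeff i B := by
  by_cases hk : k < -(n : ℤ)
  · exact Or.inl ⟨hk, (isShift_iff.1 h).1 k hk⟩
  · refine Or.inr ⟨(k + n).toNat, by omega, ?_⟩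
    rw [← h.lsCoeff_nat]
    congr 1
    omega

theorem IsShift.lsCoeff_neg {n : ℕ} {B : Dist H R⟦X⟧} {A : Dist H R⸨X⸩} (h : IsShift n B A) :
    lsCoeff (-(n : ℤ)) A = psCoeff 0 B := by
  rw [← h.lsCoeff_nat]
  congr 1
  simp

/-- A connection in normal form with given coefficients. -/
theorem exists_conn_of_coeffs (hle : 𝔥 ≤ 𝔟) {n : ℕ} {B : Dist H R⟦X⟧}
    (hB : ∀ i, psCoeff i B ∈ scalarExt 𝔥.toSubmodule R)
    (hz : ∀ i, 2 * n - 1 ≤ i → psCoeff i B = 0)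
    (hr : IsRegularFamily (Module.finrank ℂ 𝔥) (psCoeff 0 B)) :
    ∃ A : Conn R 𝔥 𝔟 n, IsShift n B A.1 ∧ IsNormalForm A := by
  obtain ⟨A, hA⟩ := exists_isShift_left n B
  have hmem : ∀ k, lsCoeff k A ∈ scalarExt 𝔥.toSubmodule R := by
    intro k
    rcases hA.lsCoeff_cases k with ⟨_, h⟩ | ⟨i, _, h⟩
    · rw [h]
      exact Submodule.zero_mem _
    · rw [h]
      exact hB i
  refine ⟨⟨A, isTangent_of_lsCoeff fun k => isTangent_of_mem_scalarExt (hmem k),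
    (isShift_iff.1 hA).1, fun k _ => scalarExt_mono hle (hmem k), ?_⟩, hA, hmem, fun k hk => ?_⟩
  · rw [hA.lsCoeff_neg]
    exact hr
  · rcases hA.lsCoeff_cases k with ⟨_, h⟩ | ⟨i, hi, h⟩
    · exact h
    · rw [h]
      exact hz i (by omega)

namespace RootChart

variable [Module.Finite ℂ (lieAlg H ℂ)] [LieAlgebra.IsSolvable 𝔟]

theorem exists_conn_normalForm (C : RootChart 𝔥 𝔟 κ) (hle : 𝔥 ≤ 𝔟) {n : ℕ} (hn : 2 ≤ n)
    (A : Conn R 𝔥 𝔟 n) :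
    ∃ A' : Conn R 𝔥 𝔟 n, ConnQuot.mk A' = ConnQuot.mk A ∧ IsNormalForm A' := by
  obtain ⟨B, hB⟩ := exists_isShift A.2.pole
  have hBp : ∀ i < n, psCoeff i B ∈ scalarExt 𝔟.toSubmodule R := fun i hi => by
    rw [← hB.lsCoeff_nat]
    exact A.2.polar _ (by omega)
  have hBt : IsTangent B := isTangent_of_psCoeff fun i => by
    rw [← hB.lsCoeff_nat]
    exact IsTangent.lsCoeff A.2.tangent _
  obtain ⟨h, hh, e, he, hhe⟩ := C.exists_of_mem_borel (hBp 0 (by omega))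
  have hreg := A.2.nonresonant
  rw [hB.lsCoeff_neg, hhe] at hreg
  have hu := C.isUnit_of_isRegularFamily hh he hreg
  obtain ⟨g, hg, h0, hc, hz⟩ := C.exists_normalForm hn hBt hBp hh
    (by rw [hhe, add_sub_cancel_left]; exact he) hu
  obtain ⟨A', hA', hnf⟩ := exists_conn_of_coeffs hle hc hz
    (by rw [h0]; exact C.isRegularFamily_of_isUnit hh hu)
  refine ⟨A', (Quotient.sound (s := gaugeSetoid R 𝔥 𝔟 n) ⟨g, hg, ?_⟩).symm, hnf⟩
  exact (gauge_isShift_iff hB hA').2 (shiftGauge_eq_iff.1 rfl)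

theorem normalForm_unique (C : RootChart 𝔥 𝔟 κ) {n : ℕ} (hn : 2 ≤ n)
    {A A' : Conn R 𝔥 𝔟 n} (h : IsNormalForm A) (h' : IsNormalForm A')
    (hq : ConnQuot.mk A = ConnQuot.mk A') : A = A' := by
  obtain ⟨g, hg, hgA⟩ := Quotient.exact (s := gaugeSetoid R 𝔥 𝔟 n) hq
  obtain ⟨B, hB⟩ := exists_isShift A.2.pole
  obtain ⟨B', hB'⟩ := exists_isShift A'.2.pole
  have hu : ∀ k, IsUnit ((psCoeff 0 B).ofConv (C.rootFun k)) := by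
    rw [← hB.lsCoeff_neg]
    refine C.isUnit_of_isRegularFamily (h.1 _) (Submodule.zero_mem _) ?_
    rw [add_zero]
    exact A.2.nonresonant
  have := C.eq_of_gauge (by omega) (fun i => by rw [← hB.lsCoeff_nat]; exact h.1 _)
    (fun i => by rw [← hB'.lsCoeff_nat]; exact h'.1 _)
    (fun i hi => by rw [← hB.lsCoeff_nat]; exact h.2 _ (by omega))
    (fun i hi => by rw [← hB'.lsCoeff_nat]; exact h'.2 _ (by omega)) hu hg
    ((gauge_isShift_iff hB hB').1 hgA)
  subst this
  exact Subtype.ext (hB.unique_right hB')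

theorem existsUnique_normalForm (C : RootChart 𝔥 𝔟 κ) (hle : 𝔥 ≤ 𝔟) {n : ℕ} (hn : 2 ≤ n)
    (c : ConnQuot R 𝔥 𝔟 n) :
    ∃! A : Conn R 𝔥 𝔟 n, ConnQuot.mk A = c ∧ IsNormalForm A := by
  obtain ⟨A, rfl⟩ := Quotient.exists_rep c
  obtain ⟨A', h1, h2⟩ := C.exists_conn_normalForm hle hn A
  exact ⟨A', ⟨h1, h2⟩, fun A'' h => C.normalForm_unique hn h.2 h2 (h.1.trans h1.symm)⟩

end RootChart

theorem normalCoeffs_injective {n : ℕ} {A A' : Conn R 𝔥 𝔟 n} {h : IsNormalForm A}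
    {h' : IsNormalForm A'} (he : normalCoeffs A h = normalCoeffs A' h') : A = A' := by
  refine Subtype.ext (ls_ext fun k => ?_)
  have h1 : lsCoeff (-(n : ℤ)) A.1 = lsCoeff (-(n : ℤ)) A'.1 :=
    congrArg (fun p : CartanPoints R 𝔥 (2 * n - 2) => p.1.1.1) he
  have h2 : ∀ i : Fin (2 * n - 2), lsCoeff (-(n : ℤ) + 1 + (i : ℤ)) A.1 =
      lsCoeff (-(n : ℤ) + 1 + (i : ℤ)) A'.1 := fun i =>
    congrArg (fun p : CartanPoints R 𝔥 (2 * n - 2) => (p.2 i).1) he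
  rcases lt_trichotomy k (-(n : ℤ)) with hk | rfl | hk
  · rw [A.2.pole k hk, A'.2.pole k hk]
  · exact h1
  · by_cases hk' : (n : ℤ) - 2 < k
    · rw [h.2 k hk', h'.2 k hk']
    · have := h2 ⟨(k + n - 1).toNat, by omega⟩
      simp only at this
      rwa [show -(n : ℤ) + 1 + ((k + n - 1).toNat : ℤ) = k by omega] at this

theorem normalCoeffs_surjective [Module.Finite ℂ (lieAlg H ℂ)] (hle : 𝔥 ≤ 𝔟) {n : ℕ} (hn : 2 ≤ n)
    (p : CartanPoints R 𝔥 (2 * n - 2)) :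
    ∃ (A : Conn R 𝔥 𝔟 n) (h : IsNormalForm A), normalCoeffs A h = p := by
  -- After multiplication by `z^n`, index `0` carries `α_n` and index `i ≥ 1` the entry `i - 1` of
  -- the remaining tuple; the entries end at index `2n - 2`.
  obtain ⟨B, hB⟩ := exists_psCoeff fun i => if i = 0 then p.1.1.1 else
    if h : i - 1 < 2 * n - 2 then (p.2 ⟨i - 1, h⟩).1 else 0
  have hB0 : psCoeff 0 B = p.1.1.1 := hB 0
  obtain ⟨A, hA, hnf⟩ := exists_conn_of_coeffs (B := B) (n := n) hle (fun i => by
    rw [hB]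
    split_ifs
    · exact p.1.1.2
    · exact (p.2 _).2
    · exact Submodule.zero_mem _) (fun i hi => by
      rw [hB, if_neg (by omega), dif_neg (by omega)]) (by rw [hB0]; exact p.1.2)
  refine ⟨A, hnf, Prod.ext (Subtype.ext (Subtype.ext ?_)) (funext fun i => Subtype.ext ?_)⟩
  · exact hA.lsCoeff_neg.trans hB0
  · change lsCoeff (-(n : ℤ) + 1 + (i : ℤ)) A.1 = _
    have := hA.lsCoeff_nat (i + 1)
    rw [hB, if_neg (by omega), dif_pos (by omega)] at this
    rw [show -(n : ℤ) + 1 + (i : ℤ) = ((i : ℕ) + 1 : ℕ) - n by push_cast; ring]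
    exact this

theorem IsNormalForm.map (φ : R →ₐ[ℂ] R') {n : ℕ} {A : Conn R 𝔥 𝔟 n} (h : IsNormalForm A) :
    IsNormalForm (Conn.map φ A) :=
  ⟨fun k => distMap_mem_scalarExt φ _ (h.1 k), fun k hk => by
    change distMap φ (lsCoeff k A.1) = 0
    rw [h.2 k hk, map_zero]⟩

/-- The isomorphism given by the coefficients of the normal form. -/
theorem RootChart.exists_iso (C : RootChart 𝔥 𝔟 κ) [Module.Finite ℂ (lieAlg H ℂ)]
    [LieAlgebra.IsSolvable 𝔟] (hle : 𝔥 ≤ 𝔟) {n : ℕ} (hn : 2 ≤ n) :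
    ∃ e : connQuotFunctor.{u, v} 𝔥 𝔟 n ≅ cartanFunctor.{u, v} 𝔥 (2 * n - 2),
      ∀ (R : CommAlgCat.{v} ℂ) (A : Conn R 𝔥 𝔟 n) (hA : IsNormalForm A),
        e.hom.app R (ConnQuot.mk A) = normalCoeffs A hA := by
  choose N hN _ using fun (R : CommAlgCat.{v} ℂ) (c : ConnQuot R 𝔥 𝔟 n) =>
    C.existsUnique_normalForm hle hn c
  let f : ∀ R : CommAlgCat.{v} ℂ, ConnQuot R 𝔥 𝔟 n → CartanPoints R 𝔥 (2 * n - 2) :=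
    fun R c => normalCoeffs (N R c) (hN R c).2
  have hf : ∀ (R : CommAlgCat.{v} ℂ) (A : Conn R 𝔥 𝔟 n) (hA : IsNormalForm A),
      f R (ConnQuot.mk A) = normalCoeffs A hA := by
    intro R A hA
    have : N R (ConnQuot.mk A) = A := C.normalForm_unique hn (hN R _).2 hA (hN R _).1
    simp only [f, this]
  have hbij : ∀ R, Function.Bijective (f R) := by
    intro R
    constructor
    · intro c c' h
      rw [← (hN R c).1, ← (hN R c').1, normalCoeffs_injective h]
    · intro p
      obtain ⟨A, hA, rfl⟩ := normalCoeffs_surjective hle hn p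
      exact ⟨_, hf R A hA⟩
  refine ⟨NatIso.ofComponents (fun R => (Equiv.ofBijective (f R) (hbij R)).toIso) ?_, hf⟩
  intro R R' φ
  ext c
  change f R' (ConnQuot.map φ.hom c) = CartanPoints.map φ.hom (f R c)
  rw [← (hN R c).1, hf R _ (hN R c).2]
  -- Naturality: the base change of a normal form is a normal form, so by uniqueness it is the one
  -- chosen over `R'`.
  exact hf R' _ ((hN R c).2.map φ.hom)

end NormalForm

/-! ### Krull dimension of a localized polynomial ring -/

section Dimension

variable {σ : Type*}

/-- The translation `X_i ↦ X_i + c_i`. -/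
def translate (c : σ → ℂ) : MvPolynomial σ ℂ ≃ₐ[ℂ] MvPolynomial σ ℂ :=
  AlgEquiv.ofAlgHom (MvPolynomial.aeval fun i => MvPolynomial.X i + MvPolynomial.C (c i))
    (MvPolynomial.aeval fun i => MvPolynomial.X i - MvPolynomial.C (c i))
    (by ext i; simp [MvPolynomial.algHom_C]) (by ext i; simp [MvPolynomial.algHom_C])

theorem height_vanishingIdeal (c : σ → ℂ) :
    (MvPolynomial.vanishingIdeal ℂ {c}).height = (MvPolynomial.vanishingIdeal ℂ {(0 : σ → ℂ)}).height := by
  rw [← RingEquiv.height_comap (translate c).toRingEquiv (MvPolynomial.vanishingIdeal ℂ {(0 : σ → ℂ)})]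
  congr 1
  ext p
  rw [Ideal.mem_comap, MvPolynomial.mem_vanishingIdeal_singleton_iff,
    MvPolynomial.mem_vanishingIdeal_singleton_iff]
  have : (MvPolynomial.aeval (0 : σ → ℂ)).comp (translate c).toAlgHom =
      MvPolynomial.aeval (R := ℂ) c := by
    ext i
    simp [translate]
  rw [← this]
  rfl

/-- The dimension is the supremum of the heights of maximal ideals. By the Nullstellensatz these are
the ideals of points, and translations show that all their heights are equal. -/
theorem coe_height_vanishingIdeal [Finite σ] (c : σ → ℂ) :
    ((MvPolynomial.vanishingIdeal ℂ {c}).height : WithBot ℕ∞) = Nat.card σ := by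
  have h1 := Ideal.sup_isMaximal_height_eq_ringKrullDim (R := MvPolynomial σ ℂ)
  rw [MvPolynomial.ringKrullDim_of_isNoetherianRing, ringKrullDim_eq_zero_of_field, zero_add] at h1
  rw [← h1, WithBot.coe_inj]
  apply le_antisymm
  · exact le_iSup₂_of_le (f := fun (I : Ideal (MvPolynomial σ ℂ)) (_ : I.IsMaximal) => I.height) _
      (MvPolynomial.isMaximal_iff_eq_vanishingIdeal_singleton.2 ⟨c, rfl⟩) le_rfl
  · refine iSup₂_le fun I hI => ?_
    obtain ⟨x, rfl⟩ := MvPolynomial.isMaximal_iff_eq_vanishingIdeal_singleton.1 hI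
    rw [height_vanishingIdeal x, height_vanishingIdeal c]

/-- Heights do not change under contraction from the localization, which bounds the dimension above.
For the lower bound, the ideal of a point where `f` does not vanish survives with full height. -/
theorem ringKrullDim_away [Finite σ] {f : MvPolynomial σ ℂ} (hf : f ≠ 0) :
    ringKrullDim (Localization.Away f) = Nat.card σ := by
  apply le_antisymm
  · rw [ringKrullDim_le_iff_isMaximal_height_le]
    intro J hJ
    rw [← IsLocalization.height_under (Submonoid.powers f) J]
    have hp : (J.under (MvPolynomial σ ℂ)).IsPrime := Ideal.IsPrime.under _ _
    refine (Ideal.height_le_ringKrullDim_of_ne_top hp.ne_top).trans ?_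
    rw [MvPolynomial.ringKrullDim_of_isNoetherianRing, ringKrullDim_eq_zero_of_field, zero_add]
  · obtain ⟨c, hc⟩ : ∃ c : σ → ℂ, MvPolynomial.eval c f ≠ 0 := by
      by_contra hcon
      push Not at hcon
      exact hf (MvPolynomial.funext fun c => by rw [hcon, map_zero])
    have hm : (MvPolynomial.vanishingIdeal ℂ {c}).IsMaximal :=
      MvPolynomial.isMaximal_iff_eq_vanishingIdeal_singleton.2 ⟨c, rfl⟩
    have hd : Disjoint (Submonoid.powers f : Set (MvPolynomial σ ℂ))
        (MvPolynomial.vanishingIdeal ℂ {c} : Set (MvPolynomial σ ℂ)) := by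
      rw [Set.disjoint_left]
      rintro _ ⟨k, rfl⟩ h
      have := hm.isPrime.mem_of_pow_mem k h
      rw [MvPolynomial.mem_vanishingIdeal_singleton_iff, MvPolynomial.aeval_eq_eval] at this
      exact hc this
    have h1 := IsLocalization.height_map_of_disjoint (S := Localization.Away f)
      (Submonoid.powers f) _ hd
    have hp := IsLocalization.isPrime_of_isPrime_disjoint (Submonoid.powers f)
      (Localization.Away f) _ hm.isPrime hd
    rw [← coe_height_vanishingIdeal c, ← h1]
    exact Ideal.height_le_ringKrullDim_of_ne_top hp.ne_top

end Dimension

/-! ### Representability of `𝔥^r × 𝔥^m` -/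

section Representability

variable {H : Type u} [CommRing H] [HopfAlgebra ℂ H]
variable {𝔥 𝔟 : LieSubalgebra ℂ (lieAlg H ℂ)} {κ : Type*} [Fintype κ]

theorem exists_extend_coords [Module.Finite ℂ (lieAlg H ℂ)] {ι : Type*} [Fintype ι] [DecidableEq ι]
    (b : Module.Basis ι ℂ 𝔥) : ∃ f : ι → H,
      (∀ i j, (b j).1.1.ofConv (f i) = if j = i then 1 else 0) ∧
      ∀ (R : Type v) [CommRing R] [Algebra ℂ R] (X : Dist H R), X ∈ scalarExt 𝔥.toSubmodule R →
        X = ∑ i, X.ofConv (f i) • baseExt R (b i).1.1 := by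
  have h1 : ∀ i, ∃ f : H, ∀ x : 𝔥, b.repr x i = x.1.1.ofConv f := by
    intro i
    obtain ⟨l, hl⟩ := LinearMap.exists_extend (p := 𝔥.toSubmodule) (b.coord i)
    obtain ⟨f, hf⟩ := exists_eval l
    refine ⟨f, fun x => ?_⟩
    rw [← hf]
    exact (LinearMap.congr_fun hl x).symm
  choose f hf using h1
  refine ⟨f, fun i j => ?_, fun R _ _ X hX => dist_ext fun a => ?_⟩
  · rw [← hf, b.repr_self, Finsupp.single_apply]
  · have h2 : X.ofConv (a - ∑ i, (b i).1.1.ofConv a • f i) = 0 := by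
      refine (mem_scalarExt_iff.1 hX).2 _ fun x hx => ?_
      rw [map_sub, map_sum, sub_eq_zero]
      let ev : 𝔥 →ₗ[ℂ] ℂ :=
        { toFun := fun x => x.1.1.ofConv a
          map_add' := fun x y => rfl
          map_smul' := fun c x => rfl }
      have h3 : ev (∑ i, b.repr ⟨x, hx⟩ i • b i) = ∑ i, b.repr ⟨x, hx⟩ i • ev (b i) := by
        rw [map_sum]
        exact Finset.sum_congr rfl fun i _ => map_smul _ _ _
      rw [b.sum_repr] at h3
      refine h3.trans (Finset.sum_congr rfl fun i _ => ?_)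
      rw [map_smul, smul_eq_mul, smul_eq_mul, mul_comm, hf]
      rfl
    rw [map_sub, map_sum, sub_eq_zero] at h2
    rw [h2, sum_ofConv]
    exact Finset.sum_congr rfl fun i _ => by
      rw [map_smul, smul_ofConv, baseExt_apply, Algebra.smul_def, mul_comm]

variable {R : Type v} [CommRing R] [Algebra ℂ R]
variable {R' : Type v} [CommRing R'] [Algebra ℂ R']

/-- The element of `𝔥 ⊗ R` with given coordinates. -/
def cartanSum {ι : Type*} [Fintype ι] (b : Module.Basis ι ℂ 𝔥) (c : ι → R) : Dist H R :=
  ∑ i, c i • baseExt R (b i).1.1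

theorem cartanSum_mem {ι : Type*} [Fintype ι] (b : Module.Basis ι ℂ 𝔥) (c : ι → R) :
    cartanSum b c ∈ scalarExt 𝔥.toSubmodule R :=
  Submodule.sum_mem _ fun i _ => Submodule.smul_mem _ _ (baseExt_mem_scalarExt (b i).2)

theorem cartanSum_apply {ι : Type*} [Fintype ι] (b : Module.Basis ι ℂ 𝔥) (c : ι → R) (a : H) :
    (cartanSum b c).ofConv a = ∑ i, c i * algebraMap ℂ R ((b i).1.1.ofConv a) := by
  rw [cartanSum, sum_ofConv]
  rfl

theorem distMap_cartanSum {ι : Type*} [Fintype ι] (b : Module.Basis ι ℂ 𝔥) (c : ι → R)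
    (φ : R →ₐ[ℂ] R') : distMap φ (cartanSum b c) = cartanSum b fun i => φ (c i) := by
  rw [cartanSum, map_sum]
  exact Finset.sum_congr rfl fun i _ => by rw [distMap_smul, distMap_baseExt]

namespace RootChart

variable (C : RootChart 𝔥 𝔟 κ)

/-- The product of the roots as a polynomial in the coordinates of the leading coefficient. -/
def discPoly {ι σ : Type*} [Fintype ι] (b : Module.Basis ι ℂ 𝔥) (s : ι → σ) : MvPolynomial σ ℂ :=
  ∏ k, ∑ i, MvPolynomial.X (s i) * MvPolynomial.C ((b i).1.1.ofConv (C.rootFun k))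

theorem aeval_discPoly {ι σ : Type*} [Fintype ι] (b : Module.Basis ι ℂ 𝔥) (s : ι → σ)
    (c : σ → R) : MvPolynomial.aeval c (C.discPoly b s) =
      ∏ k, (cartanSum b fun i => c (s i)).ofConv (C.rootFun k) := by
  rw [discPoly, map_prod]
  refine Finset.prod_congr rfl fun k _ => ?_
  rw [map_sum, cartanSum_apply]
  exact Finset.sum_congr rfl fun i _ => by
    rw [map_mul, MvPolynomial.aeval_X, MvPolynomial.aeval_C]

theorem discPoly_ne_zero {ι σ : Type*} [Fintype ι] (b : Module.Basis ι ℂ 𝔥) {s : ι → σ}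
    (hs : Function.Injective s) : C.discPoly b s ≠ 0 := by
  rw [discPoly, Finset.prod_ne_zero_iff]
  intro k _ h0
  obtain ⟨x, hx, hne⟩ := C.root_ne k
  apply hne
  -- The coordinates of an `x ∈ 𝔥` where the root is nonzero; at this point the linear factor takes
  -- the value of the root.
  let c : σ → ℂ := Function.extend s (b.repr ⟨x, hx⟩) 0
  have h1 := congrArg (MvPolynomial.eval c) h0
  rw [map_sum, map_zero] at h1
  let l : 𝔥 →ₗ[ℂ] ℂ :=
    { toFun := fun x => C.root k x.1
      map_add' := fun x y => map_add _ _ _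
      map_smul' := fun c x => map_smul _ _ _ }
  have h2 : l (∑ i, b.repr ⟨x, hx⟩ i • b i) = ∑ i, b.repr ⟨x, hx⟩ i • l (b i) := by
    rw [map_sum]
    exact Finset.sum_congr rfl fun i _ => map_smul _ _ _
  rw [b.sum_repr] at h2
  refine h2.trans (Eq.trans (Finset.sum_congr rfl fun i _ => ?_) h1)
  rw [map_mul, MvPolynomial.eval_X, MvPolynomial.eval_C, smul_eq_mul, ← C.root_eq]
  congr 1
  exact (hs.extend_apply _ _ _).symm

theorem isRegularFamily_iff [Module.Finite ℂ (lieAlg H ℂ)] {X : Dist H R}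
    (hX : X ∈ scalarExt 𝔥.toSubmodule R) :
    IsRegularFamily (Module.finrank ℂ 𝔥) X ↔ IsUnit (∏ k, X.ofConv (C.rootFun k)) := by
  constructor
  · intro h
    refine Finset.prod_induction _ IsUnit (fun _ _ => IsUnit.mul) isUnit_one fun k _ => ?_
    refine C.isUnit_of_isRegularFamily hX (Submodule.zero_mem _) ?_ k
    rwa [add_zero]
  · intro h
    exact C.isRegularFamily_of_isUnit hX fun k =>
      isUnit_of_dvd_unit (Finset.dvd_prod_of_mem (fun k => X.ofConv (C.rootFun k)) (Finset.mem_univ k)) h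

/-- The functor of points of `𝔥^r × 𝔥^m` is an affine variety. -/
theorem isAffineVariety_cartanFunctor (C : RootChart 𝔥 𝔟 κ) [Module.Finite ℂ (lieAlg H ℂ)] (m : ℕ) :
    IsAffineVarietyOfDim.{u, v} (cartanFunctor.{u, v} 𝔥 m)
      ((m + 1) * Module.finrank ℂ 𝔥) := by
  classical
  let b := Module.finBasis ℂ 𝔥
  obtain ⟨f, hf, hfs⟩ := exists_extend_coords.{u, v} b
  -- The block `none` holds the coordinates of the regular leading coefficient, and the blocks `some
  -- j` those of the free ones. The lift places the representing algebra in the universe of the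
  -- coefficient algebras.
  let σ := ULift.{v} (Option (Fin m) × Fin (Module.finrank ℂ 𝔥))
  let s : Fin (Module.finrank ℂ 𝔥) → σ := fun i => ⟨(none, i)⟩
  have hs : Function.Injective s := fun i j h => by
    have := congrArg ULift.down h
    exact (Prod.ext_iff.1 this).2
  let D : MvPolynomial σ ℂ := C.discPoly b s
  have hD : D ≠ 0 := C.discPoly_ne_zero b hs
  let A := Localization.Away D
  let var : σ → A := fun t => algebraMap (MvPolynomial σ ℂ) A (MvPolynomial.X t)
  have hcomp : ∀ {R : Type v} [CommRing R] [Algebra ℂ R] (ψ : A →ₐ[ℂ] R) (p : MvPolynomial σ ℂ),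
      ψ (algebraMap (MvPolynomial σ ℂ) A p) = MvPolynomial.aeval (fun t => ψ (var t)) p := by
    intro R _ _ ψ p
    have : ψ.comp (IsScalarTower.toAlgHom ℂ (MvPolynomial σ ℂ) A) =
        MvPolynomial.aeval fun t => ψ (var t) := by
      ext t
      simp [var]
    exact AlgHom.congr_fun this p
  have hcoord : ∀ {R : Type v} [CommRing R] [Algebra ℂ R]
      (c : Fin (Module.finrank ℂ 𝔥) → R) i, (cartanSum b c).ofConv (f i) = c i := by
    intro R _ _ c i
    rw [cartanSum_apply, Finset.sum_eq_single i]
    · rw [hf, if_pos rfl, map_one, mul_one]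
    · intro j _ hj
      rw [hf, if_neg hj, map_zero, mul_zero]
    · simp
  let F : ∀ (R : Type v) [CommRing R] [Algebra ℂ R], (A →ₐ[ℂ] R) → CartanPoints R 𝔥 m :=
    fun R _ _ ψ =>
      (⟨⟨cartanSum b fun i => ψ (var (s i)), cartanSum_mem _ _⟩, by
        -- Regularity is the invertibility of the product of the roots, that is, of the image of
        -- `D`, which the localization makes a unit.
        rw [C.isRegularFamily_iff (cartanSum_mem _ _)]
        rw [← C.aeval_discPoly b s fun t => ψ (var t), ← hcomp]
        exact (IsLocalization.Away.algebraMap_isUnit D).map ψ⟩,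
      fun j => ⟨cartanSum b fun i => ψ (var ⟨(some j, i)⟩), cartanSum_mem _ _⟩)
  have hbij : ∀ (R : Type v) [CommRing R] [Algebra ℂ R], Function.Bijective (F R) := by
    intro R _ _
    constructor
    · intro ψ ψ' h
      have h1 : ∀ i, ψ (var (s i)) = ψ' (var (s i)) := fun i => by
        have := congrArg (fun p : CartanPoints R 𝔥 m => p.1.1.1.ofConv (f i)) h
        simpa only [F, hcoord] using this
      have h2 : ∀ j i, ψ (var ⟨(some j, i)⟩) = ψ' (var ⟨(some j, i)⟩) := fun j i => by
        have := congrArg (fun p : CartanPoints R 𝔥 m => (p.2 j).1.ofConv (f i)) h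
        simpa only [F, hcoord] using this
      have h3 : ∀ t, ψ (var t) = ψ' (var t) := by
        rintro ⟨_ | j, i⟩
        · exact h1 i
        · exact h2 j i
      refine IsLocalization.algHom_ext (Submonoid.powers D) ?_
      refine AlgHom.ext fun p => ?_
      change ψ (algebraMap _ A p) = ψ' (algebraMap _ A p)
      rw [hcomp, hcomp]
      simp only [h3]
    · intro p
      let c : σ → R := fun t => match t.down with
        | (none, i) => p.1.1.1.ofConv (f i)
        | (some j, i) => (p.2 j).1.ofConv (f i)
      have h1 : cartanSum b (fun i => c (s i)) = p.1.1.1 := (hfs R _ p.1.1.2).symm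
      have hu : ∀ y : Submonoid.powers D, IsUnit (MvPolynomial.aeval (R := ℂ) c (y : MvPolynomial σ ℂ)) := by
        rintro ⟨_, k, rfl⟩
        rw [map_pow, C.aeval_discPoly, h1]
        exact ((C.isRegularFamily_iff p.1.1.2).1 p.1.2).pow k
      refine ⟨IsLocalization.liftAlgHom (M := Submonoid.powers D) (f := MvPolynomial.aeval c) hu, ?_⟩
      have h2 : ∀ t, IsLocalization.liftAlgHom (M := Submonoid.powers D) (S := A)
          (f := MvPolynomial.aeval c) hu (var t) = c t := by
        intro t
        change IsLocalization.lift hu (algebraMap _ A _) = _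
        rw [IsLocalization.lift_eq]
        exact MvPolynomial.aeval_X c t
      refine Prod.ext (Subtype.ext (Subtype.ext ?_)) (funext fun j => Subtype.ext ?_)
      · change cartanSum b _ = _
        simp only [h2]
        exact h1
      · change cartanSum b _ = _
        simp only [h2]
        exact (hfs R _ (p.2 j).2).symm
  refine ⟨CommAlgCat.of ℂ A, ?_, ?_, ?_, ⟨(NatIso.ofComponents (fun R =>
    (Equiv.ofBijective (fun x : ULift.{u} (CommAlgCat.of ℂ A ⟶ R) => F R x.down.hom) ?_).toIso)
    ?_).symm⟩⟩
  · have : Algebra.FiniteType (MvPolynomial σ ℂ) A := IsLocalization.finiteType_of_monoid_fg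
      (Submonoid.powers D) A
    exact Algebra.FiniteType.trans (S := MvPolynomial σ ℂ) inferInstance this
  · exact IsLocalization.isDomain_localization (powers_le_nonZeroDivisors_of_noZeroDivisors hD)
  · refine (ringKrullDim_away hD).trans ?_
    rw [Nat.card_eq_fintype_card]
    simp [σ]
  · constructor
    · intro x y h
      exact ULift.ext _ _ (CommAlgCat.hom_ext ((hbij R).1 h))
    · intro p
      obtain ⟨ψ, hψ⟩ := (hbij R).2 p
      exact ⟨⟨CommAlgCat.ofHom ψ⟩, hψ⟩
  · intro R R' φ
    ext x
    refine Prod.ext (Subtype.ext (Subtype.ext ?_)) (funext fun j => Subtype.ext ?_)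
    · exact (distMap_cartanSum b _ φ.hom).symm
    · exact (distMap_cartanSum b _ φ.hom).symm

end RootChart

end Representability

end

end FormalConn

theorem mainTheorem7 {H : Type u} [CommRing H] [HopfAlgebra ℂ H]
    (hG : FormalConn.IsConnectedSemisimple H)
    (𝔥 𝔟 : LieSubalgebra ℂ (FormalConn.lieAlg H ℂ))
    (h𝔥 : 𝔥.IsCartanSubalgebra) (h𝔟 : FormalConn.IsBorel 𝔟) (h𝔥𝔟 : 𝔥 ≤ 𝔟)
    (n : ℕ) (hn : 2 ≤ n) :
    (∀ (R : Type v) [CommRing R] [Algebra ℂ R] (c : FormalConn.ConnQuot R 𝔥 𝔟 n),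
      ∃! A : FormalConn.Conn R 𝔥 𝔟 n, FormalConn.ConnQuot.mk A = c ∧ FormalConn.IsNormalForm A) ∧
    (∃ e : FormalConn.connQuotFunctor.{u, v} 𝔥 𝔟 n ≅
        FormalConn.cartanFunctor.{u, v} 𝔥 (2 * n - 2),
      ∀ (R : CommAlgCat.{v} ℂ) (A : FormalConn.Conn R 𝔥 𝔟 n) (hA : FormalConn.IsNormalForm A),
        e.hom.app R (FormalConn.ConnQuot.mk A) = FormalConn.normalCoeffs A hA) ∧
    FormalConn.IsAffineVarietyOfDim.{u, v} (FormalConn.connQuotFunctor.{u, v} 𝔥 𝔟 n)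
      ((2 * n - 1) * Module.finrank ℂ 𝔥) := by
  have h1 : Algebra.FiniteType ℂ H := hG.finiteType
  have h2 : Module.Finite ℂ (FormalConn.lieAlg H ℂ) := FormalConn.finite_lieAlg
  have h3 : LieAlgebra.IsSemisimple ℂ (FormalConn.lieAlg H ℂ) := hG.semisimple
  have h4 : LieAlgebra.IsSolvable 𝔟 := h𝔟.prop
  -- Semisimplicity enters here, as nondegeneracy of the Killing form.
  obtain ⟨C⟩ := FormalConn.exists_rootChart h𝔥𝔟
  refine ⟨fun R _ _ c => C.existsUnique_normalForm h𝔥𝔟 hn c, C.exists_iso h𝔥𝔟 hn, ?_⟩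
  obtain ⟨e, -⟩ := FormalConn.RootChart.exists_iso.{u, v} C h𝔥𝔟 hn
  obtain ⟨A, hft, hdom, hdim, ⟨i⟩⟩ := C.isAffineVariety_cartanFunctor (2 * n - 2)
  refine ⟨A, hft, hdom, ?_, ⟨e ≪≫ i⟩⟩
  rw [hdim, show 2 * n - 2 + 1 = 2 * n - 1 by omega]
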